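/- Notation. $C_0^\infty(\mathbb R^n\setminus 0)$ denotes the complex-valued smooth functions with compact support in $\mathbb R^n\setminus\{0\}$, $\mathcal H^1$ is the usual Sobolev space $\{g\in L^2(\mathbb R^n):\nabla g\in L^2\}$ with $\|g\|_{\mathcal H^1}^2=\|g\|_{L^2}^2+\|\nabla g\|_{L^2}^2$, and $\langle f,g\rangle=\int f\bar g\,dx$. Let $V:\mathbb R^n\to\mathbb R$ be locally integrable on $\mathbb R^n\setminus\{0\}$, and suppose that $x\cdot\nabla V$, taken in the sense of distributions on $\mathbb R^n\setminus\{0\}$, is a locally integrable function there. Put $Q_H(f,g)=\langle\nabla f,\nabla g\rangle+\int Vf\bar g\,dx$ for $f,g\in C_0^\infty(\mathbb R^n\setminus 0)$. When $Q_H$ is nonnegative (as it is in both parts below), let $\mathcal G^1\subset L^2$ be the closure of $C_0^\infty(\mathbb R^n\setminus 0)$ for the norm $(\|f\|_{L^2}^2+Q_H(f,f))^{1/2}$, extend $Q_H$ continuously to $\mathcal G^1$, and let $H$ be the self-adjoint realization of $-\Delta+V$: $u\in D(H)$ and $Hu=h$ if and only if $u\in\mathcal G^1$, $h\in L^2$ and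 $Q_H(u,g)=\langle h,g\rangle$ for all $g\in\mathcal G^1$. **Theorem.** (1) Let $n\ge 3$. Suppose that there is $\delta_0>0$ such that for all $f\in C_0^\infty(\mathbb R^n\setminus 0)$ $$\langle(-\Delta+V)f,f\rangle\ge\delta_0\|\nabla f\|_{L^2}^2,\qquad \langle(-\Delta-V-x\cdot\nabla V)f,f\rangle\ge\delta_0\|\nabla f\|_{L^2}^2$$ (in the form sense), and that for some constant $C_0$ $$\big\||V|^{1/2}g\big\|_{L^2}+\big\||x\cdot\nabla V|^{1/2}g\big\|_{L^2}+\big\||x|Vg\big\|_{L^2}\le C_0\|g\|_{\mathcal H^1},\qquad g\in\mathcal H^1(\mathbb R^n).$$ Then every $z\in\mathbb C\setminus[0,\infty)$ is in the resolvent set of $H$, and there is $C>0$, independent of $z$ and $f$, such that $$\big\||x|^{-1}(H-z)^{-1}|x|^{-1}f\big\|_{L^2}\le C\|f\|_{L^2},\qquad z\in\mathbb C\setminus[0,\infty),\ f\in C_0^\infty(\mathbb R^n\setminus 0).$$ (2) Let $n=2$. Suppose that $|x|^2(x\cdot\nabla)^\ell V\in L^\infty(\mathbb R^2)$ for $\ell=0,1,2$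 (derivatives in the sense of distributions on $\mathbb R^2\setminus\{0\}$), that there is $\delta_0>0$ such that almost everywhere on $\mathbb R^2$ $$V>0,\qquad \delta_0^{-1}V\ge -x\cdot\nabla V\ge(1+\delta_0)V,$$ and that $V^{-1}$ is locally integrable on $\mathbb R^2$. Then every $z\in\mathbb C\setminus[0,\infty)$ is in the resolvent set of $H$, and there is $C>0$, independent of $z$ and $f$, such that $V^{1/2}f\in L^2(\mathbb R^2)$ and $$\big\|V^{1/2}(H-z)^{-1}V^{1/2}f\big\|_{L^2}\le C\|f\|_{L^2},\qquad z\in\mathbb C\setminus[0,\infty),\ f\in C_0^\infty(\mathbb R^2\setminus 0).$$ -/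

import Mathlib

open MeasureTheory Filter Topology TopologicalSpace
open scoped Distributions ENNReal NNReal

noncomputable section

/-- Euclidean space `ℝⁿ`. -/
abbrev RSpace (n : ℕ) : Type := EuclideanSpace ℝ (Fin n)

/-- `ℝⁿ ∖ {0}` as an open set. -/
def puncturedSpace (n : ℕ) : Opens (RSpace n) := ⟨{0}ᶜ, isOpen_compl_singleton⟩

/-- The space `C₀^∞(ℝⁿ ∖ 0)` of complex-valued test functions. -/
abbrev PuncturedTest (n : ℕ) : Type := 𝓓(puncturedSpace n, ℂ)

/-- The complex Hilbert space `L²(ℝⁿ)`. -/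
abbrev LTwo (n : ℕ) : Type := Lp ℂ 2 (volume : Measure (RSpace n))

/-- The classical partial derivative `∂ᵢ f (x)`. -/
def partialDeriv {n : ℕ} (i : Fin n) (f : RSpace n → ℂ) (x : RSpace n) : ℂ :=
  fderiv ℝ f x (EuclideanSpace.single i (1 : ℝ))

/-- `‖∇ f‖²_{L²}` for a test function `f`. -/
def gradNormSq {n : ℕ} (f : PuncturedTest n) : ℝ :=
  ∫ x, ∑ i : Fin n, ‖partialDeriv i f x‖ ^ 2

/-- The sesquilinear form `⟨f, (-Δ + U) g⟩ = ⟨∇ f, ∇ g⟩ + ∫ U f ḡ` on `C₀^∞(ℝⁿ ∖ 0)`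
(linear in `f`, antilinear in `g`). -/
def schrodingerForm {n : ℕ} (U : RSpace n → ℝ) (f g : PuncturedTest n) : ℂ :=
  (∫ x, ∑ i : Fin n, partialDeriv i f x * starRingEnd ℂ (partialDeriv i g x))
    + ∫ x, (U x : ℂ) * f x * starRingEnd ℂ (g x)

/-- `φ` is a sequence of test functions which converges to `u` in `L²` and is Cauchy for
the form `⟨·, (-Δ + V) ·⟩`; that is, it converges to `u` in the form norm
`(‖f‖² + ⟨f, (-Δ + V) f⟩)^{1/2}`. -/
structure IsFormApprox {n : ℕ} (V : RSpace n → ℝ) (φ : ℕ → PuncturedTest n)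
    (u : LTwo n) : Prop where
  tendsto_L2 : Tendsto (fun j => eLpNorm (fun x => φ j x - u x) 2 volume) atTop (𝓝 0)
  cauchy_form : Tendsto
    (fun p : ℕ × ℕ => schrodingerForm V (φ p.1 - φ p.2) (φ p.1 - φ p.2)) atTop (𝓝 0)

/-- The form domain `𝒢¹`: the closure of `C₀^∞(ℝⁿ ∖ 0)` for the form norm. -/
def formDomain {n : ℕ} (V : RSpace n → ℝ) : Set (LTwo n) :=
  {u | ∃ φ : ℕ → PuncturedTest n, IsFormApprox V φ u}

/-- `q` is the value at `(u, v)` of the continuous extension of the form to `𝒢¹`. -/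
def IsFormValue {n : ℕ} (V : RSpace n → ℝ) (u v : LTwo n) (q : ℂ) : Prop :=
  ∀ φ ψ : ℕ → PuncturedTest n, IsFormApprox V φ u → IsFormApprox V ψ v →
    Tendsto (fun j => schrodingerForm V (φ j) (ψ j)) atTop (𝓝 q)

/-- The graph of the self-adjoint realization `H` of `-Δ + V`: `u ∈ D(H)` and `H u = h`
when `u ∈ 𝒢¹` and `Q_H(u, g) = ⟨h, g⟩ = ∫ h ḡ` for all `g ∈ 𝒢¹`. -/
def HamiltonianGraph {n : ℕ} (V : RSpace n → ℝ) (u h : LTwo n) : Prop :=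
  u ∈ formDomain V ∧ ∀ g ∈ formDomain V, IsFormValue V u g (inner ℂ g h)

/-- The bounded operator `R` on `L²` is the resolvent `(H - z)⁻¹`: it maps `L²` into `D(H)`,
`(H - z) R h = h` for `h ∈ L²`, and `R (H - z) u = u` for `u ∈ D(H)`. -/
structure IsResolvent {n : ℕ} (V : RSpace n → ℝ) (z : ℂ) (R : LTwo n →L[ℂ] LTwo n) :
    Prop where
  right_inv : ∀ h : LTwo n, HamiltonianGraph V (R h) (h + z • R h)
  left_inv : ∀ u h : LTwo n, HamiltonianGraph V u h → R (h - z • u) = u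

/-- The uniform estimate `‖w (H - z)⁻¹ w f‖_{L²} ≤ C ‖f‖_{L²}` for all `z ∈ ℂ ∖ [0, ∞)` and
`f ∈ C₀^∞(ℝⁿ ∖ 0)`, including that `z` belongs to the resolvent set of `H` and that
`w f ∈ L²`. -/
def UniformResolventEstimate {n : ℕ} (V w : RSpace n → ℝ) : Prop :=
  ∃ C : ℝ≥0, 0 < C ∧ ∀ z : ℂ, z ∉ Complex.ofReal '' Set.Ici (0 : ℝ) →
    ∃ R : LTwo n →L[ℂ] LTwo n, IsResolvent V z R ∧
      ∀ f : PuncturedTest n,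
        ∃ hwf : MemLp (fun x => (w x : ℂ) * f x) 2 (volume : Measure (RSpace n)),
          eLpNorm (fun x => (w x : ℂ) * R (hwf.toLp _) x) 2 volume
            ≤ (C : ℝ≥0∞) * eLpNorm (fun x => f x) 2 volume

/-- `W = x · ∇ V` in the sense of distributions on `ℝⁿ ∖ 0`, both functions being locally
integrable there: `∫ W φ = - ∫ V ∇ · (x φ)`. -/
structure IsEulerDeriv {n : ℕ} (V W : RSpace n → ℝ) : Prop where
  locInt : LocallyIntegrableOn V {0}ᶜ volume
  locInt_deriv : LocallyIntegrableOn W {0}ᶜ volume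
  integral_eq : ∀ φ : PuncturedTest n,
    ∫ x, (W x : ℂ) * φ x = - ∫ x, (V x : ℂ) * ((n : ℂ) * φ x + fderiv ℝ φ x x)

/-- `g` belongs to the Sobolev space `ℋ¹(ℝⁿ)`, with weak gradient `G`. -/
structure IsSobolevOne {n : ℕ} (g : RSpace n → ℂ) (G : Fin n → RSpace n → ℂ) : Prop where
  memLp : MemLp g 2 volume
  memLp_grad : ∀ i, MemLp (G i) 2 volume
  weak_grad : ∀ (i : Fin n) (φ : 𝓓((⊤ : Opens (RSpace n)), ℂ)),
    ∫ x, g x * partialDeriv i φ x = - ∫ x, G i x * φ x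

/-- The norm of `ℋ¹(ℝⁿ)`. -/
def sobolevOneNorm {n : ℕ} (g : RSpace n → ℂ) (G : Fin n → RSpace n → ℂ) : ℝ≥0∞ :=
  (eLpNorm g 2 volume ^ 2 + ∑ i : Fin n, eLpNorm (G i) 2 volume ^ 2) ^ (1 / 2 : ℝ)

/-- `‖|V|^{1/2} g‖ + ‖|W|^{1/2} g‖ + ‖|x| V g‖ ≤ C ‖g‖_{ℋ¹}` for all `g ∈ ℋ¹`
(used with `W = x · ∇ V`). -/
def SobolevFormBound {n : ℕ} (V W : RSpace n → ℝ) : Prop :=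
  ∃ C : ℝ≥0, ∀ (g : RSpace n → ℂ) (G : Fin n → RSpace n → ℂ), IsSobolevOne g G →
    eLpNorm (fun x => (√|V x| : ℂ) * g x) 2 volume
      + eLpNorm (fun x => (√|W x| : ℂ) * g x) 2 volume
      + eLpNorm (fun x => ((‖x‖ * V x : ℝ) : ℂ) * g x) 2 volume
      ≤ (C : ℝ≥0∞) * sobolevOneNorm g G

/-- The positivity assumption in dimension `n ≥ 3` (with `W = x · ∇ V`): for some `δ₀ > 0`,
`⟨(-Δ + V) f, f⟩ ≥ δ₀ ‖∇ f‖²` and `⟨(-Δ - V - x · ∇ V) f, f⟩ ≥ δ₀ ‖∇ f‖²`. -/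
def RepulsiveForm {n : ℕ} (V W : RSpace n → ℝ) : Prop :=
  ∃ δ₀ : ℝ, 0 < δ₀ ∧ ∀ f : PuncturedTest n,
    δ₀ * gradNormSq f ≤ (schrodingerForm V f f).re ∧
    δ₀ * gradNormSq f ≤ (schrodingerForm (fun x => - V x - W x) f f).re

/-- The class `𝒳₂` (with `W = x · ∇ V`): `|x|² (x · ∇)^ℓ V ∈ L^∞(ℝ²)` for `ℓ = 0, 1, 2`. -/
def InClassXTwo (V W : RSpace 2 → ℝ) : Prop :=
  ∃ W₂ : RSpace 2 → ℝ, IsEulerDeriv V W ∧ IsEulerDeriv W W₂ ∧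
    ∃ M : ℝ, ∀ᵐ x ∂(volume : Measure (RSpace 2)),
      ‖x‖ ^ 2 * |V x| ≤ M ∧ ‖x‖ ^ 2 * |W x| ≤ M ∧ ‖x‖ ^ 2 * |W₂ x| ≤ M

/-- The pointwise repulsivity assumption in dimension `2` (with `W = x · ∇ V`). -/
structure RepulsivePointwise (V W : RSpace 2 → ℝ) : Prop where
  bounds : ∃ δ₀ : ℝ, 0 < δ₀ ∧ ∀ᵐ x ∂(volume : Measure (RSpace 2)),
    0 < V x ∧ - W x ≤ δ₀⁻¹ * V x ∧ (1 + δ₀) * V x ≤ - W x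
  locInt_inv : LocallyIntegrable (fun x => (V x)⁻¹) volume

end

/-! Both parts follow from one a priori estimate, proved under the bounds collected in `FormSetup`.
Let `(H - z)u = F` with `F = w f`, let `ε = Im z`, and let `‖w u‖` be the quantity to bound. The
form values `Q_H(u,u)` and `⟨(-Δ - V - x·∇V)u, u⟩` both dominate `‖∇u‖² + ‖w u‖²` up to a constant.
If `Re z ≤ |ε|`, the real and imaginary parts of the energy identity suffice: `|ε|‖u‖² ≤ ‖w u‖‖f‖`,
so that `Q_H(u,u) ≤ 2‖w u‖‖f‖`.

If `Re z > |ε| > 0`, take `k² = Re z` with `k` of the sign of `ε`, and put `∇ₖu = ∇u - i k x̂ u =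
e^{ikr} ∇(e^{-ikr} u)`. The virial identity for the generator of dilations, the energy identity and
the flux identity (imaginary part of the equation tested against `|x| u`) combine in
`multiplier_identity`. Its left side is half the form of `-Δ - V - x·∇V` at `e^{-ikr} u`, hence is
bounded below by `‖∇ₖu‖² + ‖w u‖²`. Its right side has terms in `f`, harmless because `|x| w` is
bounded, and the remainder `ε (Im⟨|x|u, ∂ᵣu⟩ - k ⟨|x|u, u⟩)`, with the pairing antilinear in its
first slot.

That remainder is the difficulty. It is controlled by positivity of `Q_H` alone, applied to `√r
e^{-ikr} u` (`radial_positivity`, `flux_inequality`): together with the equation this bounds the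
remainder by `(ε/2k) ‖u‖ (‖|x|F‖ + ½ Σ‖∇ₖu‖)`. Since `ε² / k² ≤ |ε|` and `|ε|‖u‖² ≤ ‖w u‖‖f‖`,
everything is absorbed by Young's inequality (`sq_le_absorbConst_mul`). No Hardy inequality enters
here, which is why the argument covers dimension two.

No regularity of `u` beyond the form domain is available, so the identities are proved on test
functions and extended by closure. The form domain is realised as a closed subspace of a product of
copies of `L²` that stores the gradient and all multiples of `u` needed later. The virial identity
uses difference quotients of dilations, and the weight `|x|` is first replaced by the bounded weight
`r/(1+κr)`.

For `n ≥ 3` the required bounds come from Hardy's inequality with `w = |x|⁻¹`; for `n = 2` they are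
pointwise consequences of the assumptions with `w = V^{1/2}`. -/

open scoped ContDiff

noncomputable section

variable {n : ℕ}

/-! ### Calculus of test functions on the punctured space -/

namespace PuncturedTest

lemma ne_zero_of_mem_tsupport (φ : PuncturedTest n) {x : RSpace n} (hx : x ∈ tsupport φ) :
    x ≠ 0 := φ.tsupport_subset hx

lemma differentiable (φ : PuncturedTest n) : Differentiable ℝ φ :=
  φ.contDiff.differentiable (by simp)

lemma continuous_fderiv (φ : PuncturedTest n) : Continuous (fderiv ℝ φ) :=
  φ.contDiff.continuous_fderiv (by simp)

lemma notMem_tsupport_zero (φ : PuncturedTest n) : (0 : RSpace n) ∉ tsupport φ :=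
  fun h => φ.ne_zero_of_mem_tsupport h rfl

lemma apply_zero (φ : PuncturedTest n) : φ 0 = 0 :=
  image_eq_zero_of_notMem_tsupport φ.notMem_tsupport_zero

lemma fderiv_eq_zero {φ : PuncturedTest n} {x : RSpace n} (hx : x ∉ tsupport φ) :
    fderiv ℝ φ x = 0 := by
  have : φ =ᶠ[𝓝 x] (fun _ => (0 : ℂ)) := notMem_tsupport_iff_eventuallyEq.mp hx
  rw [this.fderiv_eq]; simp

/-- The product of a test function with a function which is smooth away from the origin. -/
def smoothMul (χ : RSpace n → ℂ) (hχ : ∀ x, x ≠ 0 → ContDiffAt ℝ ∞ χ x)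
    (φ : PuncturedTest n) : PuncturedTest n where
  toFun x := χ x * φ x
  contDiff' := by
    refine contDiff_iff_contDiffAt.mpr fun x => ?_
    by_cases hx : x ∈ tsupport φ
    · exact (hχ x (φ.ne_zero_of_mem_tsupport hx)).mul φ.contDiff.contDiffAt
    · have h0 : (fun y => χ y * φ y) =ᶠ[𝓝 x] fun _ => (0 : ℂ) := by
        filter_upwards [notMem_tsupport_iff_eventuallyEq.mp hx] with y hy
        simp [hy]
      exact contDiffAt_const.congr_of_eventuallyEq h0
  hasCompactSupport' := φ.hasCompactSupport.mul_left
  tsupport_subset' := (tsupport_mul_subset_right).trans φ.tsupport_subset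

lemma fderiv_smoothMul {χ : RSpace n → ℂ} (hχ : ∀ x, x ≠ 0 → ContDiffAt ℝ ∞ χ x)
    (φ : PuncturedTest n) (x : RSpace n) :
    fderiv ℝ (smoothMul χ hχ φ) x = χ x • fderiv ℝ φ x + φ x • fderiv ℝ χ x := by
  by_cases hx : x ∈ tsupport φ
  · have h1 : DifferentiableAt ℝ χ x :=
      (hχ x (φ.ne_zero_of_mem_tsupport hx)).differentiableAt (by simp)
    exact fderiv_mul h1 φ.differentiable.differentiableAt
  · have h2 : x ∉ tsupport (smoothMul χ hχ φ) := fun h => hx (tsupport_mul_subset_right h)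
    rw [fderiv_eq_zero h2, fderiv_eq_zero hx, image_eq_zero_of_notMem_tsupport hx]
    ext v
    change (0 : ℂ) = χ x * 0 + 0 * fderiv ℝ χ x v
    ring

/-- The squared modulus of a test function. -/
def normSq (φ : PuncturedTest n) : PuncturedTest n where
  toFun x := φ x * starRingEnd ℂ (φ x)
  contDiff' := φ.contDiff.mul (Complex.conjCLE.contDiff.comp φ.contDiff)
  hasCompactSupport' := φ.hasCompactSupport.mul_right
  tsupport_subset' := (tsupport_mul_subset_left).trans φ.tsupport_subset

@[simp] lemma normSq_apply (φ : PuncturedTest n) (x : RSpace n) :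
    normSq φ x = φ x * starRingEnd ℂ (φ x) := rfl

lemma fderiv_normSq (φ : PuncturedTest n) (x v : RSpace n) :
    fderiv ℝ (normSq φ) x v = ((2 * (starRingEnd ℂ (φ x) * fderiv ℝ φ x v).re : ℝ) : ℂ) := by
  have h1 := φ.differentiable.differentiableAt (x := x) |>.hasFDerivAt
  have h2 : HasFDerivAt (fun x => starRingEnd ℂ (φ x))
      ((Complex.conjCLE : ℂ →L[ℝ] ℂ).comp (fderiv ℝ φ x)) x :=
    (Complex.conjCLE : ℂ →L[ℝ] ℂ).hasFDerivAt.comp x h1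
  have h3 : HasFDerivAt (normSq φ) _ x := h1.mul h2
  rw [h3.fderiv]
  apply Complex.ext <;> simp <;> ring

/-- The partial derivative of a test function. -/
def pd (i : Fin n) : PuncturedTest n →ₗ[ℂ] PuncturedTest n where
  toFun φ :=
    { toFun := partialDeriv i φ
      contDiff' := by
        have h := φ.contDiff.fderiv_right (m := ∞) (by simp)
        exact h.clm_apply contDiff_const
      hasCompactSupport' :=
        (φ.hasCompactSupport.fderiv ℝ).comp_left (g := fun L : RSpace n →L[ℝ] ℂ =>
          L (EuclideanSpace.single i (1 : ℝ))) (by simp)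
      tsupport_subset' := by
        refine Set.Subset.trans ?_ φ.tsupport_subset
        refine closure_minimal (fun x hx => ?_) (isClosed_tsupport _)
        by_contra h
        exact hx (by simp [partialDeriv, fderiv_eq_zero h]) }
  map_add' φ ψ := by
    ext x
    have : fderiv ℝ (⇑(φ + ψ)) x = fderiv ℝ φ x + fderiv ℝ ψ x :=
      fderiv_add φ.differentiable.differentiableAt ψ.differentiable.differentiableAt
    exact congrArg (fun L : RSpace n →L[ℝ] ℂ => L (EuclideanSpace.single i (1 : ℝ))) this
  map_smul' c φ := by
    ext x
    have : fderiv ℝ (⇑(c • φ)) x = c • fderiv ℝ φ x :=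
      fderiv_const_smul φ.differentiable.differentiableAt c
    exact congrArg (fun L : RSpace n →L[ℝ] ℂ => L (EuclideanSpace.single i (1 : ℝ))) this

@[simp] lemma pd_apply (i : Fin n) (φ : PuncturedTest n) (x : RSpace n) :
    pd i φ x = partialDeriv i φ x := rfl

lemma partialDeriv_smoothMul {χ : RSpace n → ℂ} (hχ : ∀ x, x ≠ 0 → ContDiffAt ℝ ∞ χ x)
    (φ : PuncturedTest n) (i : Fin n) (x : RSpace n) :
    partialDeriv i (smoothMul χ hχ φ) x = χ x * partialDeriv i φ x + partialDeriv i χ x * φ x := by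
  simp [partialDeriv, fderiv_smoothMul, mul_comm]

lemma hasCompactSupport_partialDeriv (φ : PuncturedTest n) (i : Fin n) :
    HasCompactSupport (partialDeriv i φ) := (pd i φ).hasCompactSupport

lemma continuous_partialDeriv (φ : PuncturedTest n) (i : Fin n) :
    Continuous (partialDeriv i φ) := (pd i φ).continuous

end PuncturedTest

lemma fderiv_apply_eq_sum (f : RSpace n → ℂ) (x v : RSpace n) :
    fderiv ℝ f x v = ∑ i, (v i : ℂ) * partialDeriv i f x := by
  conv_lhs => rw [← (EuclideanSpace.basisFun (Fin n) ℝ).sum_repr v]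
  simp [partialDeriv]

namespace PuncturedTest

/-- The product of a test function with a radial function. -/
def radialMul (χ : ℝ → ℂ) (hχ : ∀ r, 0 < r → ContDiffAt ℝ ∞ χ r) :
    PuncturedTest n → PuncturedTest n :=
  smoothMul (fun x => χ ‖x‖) fun x hx =>
    (hχ _ (norm_pos_iff.mpr hx)).comp x (contDiffAt_norm ℝ hx)

@[simp] lemma radialMul_apply (χ : ℝ → ℂ) (hχ : ∀ r, 0 < r → ContDiffAt ℝ ∞ χ r)
    (φ : PuncturedTest n) (x : RSpace n) : radialMul χ hχ φ x = χ ‖x‖ * φ x := rfl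

end PuncturedTest

lemma fderiv_radial {χ : ℝ → ℂ} {c : ℂ} {x : RSpace n} (hx : x ≠ 0)
    (hχ : HasDerivAt χ c ‖x‖) (v : RSpace n) :
    fderiv ℝ (fun x : RSpace n => χ ‖x‖) x v = ((inner ℝ x v / ‖x‖ : ℝ) : ℂ) * c := by
  have h1 : HasFDerivAt (fun x : RSpace n => ‖x‖) _ x :=
    ((contDiffAt_norm ℝ hx (n := 1)).differentiableAt (by simp)).hasFDerivAt
  have h3 : fderiv ℝ (fun x : RSpace n => ‖x‖) x v = inner ℝ x v / ‖x‖ := by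
    have h4 : HasFDerivAt (fun x : RSpace n => ‖x‖ ^ 2) _ x := h1.pow 2
    have h5 := congrArg (fun L : RSpace n →L[ℝ] ℝ => L v)
      (h4.unique (hasStrictFDerivAt_norm_sq x).hasFDerivAt)
    have h6 : 0 < ‖x‖ := norm_pos_iff.mpr hx
    simp at h5
    field_simp
    linarith
  have h2 := hχ.hasFDerivAt.comp x h1
  have h7 : (χ ∘ fun x : RSpace n => ‖x‖) = fun x => χ ‖x‖ := rfl
  rw [h7] at h2
  rw [h2.fderiv, ← h3]
  simp

namespace PuncturedTest

lemma partialDeriv_radialMul {χ : ℝ → ℂ} (hχ : ∀ r, 0 < r → ContDiffAt ℝ ∞ χ r)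
    {χ' : ℝ → ℂ} (hχ' : ∀ r, 0 < r → HasDerivAt χ (χ' r) r)
    (φ : PuncturedTest n) (i : Fin n) (x : RSpace n) :
    partialDeriv i (radialMul χ hχ φ) x =
      χ ‖x‖ * partialDeriv i φ x + χ' ‖x‖ * ((x i / ‖x‖ : ℝ) : ℂ) * φ x := by
  rw [radialMul, partialDeriv_smoothMul]
  by_cases hx : x = 0
  · simp [hx, φ.apply_zero]
  · rw [show partialDeriv i (fun x : RSpace n => χ ‖x‖) x = _ from
      fderiv_radial hx (hχ' _ (norm_pos_iff.mpr hx)) _]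
    simp only [EuclideanSpace.inner_single_right, conj_trivial, one_mul]
    ring

lemma integrable_mul (φ : PuncturedTest n) {f : RSpace n → ℂ} (hf : Continuous f) :
    Integrable (fun x => f x * φ x) :=
  (hf.mul φ.continuous).integrable_of_hasCompactSupport φ.hasCompactSupport.mul_left

/-- The integrand is the divergence of the compactly supported field `x ψ`. All later integrations
by parts along radial fields reduce to this. -/
lemma integral_euler (ψ : PuncturedTest n) :
    ∫ x, ((n : ℂ) * ψ x + fderiv ℝ ψ x x) = 0 := by
  have h : ∀ i : Fin n, ∫ x : RSpace n, (x i : ℂ) * partialDeriv i ψ x = - ∫ x, ψ x := by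
    intro i
    have hd : ∀ x : RSpace n, HasFDerivAt (fun x : RSpace n => (x i : ℂ))
        (Complex.ofRealCLM.comp (EuclideanSpace.proj i : RSpace n →L[ℝ] ℝ)) x := fun x =>
      (Complex.ofRealCLM.comp (EuclideanSpace.proj i : RSpace n →L[ℝ] ℝ)).hasFDerivAt
    have hd' : ∀ x : RSpace n, fderiv ℝ (fun x : RSpace n => (x i : ℂ)) x
        (EuclideanSpace.single i 1) = 1 := fun x => by rw [(hd x).fderiv]; simp
    have hc : Continuous (fun x : RSpace n => (x i : ℂ)) := by fun_prop
    have := integral_mul_fderiv_eq_neg_fderiv_mul_of_integrable (μ := volume)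
      (f := fun x : RSpace n => (x i : ℂ)) (g := ψ) (v := EuclideanSpace.single i 1)
      (by simpa only [hd'] using ψ.integrable_mul continuous_const)
      ((pd i ψ).integrable_mul hc) (ψ.integrable_mul hc)
      (fun x _ => (hd x).differentiableAt) (fun x _ => ψ.differentiable.differentiableAt)
    simp only [hd', one_mul] at this
    exact this
  have hi : ∀ i : Fin n, Integrable (fun x : RSpace n => (x i : ℂ) * partialDeriv i ψ x) :=
    fun i => (pd i ψ).integrable_mul (by fun_prop)
  simp only [fderiv_apply_eq_sum]
  rw [integral_add (ψ.integrable_mul continuous_const) (integrable_finsetSum _ fun i _ => hi i),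
    integral_finsetSum _ (fun i _ => hi i), integral_const_mul]
  simp [h]

end PuncturedTest

/-! ### Pairings in `L²` and bounded multiplication operators -/

lemma inner_toLp {f g : RSpace n → ℂ} (hf : MemLp f 2 volume) (hg : MemLp g 2 volume) :
    inner ℂ (hf.toLp f) (hg.toLp g) = ∫ x, g x * starRingEnd ℂ (f x) := by
  rw [L2.inner_def]
  refine integral_congr_ae ?_
  filter_upwards [hf.coeFn_toLp, hg.coeFn_toLp] with x h1 h2
  rw [h1, h2, RCLike.inner_apply]

lemma norm_toLp_sq {f : RSpace n → ℂ} (hf : MemLp f 2 volume) :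
    ‖hf.toLp f‖ ^ 2 = ∫ x, ‖f x‖ ^ 2 := by
  have h := inner_self_eq_norm_sq_to_K (𝕜 := ℂ) (hf.toLp f)
  rw [inner_toLp] at h
  have h2 : ∫ x, f x * starRingEnd ℂ (f x) = ((∫ x, ‖f x‖ ^ 2 : ℝ) : ℂ) := by
    rw [← integral_complex_ofReal]
    refine integral_congr_ae (ae_of_all _ fun x => ?_)
    simp only [Complex.mul_conj, Complex.normSq_eq_norm_sq]
  rw [h2] at h
  have h3 : ((∫ x, ‖f x‖ ^ 2 : ℝ) : ℂ) = ((‖hf.toLp f‖ ^ 2 : ℝ) : ℂ) := by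
    rw [h]; push_cast; rfl
  exact (Complex.ofReal_injective h3).symm

lemma inner_eq_integral (f g : LTwo n) : inner ℂ f g = ∫ x, g x * starRingEnd ℂ (f x) := by
  rw [L2.inner_def]
  simp only [RCLike.inner_apply]

lemma integrable_mul_conj (f g : LTwo n) : Integrable fun x => g x * starRingEnd ℂ (f x) := by
  simpa only [RCLike.inner_apply] using L2.integrable_inner (𝕜 := ℂ) f g

/-- Multiplication by an essentially bounded real function. -/
def mulLp (b : RSpace n → ℝ) (hb : MemLp b ∞ volume) : LTwo n →L[ℂ] LTwo n :=
  (ContinuousLinearMap.mul ℂ ℂ).holderL volume ∞ 2 2 (hb.ofReal.toLp fun x => (b x : ℂ))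

lemma mulLp_ae {b : RSpace n → ℝ} (hb : MemLp b ∞ volume) (f : LTwo n) :
    mulLp b hb f =ᵐ[volume] fun x => (b x : ℂ) * f x := by
  have h1 := (ContinuousLinearMap.mul ℂ ℂ).coeFn_holder (r := 2)
    (hb.ofReal.toLp fun x => (b x : ℂ)) f
  have h2 := MemLp.coeFn_toLp (hb.ofReal (K := ℂ))
  filter_upwards [h1, h2] with x hx1 hx2
  change ((ContinuousLinearMap.mul ℂ ℂ).holder 2 (hb.ofReal.toLp fun x => (b x : ℂ)) f) x = _
  rw [hx1]
  exact congrArg (fun c => c * f x) hx2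

lemma inner_mulLp {b : RSpace n → ℝ} (hb : MemLp b ∞ volume) (f g : LTwo n) :
    inner ℂ (mulLp b hb f) g = inner ℂ f (mulLp b hb g) := by
  rw [inner_eq_integral, inner_eq_integral]
  refine integral_congr_ae ?_
  filter_upwards [mulLp_ae hb f, mulLp_ae hb g] with x h1 h2
  rw [h1, h2, map_mul, Complex.conj_ofReal]
  ring

lemma norm_mulLp_le {b : RSpace n → ℝ} (hb : MemLp b ∞ volume) {C : ℝ}
    (hC : ∀ᵐ x, |b x| ≤ C) (f : LTwo n) : ‖mulLp b hb f‖ ≤ C * ‖f‖ := by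
  refine Lp.norm_le_mul_norm_of_ae_le_mul ?_
  filter_upwards [mulLp_ae hb f, hC] with x h1 h2
  rw [h1, norm_mul, Complex.norm_real, Real.norm_eq_abs]
  gcongr

lemma mulLp_mulLp {b c d : RSpace n → ℝ} (hb : MemLp b ∞ volume) (hc : MemLp c ∞ volume)
    (hd : MemLp d ∞ volume) (h : ∀ᵐ x, b x * c x = d x) (f : LTwo n) :
    mulLp b hb (mulLp c hc f) = mulLp d hd f := by
  refine Lp.ext ?_
  filter_upwards [mulLp_ae hb (mulLp c hc f), mulLp_ae hc f, mulLp_ae hd f, h] with x h1 h2 h3 h4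
  rw [h1, h2, h3, ← h4]
  push_cast
  ring

namespace PuncturedTest

lemma memLp (φ : PuncturedTest n) : MemLp φ 2 volume :=
  φ.continuous.memLp_of_hasCompactSupport φ.hasCompactSupport

/-- A test function as an element of `L²`. -/
def toLTwo : PuncturedTest n →ₗ[ℂ] LTwo n where
  toFun φ := φ.memLp.toLp φ
  map_add' φ ψ := MemLp.toLp_add φ.memLp ψ.memLp
  map_smul' c φ := MemLp.toLp_const_smul c φ.memLp

lemma toLTwo_ae (φ : PuncturedTest n) : toLTwo φ =ᵐ[volume] φ := φ.memLp.coeFn_toLp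

lemma norm_toLTwo_sq (φ : PuncturedTest n) : ‖toLTwo φ‖ ^ 2 = ∫ x, ‖φ x‖ ^ 2 :=
  norm_toLp_sq φ.memLp

lemma inner_toLTwo (φ ψ : PuncturedTest n) :
    inner ℂ (toLTwo φ) (toLTwo ψ) = ∫ x, ψ x * starRingEnd ℂ (φ x) :=
  inner_toLp φ.memLp ψ.memLp

lemma inner_pd (i : Fin n) (φ ψ : PuncturedTest n) :
    inner ℂ (toLTwo φ) (toLTwo (pd i ψ)) = - inner ℂ (toLTwo (pd i φ)) (toLTwo ψ) := by
  rw [inner_toLTwo, inner_toLTwo]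
  have hc : Continuous fun x => starRingEnd ℂ (φ x) := Complex.continuous_conj.comp φ.continuous
  have hc' : Continuous fun x => starRingEnd ℂ (partialDeriv i φ x) :=
    Complex.continuous_conj.comp (φ.continuous_partialDeriv i)
  have hd : ∀ x, HasFDerivAt (fun x => starRingEnd ℂ (φ x))
      ((Complex.conjCLE : ℂ →L[ℝ] ℂ).comp (fderiv ℝ φ x)) x := fun x =>
    (Complex.conjCLE : ℂ →L[ℝ] ℂ).hasFDerivAt.comp x φ.differentiable.differentiableAt.hasFDerivAt
  have hd' : ∀ x, fderiv ℝ (fun x => starRingEnd ℂ (φ x)) x (EuclideanSpace.single i 1)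
      = starRingEnd ℂ (partialDeriv i φ x) := fun x => by
    rw [(hd x).fderiv]; rfl
  have := integral_mul_fderiv_eq_neg_fderiv_mul_of_integrable (μ := volume)
    (f := fun x => starRingEnd ℂ (φ x)) (g := ψ) (v := EuclideanSpace.single i 1)
    (by simp only [hd']; exact ψ.integrable_mul hc') ((pd i ψ).integrable_mul hc)
    (ψ.integrable_mul hc) (fun x _ => (hd x).differentiableAt)
    (fun x _ => ψ.differentiable.differentiableAt)
  simp only [hd'] at this
  simp only [pd_apply, mul_comm (ψ _)]
  rw [← this]
  refine integral_congr_ae (ae_of_all _ fun x => mul_comm _ _)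

end PuncturedTest

/-! ### The form domain as a closed subspace of a product of `L²` spaces -/

open PuncturedTest

/-- The multipliers which are controlled by the form norm. -/
def obs (V W w : RSpace n → ℝ) : Fin 7 → RSpace n → ℝ :=
  ![fun _ => 1, fun x => √|V x|, fun x => V x / √|V x|, fun x => √|W x|,
    fun x => W x / √|W x|, fun x => ‖x‖ * V x, w]

/-- Bounds on a potential `V`, on `W = x · ∇ V` and on a weight `w` which
lead to uniform resolvent estimates. -/
structure FormSetup (V W w : RSpace n → ℝ) : Prop where
  two_le : 2 ≤ n
  euler : IsEulerDeriv V W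
  aesm_obs : ∀ k, AEStronglyMeasurable (obs V W w k) volume
  memLp_obs : ∀ k (φ : PuncturedTest n), MemLp (fun x => (obs V W w k x : ℂ) * φ x) 2 volume
  coercive : ∃ C : ℝ, 0 < C ∧ ∀ k (φ : PuncturedTest n),
    ∫ x, ‖(obs V W w k x : ℂ) * φ x‖ ^ 2
      ≤ C * ((schrodingerForm V φ φ).re + ∫ x, ‖φ x‖ ^ 2)
  repulsive : ∃ δ : ℝ, 0 < δ ∧ ∀ φ : PuncturedTest n,
    δ * (gradNormSq φ + ∫ x, ‖(w x : ℂ) * φ x‖ ^ 2) ≤ (schrodingerForm V φ φ).re ∧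
    δ * (gradNormSq φ + ∫ x, ‖(w x : ℂ) * φ x‖ ^ 2)
      ≤ (schrodingerForm (fun x => - V x - W x) φ φ).re
  weight : ∃ C : ℝ, 0 < C ∧ ∀ᵐ x ∂(volume : Measure (RSpace n)), |‖x‖ * w x| ≤ C

/-- Families of gradient components and of controlled multiples of a function. -/
abbrev FormSpace (n : ℕ) : Type := PiLp 2 (fun _ : Fin n ⊕ Fin 7 => LTwo n)

/-- The `i`-th gradient component. -/
def gradC (i : Fin n) : FormSpace n →L[ℂ] LTwo n :=
  PiLp.proj 2 (fun _ : Fin n ⊕ Fin 7 => LTwo n) (Sum.inl i)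

/-- The `k`-th controlled multiple. -/
def obsC (k : Fin 7) : FormSpace n →L[ℂ] LTwo n :=
  PiLp.proj 2 (fun _ : Fin n ⊕ Fin 7 => LTwo n) (Sum.inr k)

lemma FormSpace.norm_sq (a : FormSpace n) :
    ‖a‖ ^ 2 = ∑ i, ‖gradC i a‖ ^ 2 + ∑ k, ‖obsC k a‖ ^ 2 := by
  rw [PiLp.norm_sq_eq_of_L2, Fintype.sum_sum_type]
  rfl

/-- The extension of the form `⟨f, (-Δ + V) g⟩`. -/
def qform (a b : FormSpace n) : ℂ :=
  ∑ i, inner ℂ (gradC i b) (gradC i a) + inner ℂ (obsC 1 b) (obsC 2 a)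

@[fun_prop]
lemma continuous_qform {X : Type*} [TopologicalSpace X] {f g : X → FormSpace n}
    (hf : Continuous f) (hg : Continuous g) : Continuous fun x => qform (f x) (g x) := by
  unfold qform
  fun_prop

/-- This signed factorisation turns `∫ V u v̄` into an `L²` pairing of two controlled multiples of
`u` and `v`, which is continuous although `V` has no sign. The value `0/0 = 0` covers the zeros of
`V`. -/
lemma div_sqrt_abs_mul (t : ℝ) : t / √|t| * √|t| = t := by
  by_cases h : t = 0
  · simp [h]
  · have : √|t| ≠ 0 := (Real.sqrt_pos.mpr (abs_pos.mpr h)).ne'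
    field_simp

namespace FormSetup

variable {V W w : RSpace n → ℝ}

/-- The embedding of the test functions. -/
def embed (S : FormSetup V W w) : PuncturedTest n →ₗ[ℂ] FormSpace n where
  toFun φ := WithLp.toLp 2 (Sum.elim (fun i => toLTwo (pd i φ)) fun k => (S.memLp_obs k φ).toLp _)
  map_add' φ ψ := by
    ext1 o
    rcases o with i | k
    · exact map_add (toLTwo ∘ₗ pd i) φ ψ
    · exact (MemLp.toLp_congr (S.memLp_obs k (φ + ψ)) ((S.memLp_obs k φ).add (S.memLp_obs k ψ))
        (ae_of_all _ fun x => mul_add _ _ _)).trans (MemLp.toLp_add (S.memLp_obs k φ) (S.memLp_obs k ψ))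
  map_smul' c φ := by
    ext1 o
    rcases o with i | k
    · exact map_smul (toLTwo ∘ₗ pd i) c φ
    · exact (MemLp.toLp_congr (S.memLp_obs k (c • φ)) ((S.memLp_obs k φ).const_smul c)
        (ae_of_all _ fun x => mul_left_comm _ _ _)).trans (MemLp.toLp_const_smul c (S.memLp_obs k φ))

variable (S : FormSetup V W w)

lemma gradC_embed (i : Fin n) (φ : PuncturedTest n) :
    gradC i (S.embed φ) = toLTwo (pd i φ) := rfl

lemma obsC_embed_ae (k : Fin 7) (φ : PuncturedTest n) :
    obsC k (S.embed φ) =ᵐ[volume] fun x => (obs V W w k x : ℂ) * φ x :=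
  (S.memLp_obs k φ).coeFn_toLp

lemma obsC_zero_embed (φ : PuncturedTest n) : obsC 0 (S.embed φ) = toLTwo φ := by
  refine Lp.ext ?_
  filter_upwards [S.obsC_embed_ae 0 φ, φ.toLTwo_ae] with x h1 h2
  rw [h1, h2]
  simp [obs]

/-- The form domain, as a closed subspace. -/
def dom : Submodule ℂ (FormSpace n) := (LinearMap.range S.embed).topologicalClosure

lemma embed_mem (φ : PuncturedTest n) : S.embed φ ∈ S.dom :=
  Submodule.le_topologicalClosure _ ⟨φ, rfl⟩

/-- The extension principle used throughout: the gradient components and the unbounded multiples of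
`u` are separate continuous coordinates, so the identities and inequalities between them are closed
conditions and need checking on test functions only. -/
lemma dom_induction {P : FormSpace n → Prop} (hc : IsClosed {a | P a})
    (h : ∀ φ, P (S.embed φ)) {a : FormSpace n} (ha : a ∈ S.dom) : P a := by
  have h1 : (LinearMap.range S.embed : Set (FormSpace n)) ⊆ {a | P a} := by
    rintro _ ⟨φ, rfl⟩
    exact h φ
  exact closure_minimal h1 hc ha

lemma exists_seq {a : FormSpace n} (ha : a ∈ S.dom) :
    ∃ φ : ℕ → PuncturedTest n, Tendsto (fun j => S.embed (φ j)) atTop (𝓝 a) := by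
  obtain ⟨x, hx, hxa⟩ := mem_closure_iff_seq_limit.mp ha
  choose φ hφ using hx
  exact ⟨φ, by simpa only [hφ] using hxa⟩

lemma qform_embed (φ ψ : PuncturedTest n) :
    qform (S.embed φ) (S.embed ψ) = schrodingerForm V φ ψ := by
  unfold qform schrodingerForm
  congr 1
  · rw [integral_finsetSum]
    · refine Finset.sum_congr rfl fun i _ => ?_
      rw [gradC_embed, gradC_embed, inner_toLTwo]
      rfl
    · intro i _
      refine ((φ.continuous_partialDeriv i).mul (Complex.continuous_conj.comp
        (ψ.continuous_partialDeriv i))).integrable_of_hasCompactSupport ?_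
      exact (φ.hasCompactSupport_partialDeriv i).mul_right
  · rw [inner_eq_integral]
    refine integral_congr_ae ?_
    filter_upwards [S.obsC_embed_ae 1 ψ, S.obsC_embed_ae 2 φ] with x h1 h2
    rw [h1, h2]
    simp only [obs, Matrix.cons_val_one, Matrix.cons_val, map_mul, Complex.conj_ofReal]
    conv_rhs => rw [← div_sqrt_abs_mul (V x)]
    push_cast
    ring

lemma gradNormSq_eq (φ : PuncturedTest n) :
    gradNormSq φ = ∑ i, ‖gradC i (S.embed φ)‖ ^ 2 := by
  unfold gradNormSq
  rw [integral_finsetSum]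
  · exact Finset.sum_congr rfl fun i _ => (norm_toLTwo_sq (pd i φ)).symm
  · intro i _
    exact (pd i φ).memLp.integrable_norm_pow (by simp)

lemma norm_obsC_embed_sq (k : Fin 7) (φ : PuncturedTest n) :
    ‖obsC k (S.embed φ)‖ ^ 2 = ∫ x, ‖(obs V W w k x : ℂ) * φ x‖ ^ 2 :=
  norm_toLp_sq (S.memLp_obs k φ)

end FormSetup

/-! ### Closability, coercivity and the graph of the Hamiltonian -/

namespace FormSetup

variable {V W w : RSpace n → ℝ} (S : FormSetup V W w)
include S

/-- Multiplication by an unbounded function is not continuous on `L²`, so the relation is first cut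
off to the sets where the multiplier is at most `N`. There both sides are bounded operators, the
relation passes to the closure, and these sets exhaust the space. -/
lemma obsC_ae {a : FormSpace n} (ha : a ∈ S.dom) (k : Fin 7) :
    obsC k a =ᵐ[volume] fun x => (obs V W w k x : ℂ) * obsC 0 a x := by
  classical
  set m := (S.aesm_obs k).mk _ with hm
  have hmm : Measurable m := (S.aesm_obs k).stronglyMeasurable_mk.measurable
  have hme : obs V W w k =ᵐ[volume] m := (S.aesm_obs k).ae_eq_mk
  set b : ℕ → RSpace n → ℝ := fun N => Set.indicator {x | |m x| ≤ N} fun _ => 1 with hb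
  set c : ℕ → RSpace n → ℝ := fun N => Set.indicator {x | |m x| ≤ N} m with hc
  have hs : ∀ N : ℕ, MeasurableSet {x | |m x| ≤ N} := fun N =>
    measurableSet_le hmm.norm measurable_const
  have hbL : ∀ N, MemLp (b N) ∞ volume := fun N =>
    memLp_top_of_bound (measurable_const.indicator (hs N)).aestronglyMeasurable 1
      (ae_of_all _ fun x => by
        simp only [hb, Set.indicator_apply]; split_ifs <;> simp)
  have hcL : ∀ N, MemLp (c N) ∞ volume := fun N =>
    memLp_top_of_bound (hmm.indicator (hs N)).aestronglyMeasurable N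
      (ae_of_all _ fun x => by
        simp only [hc, Set.indicator_apply, Set.mem_ofPred_eq]; split_ifs with h <;> simp [h])
  have key : ∀ N, mulLp (b N) (hbL N) (obsC k a) = mulLp (c N) (hcL N) (obsC 0 a) := by
    intro N
    refine S.dom_induction (P := fun a => mulLp (b N) (hbL N) (obsC k a)
      = mulLp (c N) (hcL N) (obsC 0 a)) (isClosed_eq (by fun_prop) (by fun_prop)) ?_ ha
    intro φ
    rw [obsC_zero_embed]
    refine Lp.ext ?_
    filter_upwards [mulLp_ae (hbL N) (obsC k (S.embed φ)), mulLp_ae (hcL N) (toLTwo φ),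
      S.obsC_embed_ae k φ, φ.toLTwo_ae, hme] with x h1 h2 h3 h4 h5
    rw [h1, h2, h3, h4, h5]
    simp only [hb, hc, Set.indicator_apply]
    split_ifs <;> simp
  have h1 : ∀ᵐ x, ∀ N, mulLp (b N) (hbL N) (obsC k a) x = b N x * obsC k a x :=
    ae_all_iff.mpr fun N => mulLp_ae (hbL N) _
  have h2 : ∀ᵐ x, ∀ N, mulLp (c N) (hcL N) (obsC 0 a) x = c N x * obsC 0 a x :=
    ae_all_iff.mpr fun N => mulLp_ae (hcL N) _
  filter_upwards [h1, h2, hme] with x hx1 hx2 hx3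
  obtain ⟨N, hN⟩ := exists_nat_ge |m x|
  have := hx2 N
  rw [← key N, hx1 N] at this
  simpa [hb, hc, Set.indicator_apply, hN, hx3] using this

lemma inner_gradC {a : FormSpace n} (ha : a ∈ S.dom) (i : Fin n) (ψ : PuncturedTest n) :
    inner ℂ (toLTwo ψ) (gradC i a) = - inner ℂ (toLTwo (pd i ψ)) (obsC 0 a) := by
  refine S.dom_induction (P := fun a => inner ℂ (toLTwo ψ) (gradC i a)
    = - inner ℂ (toLTwo (pd i ψ)) (obsC 0 a)) (isClosed_eq (by fun_prop) (by fun_prop)) ?_ ha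
  intro φ
  rw [gradC_embed, obsC_zero_embed, inner_pd]

lemma gradC_mem_closure {a : FormSpace n} (ha : a ∈ S.dom) (i : Fin n) :
    gradC i a ∈ closure (Set.range (toLTwo (n := n))) := by
  refine S.dom_induction (P := fun a => gradC i a ∈ closure (Set.range (toLTwo (n := n))))
    (isClosed_closure.preimage (gradC i).continuous) ?_ ha
  intro φ
  exact subset_closure ⟨pd i φ, rfl⟩

/-- Closability of the form. The gradient of the zero function is orthogonal to every test function
by integration by parts, yet is itself a limit of test functions, so it vanishes; the other
coordinates vanish because they are pointwise multiples of coordinate `0`. -/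
lemma eq_zero_of_obsC_zero {a : FormSpace n} (ha : a ∈ S.dom) (h : obsC 0 a = 0) : a = 0 := by
  have hg : ∀ i, gradC i a = 0 := by
    intro i
    have h1 : ∀ f ∈ closure (Set.range (toLTwo (n := n))), inner ℂ f (gradC i a) = 0 := by
      intro f hf
      refine closure_minimal (s := Set.range (toLTwo (n := n)))
        (t := {f | inner ℂ f (gradC i a) = 0}) ?_ (isClosed_eq (by fun_prop) (by fun_prop)) hf
      rintro _ ⟨ψ, rfl⟩
      simp [S.inner_gradC ha, h]
    exact inner_self_eq_zero.mp (h1 _ (S.gradC_mem_closure ha i))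
  have hm : ∀ k, obsC k a = 0 := by
    intro k
    refine Lp.ext ?_
    have h0 : obsC 0 a =ᵐ[volume] (0 : RSpace n → ℂ) := by rw [h]; exact Lp.coeFn_zero _ _ _
    filter_upwards [S.obsC_ae ha k, h0, Lp.coeFn_zero ℂ 2 (volume : Measure (RSpace n))]
      with x h1 h2 h3
    rw [h1, h2, h3]
    simp
  ext1 o
  rcases o with i | k
  · exact hg i
  · exact hm k

lemma eq_of_obsC_zero {a b : FormSpace n} (ha : a ∈ S.dom) (hb : b ∈ S.dom)
    (h : obsC 0 a = obsC 0 b) : a = b :=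
  sub_eq_zero.mp (S.eq_zero_of_obsC_zero (S.dom.sub_mem ha hb) (by rw [map_sub, h, sub_self]))

lemma qform_re_ge {a : FormSpace n} (ha : a ∈ S.dom) : 0 ≤ (qform a a).re := by
  obtain ⟨δ, hδ, h⟩ := S.repulsive
  refine S.dom_induction (P := fun a => 0 ≤ (qform a a).re)
    (isClosed_le continuous_const (by fun_prop)) ?_ ha
  intro φ
  rw [qform_embed]
  refine le_trans ?_ (h φ).1
  rw [gradNormSq_eq S]
  positivity

lemma coercive_dom : ∃ c : ℝ, 0 < c ∧ ∀ a ∈ S.dom,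
    c * ‖a‖ ^ 2 ≤ (qform a a).re + ‖obsC 0 a‖ ^ 2 := by
  obtain ⟨δ, hδ, h⟩ := S.repulsive
  obtain ⟨C, hC, h'⟩ := S.coercive
  -- The gradient coordinates cost `δ⁻¹` by positivity of the form, and each of the seven multiples
  -- costs `C`.
  have hB : 0 < δ⁻¹ + 7 * C := by positivity
  refine ⟨(δ⁻¹ + 7 * C)⁻¹, inv_pos.mpr hB, fun a ha => ?_⟩
  refine S.dom_induction (P := fun a => (δ⁻¹ + 7 * C)⁻¹ * ‖a‖ ^ 2
    ≤ (qform a a).re + ‖obsC 0 a‖ ^ 2) (isClosed_le (by fun_prop) (by fun_prop)) ?_ ha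
  intro φ
  rw [qform_embed, obsC_zero_embed, norm_toLTwo_sq, inv_mul_le_iff₀ hB, FormSpace.norm_sq,
    ← gradNormSq_eq S]
  have h1 : ∑ k, ‖obsC k (S.embed φ)‖ ^ 2
      ≤ ∑ _k : Fin 7, C * ((schrodingerForm V φ φ).re + ∫ x, ‖φ x‖ ^ 2) :=
    Finset.sum_le_sum fun k _ => by rw [norm_obsC_embed_sq S]; exact h' k φ
  have h2 := (h φ).1
  have h3 : (0 : ℝ) ≤ ∫ x, ‖(w x : ℂ) * φ x‖ ^ 2 := integral_nonneg fun x => by positivity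
  have h4 : (0 : ℝ) ≤ ∫ x, ‖φ x‖ ^ 2 := integral_nonneg fun x => by positivity
  have h5 : gradNormSq φ ≤ δ⁻¹ * (schrodingerForm V φ φ).re := by
    rw [le_inv_mul_iff₀ hδ]; nlinarith
  simp only [Finset.sum_const, Finset.card_univ, Fintype.card_fin, nsmul_eq_mul] at h1
  push_cast at h1
  have h6 : 0 ≤ δ⁻¹ * ∫ x, ‖φ x‖ ^ 2 := by positivity
  nlinarith

lemma qform_conj {a b : FormSpace n} (ha : a ∈ S.dom) (hb : b ∈ S.dom) :
    starRingEnd ℂ (qform a b) = qform b a := by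
  unfold qform
  simp only [map_add, map_sum, inner_conj_symm]
  congr 1
  rw [inner_eq_integral, inner_eq_integral]
  refine integral_congr_ae ?_
  filter_upwards [S.obsC_ae ha 1, S.obsC_ae ha 2, S.obsC_ae hb 1, S.obsC_ae hb 2]
    with x h1 h2 h3 h4
  rw [h1, h2, h3, h4]
  simp only [obs, Matrix.cons_val_one, Matrix.cons_val, map_mul, Complex.conj_ofReal]
  push_cast
  ring

lemma qform_im {a : FormSpace n} (ha : a ∈ S.dom) : (qform a a).im = 0 :=
  Complex.conj_eq_iff_im.mp (S.qform_conj ha ha)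

/-- By coercivity, being Cauchy for the form norm is being Cauchy in the product space, where
completeness supplies the limit. This links the sequential definitions of the statement to the
closed subspace `dom`. -/
lemma isFormApprox_iff {φ : ℕ → PuncturedTest n} {u : LTwo n} :
    IsFormApprox V φ u ↔
      ∃ a ∈ S.dom, obsC 0 a = u ∧ Tendsto (fun j => S.embed (φ j)) atTop (𝓝 a) := by
  have hL2 : Tendsto (fun j => eLpNorm (fun x => φ j x - u x) 2 volume) atTop (𝓝 0) ↔
      Tendsto (fun j => toLTwo (φ j)) atTop (𝓝 u) := by
    rw [Lp.tendsto_Lp_iff_tendsto_eLpNorm']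
    refine tendsto_congr fun j => eLpNorm_congr_ae ?_
    filter_upwards [(φ j).toLTwo_ae] with x hx
    simp [hx]
  constructor
  · rintro ⟨h1, h2⟩
    rw [hL2] at h1
    obtain ⟨c, hc, hcoer⟩ := S.coercive_dom
    have h3 : Tendsto (fun p : ℕ × ℕ => toLTwo (φ p.1) - toLTwo (φ p.2)) atTop (𝓝 0) := by
      rw [← prod_atTop_atTop_eq, ← sub_self u]
      exact (h1.comp tendsto_fst).sub (h1.comp tendsto_snd)
    have h4 : Tendsto (fun p : ℕ × ℕ => c⁻¹ *
        ((schrodingerForm V (φ p.1 - φ p.2) (φ p.1 - φ p.2)).re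
          + ‖toLTwo (φ p.1) - toLTwo (φ p.2)‖ ^ 2)) atTop (𝓝 0) := by
      have h5 := (Complex.continuous_re.tendsto _).comp h2
      have h6 := (h5.add (h3.norm.pow 2)).const_mul c⁻¹
      simpa using h6
    have h7 : Tendsto (fun p : ℕ × ℕ => ‖S.embed (φ p.1) - S.embed (φ p.2)‖ ^ 2)
        atTop (𝓝 0) := by
      refine squeeze_zero (fun p => by positivity) (fun p => ?_) h4
      rw [le_inv_mul_iff₀ hc, ← map_sub, ← map_sub, ← qform_embed S, ← obsC_zero_embed S]
      exact hcoer _ (S.embed_mem _)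
    have h8 : CauchySeq fun j => S.embed (φ j) := by
      rw [cauchySeq_iff_tendsto_dist_atTop_0]
      have := h7.sqrt
      simpa [dist_eq_norm, Real.sqrt_sq] using this
    obtain ⟨a, ha⟩ := cauchySeq_tendsto_of_complete h8
    refine ⟨a, ?_, ?_, ha⟩
    · exact (Submodule.isClosed_topologicalClosure _).mem_of_tendsto ha
        (Eventually.of_forall fun j => S.embed_mem _)
    · refine tendsto_nhds_unique (((obsC 0).continuous.tendsto a).comp ha) ?_
      simpa only [Function.comp_def, obsC_zero_embed] using h1
  · rintro ⟨a, ha, rfl, hφ⟩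
    refine ⟨hL2.mpr ?_, ?_⟩
    · simpa only [Function.comp_def, obsC_zero_embed] using
        ((obsC 0).continuous.tendsto a).comp hφ
    · have h1 : Tendsto (fun p : ℕ × ℕ => S.embed (φ p.1) - S.embed (φ p.2)) atTop (𝓝 0) := by
        rw [← prod_atTop_atTop_eq, ← sub_self a]
        exact (hφ.comp tendsto_fst).sub (hφ.comp tendsto_snd)
      have h2 : Continuous fun a : FormSpace n => qform a a := by fun_prop
      have h3 := (h2.tendsto 0).comp h1
      have h4 : qform (0 : FormSpace n) 0 = 0 := by simp [qform]
      rw [h4] at h3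
      refine h3.congr fun p => ?_
      rw [Function.comp_apply, ← map_sub, qform_embed]

lemma mem_formDomain_iff {u : LTwo n} : u ∈ formDomain V ↔ ∃ a ∈ S.dom, obsC 0 a = u := by
  constructor
  · rintro ⟨φ, hφ⟩
    obtain ⟨a, ha, h, -⟩ := S.isFormApprox_iff.mp hφ
    exact ⟨a, ha, h⟩
  · rintro ⟨a, ha, h⟩
    obtain ⟨φ, hφ⟩ := S.exists_seq ha
    exact ⟨φ, S.isFormApprox_iff.mpr ⟨a, ha, h, hφ⟩⟩

lemma isFormValue_iff {a b : FormSpace n} (ha : a ∈ S.dom) (hb : b ∈ S.dom) {q : ℂ} :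
    IsFormValue V (obsC 0 a) (obsC 0 b) q ↔ qform a b = q := by
  have key : ∀ φ ψ : ℕ → PuncturedTest n, Tendsto (fun j => S.embed (φ j)) atTop (𝓝 a) →
      Tendsto (fun j => S.embed (ψ j)) atTop (𝓝 b) →
      Tendsto (fun j => schrodingerForm V (φ j) (ψ j)) atTop (𝓝 (qform a b)) := by
    intro φ ψ hφ hψ
    have h2 : Continuous fun p : FormSpace n × FormSpace n => qform p.1 p.2 := by fun_prop
    refine ((h2.tendsto (a, b)).comp (hφ.prodMk_nhds hψ)).congr fun j => ?_
    rw [Function.comp_apply, qform_embed]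
  constructor
  · intro h
    obtain ⟨φ, hφ⟩ := S.exists_seq ha
    obtain ⟨ψ, hψ⟩ := S.exists_seq hb
    exact tendsto_nhds_unique (key φ ψ hφ hψ)
      (h φ ψ (S.isFormApprox_iff.mpr ⟨a, ha, rfl, hφ⟩) (S.isFormApprox_iff.mpr ⟨b, hb, rfl, hψ⟩))
  · rintro rfl φ ψ hφ hψ
    obtain ⟨a', ha', h1, h2⟩ := S.isFormApprox_iff.mp hφ
    obtain ⟨b', hb', h3, h4⟩ := S.isFormApprox_iff.mp hψ
    obtain rfl := S.eq_of_obsC_zero ha' ha h1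
    obtain rfl := S.eq_of_obsC_zero hb' hb h3
    exact key φ ψ h2 h4

lemma hamiltonianGraph_iff {u h : LTwo n} : HamiltonianGraph V u h ↔
    ∃ a ∈ S.dom, obsC 0 a = u ∧ ∀ b ∈ S.dom, qform a b = inner ℂ (obsC 0 b) h := by
  constructor
  · rintro ⟨hu, hq⟩
    obtain ⟨a, ha, rfl⟩ := S.mem_formDomain_iff.mp hu
    exact ⟨a, ha, rfl, fun b hb => (S.isFormValue_iff ha hb).mp
      (hq _ (S.mem_formDomain_iff.mpr ⟨b, hb, rfl⟩))⟩
  · rintro ⟨a, ha, rfl, hq⟩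
    refine ⟨S.mem_formDomain_iff.mpr ⟨a, ha, rfl⟩, fun g hg => ?_⟩
    obtain ⟨b, hb, rfl⟩ := S.mem_formDomain_iff.mp hg
    exact (S.isFormValue_iff ha hb).mpr (hq b hb)

end FormSetup

/-! ### Existence of the resolvent by Lax–Milgram -/

/-- If `z` has distance at least `d` from the half line, homogeneity in `q / s` gives `d s ≤ |q - z
s|`, and then `q ≤ |q - z s| + |z| s` controls `q`. -/
lemma exists_dist_ge {z : ℂ} (hz : z ∉ Complex.ofReal '' Set.Ici (0 : ℝ)) :
    ∃ c : ℝ, 0 < c ∧ ∀ q s : ℝ, 0 ≤ q → 0 ≤ s → c * (q + s) ≤ ‖(q : ℂ) - z * s‖ := by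
  have hc : IsClosed (Complex.ofReal '' Set.Ici (0 : ℝ)) :=
    Complex.isometry_ofReal.isClosedEmbedding.isClosedMap _ isClosed_Ici
  obtain ⟨d, hd, hball⟩ := Metric.isOpen_iff.mp hc.isOpen_compl z hz
  have h1 : ∀ t : ℝ, 0 ≤ t → d ≤ ‖(t : ℂ) - z‖ := by
    intro t ht
    by_contra! h
    exact hball (Metric.mem_ball.mpr (by rwa [dist_eq_norm])) ⟨t, ht, rfl⟩
  have hB : 0 < 1 + (‖z‖ + 1) / d := by positivity
  refine ⟨(1 + (‖z‖ + 1) / d)⁻¹, inv_pos.mpr hB, fun q s hq hs => ?_⟩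
  rw [inv_mul_le_iff₀ hB]
  have h2 : d * s ≤ ‖(q : ℂ) - z * s‖ := by
    rcases hs.eq_or_lt with rfl | hs
    · simp
    · have h3 := h1 (q / s) (by positivity)
      have h4 : (q : ℂ) - z * s = ((q / s : ℝ) - z) * s := by
        have : (s : ℂ) ≠ 0 := by exact_mod_cast hs.ne'
        push_cast
        field_simp
      rw [h4, norm_mul, Complex.norm_real, Real.norm_of_nonneg hs.le]
      gcongr
  have h5 : q ≤ ‖(q : ℂ) - z * s‖ + ‖z‖ * s := by
    have h6 := norm_add_le ((q : ℂ) - z * s) (z * s)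
    rw [sub_add_cancel, norm_mul, Complex.norm_real, Complex.norm_real,
      Real.norm_of_nonneg hq, Real.norm_of_nonneg hs] at h6
    exact h6
  have h7 : s ≤ ‖(q : ℂ) - z * s‖ / d := by rw [le_div_iff₀ hd]; linarith
  have h8 : (1 + (‖z‖ + 1) / d) * ‖(q : ℂ) - z * s‖
      = ‖(q : ℂ) - z * s‖ + (‖z‖ + 1) * (‖(q : ℂ) - z * s‖ / d) := by ring
  rw [h8]
  nlinarith [norm_nonneg z]

namespace FormSetup

variable {V W w : RSpace n → ℝ} (S : FormSetup V W w)

instance : CompleteSpace S.dom := (Submodule.isClosed_topologicalClosure _).completeSpace_coe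

/-- The inclusion of the form domain into `L²`. -/
def incl : S.dom →L[ℂ] LTwo n := (obsC 0).comp S.dom.subtypeL

/-- The operator on the form domain which represents the form of `H - z`. -/
def formOp (z : ℂ) : S.dom →L[ℂ] S.dom :=
  ∑ i, ((gradC i).comp S.dom.subtypeL).adjoint.comp ((gradC i).comp S.dom.subtypeL)
    + ((obsC 1).comp S.dom.subtypeL).adjoint.comp ((obsC 2).comp S.dom.subtypeL)
    - S.incl.adjoint.comp (z • S.incl)

lemma inner_formOp (z : ℂ) (a b : S.dom) :
    inner ℂ b (S.formOp z a) = qform (a : FormSpace n) b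
      - z * inner ℂ (obsC 0 (b : FormSpace n)) (obsC 0 (a : FormSpace n)) := by
  simp only [formOp, qform, sub_apply, add_apply, smul_apply,
    sum_apply, ContinuousLinearMap.comp_apply, inner_sub_right,
    inner_add_right, inner_smul_right, inner_sum, ContinuousLinearMap.adjoint_inner_right]
  rfl

/-- Both `Q_H(a,a)` and `‖u‖²` are real and nonnegative, so `exists_dist_ge` bounds `|Q_H(a,a) -
z‖u‖²|` below by their sum, which dominates the full norm by coercivity. -/
lemma isUnit_formOp {z : ℂ} (hz : z ∉ Complex.ofReal '' Set.Ici (0 : ℝ)) :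
    IsUnit (S.formOp z) := by
  obtain ⟨c, hc, h⟩ := exists_dist_ge hz
  obtain ⟨c', hc', h'⟩ := S.coercive_dom
  refine ContinuousLinearMap.isUnit_of_forall_le_norm_inner_map _
    (c := (c * c').toNNReal) (Real.toNNReal_pos.mpr (mul_pos hc hc')) fun a => ?_
  rw [norm_inner_symm, inner_formOp]
  have h1 : qform (a : FormSpace n) a = ((qform (a : FormSpace n) a).re : ℂ) :=
    Complex.ext rfl (by simpa using S.qform_im a.2)
  have h2 : inner ℂ (obsC 0 (a : FormSpace n)) (obsC 0 (a : FormSpace n))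
      = ((‖obsC 0 (a : FormSpace n)‖ ^ 2 : ℝ) : ℂ) := by
    rw [inner_self_eq_norm_sq_to_K]; push_cast; rfl
  rw [h1, h2]
  refine le_trans ?_ (h _ _ (S.qform_re_ge a.2) (by positivity))
  have h3 := h' a a.2
  rw [Real.coe_toNNReal _ (mul_pos hc hc').le]
  change ‖(a : FormSpace n)‖ ^ 2 * (c * c') ≤ _
  nlinarith

theorem exists_resolvent {z : ℂ} (hz : z ∉ Complex.ofReal '' Set.Ici (0 : ℝ)) :
    ∃ R : LTwo n →L[ℂ] LTwo n, IsResolvent V z R ∧ ∀ h, ∃ a ∈ S.dom, obsC 0 a = R h ∧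
      ∀ b ∈ S.dom, qform a b - z * inner ℂ (obsC 0 b) (obsC 0 a) = inner ℂ (obsC 0 b) h := by
  obtain ⟨u, hu⟩ := S.isUnit_formOp hz
  set B : S.dom →L[ℂ] S.dom := ((u⁻¹ : (S.dom →L[ℂ] S.dom)ˣ) : S.dom →L[ℂ] S.dom) with hB
  have hAB : ∀ a, S.formOp z (B a) = a := fun a => by
    have := congrArg (fun T : S.dom →L[ℂ] S.dom => T a) u.mul_inv
    rw [hu] at this
    exact this
  have hBA : ∀ a, B (S.formOp z a) = a := fun a => by
    have := congrArg (fun T : S.dom →L[ℂ] S.dom => T a) u.inv_mul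
    rw [hu] at this
    exact this
  have key : ∀ h : LTwo n, ∀ b ∈ S.dom,
      qform (B (S.incl.adjoint h) : FormSpace n) b
        - z * inner ℂ (obsC 0 b) (obsC 0 (B (S.incl.adjoint h) : FormSpace n))
        = inner ℂ (obsC 0 b) h := by
    intro h b hb
    rw [← S.inner_formOp z (B (S.incl.adjoint h)) ⟨b, hb⟩, hAB,
      ContinuousLinearMap.adjoint_inner_right]
    rfl
  refine ⟨S.incl.comp (B.comp S.incl.adjoint), ⟨fun h => ?_, fun v h hv => ?_⟩, fun h =>
    ⟨_, (B (S.incl.adjoint h)).2, rfl, key h⟩⟩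
  · refine S.hamiltonianGraph_iff.mpr ⟨_, (B (S.incl.adjoint h)).2, rfl, fun b hb => ?_⟩
    rw [inner_add_right, inner_smul_right, ← key h b hb]
    exact (sub_add_cancel _ _).symm
  · obtain ⟨a, ha, rfl, hq⟩ := S.hamiltonianGraph_iff.mp hv
    -- An element of `D(H)` solves the same variational equation, so injectivity of the form
    -- operator identifies it with the constructed solution.
    have h1 : S.formOp z ⟨a, ha⟩ = S.incl.adjoint (h - z • obsC 0 a) := by
      refine ext_inner_left ℂ fun b => ?_
      rw [inner_formOp, ContinuousLinearMap.adjoint_inner_right, inner_sub_right,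
        inner_smul_right]
      change qform a b - _ = _
      rw [hq b b.2]
      rfl
    change S.incl (B (S.incl.adjoint (h - z • obsC 0 a))) = _
    rw [← h1, hBA]
    rfl

end FormSetup

/-! ### Dilations and the virial identity for the Laplacian -/

/-- The components of the radial unit vector field. -/
def xhat (i : Fin n) (x : RSpace n) : ℝ := x i / ‖x‖

lemma abs_xhat_le (i : Fin n) (x : RSpace n) : |xhat i x| ≤ 1 := by
  rw [xhat, abs_div, abs_norm]
  exact div_le_one_of_le₀ (PiLp.norm_apply_le x i) (norm_nonneg x)

lemma measurable_xhat (i : Fin n) : Measurable (xhat (n := n) i) := by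
  unfold xhat; fun_prop

lemma memLp_xhat (i : Fin n) : MemLp (xhat (n := n) i) ∞ volume :=
  memLp_top_of_bound (measurable_xhat i).aestronglyMeasurable 1 (ae_of_all _ (abs_xhat_le i))

lemma sum_xhat_sq {x : RSpace n} (hx : x ≠ 0) : ∑ i, xhat i x ^ 2 = 1 := by
  have h : 0 < ‖x‖ := norm_pos_iff.mpr hx
  simp only [xhat, div_pow, ← Finset.sum_div]
  rw [← EuclideanSpace.real_norm_sq_eq]
  field_simp

namespace PuncturedTest

/-- The dilated test function `x ↦ φ (eˢ x)`. -/
def dil (s : ℝ) (φ : PuncturedTest n) : PuncturedTest n where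
  toFun x := φ (Real.exp s • x)
  contDiff' := φ.contDiff.comp (contDiff_const_smul _)
  hasCompactSupport' := φ.hasCompactSupport.comp_homeomorph
    (Homeomorph.smulOfNeZero (Real.exp s) (Real.exp_pos s).ne')
  tsupport_subset' := by
    refine closure_minimal (t := {x | Real.exp s • x ∈ tsupport φ}) (fun x hx => ?_)
      ((isClosed_tsupport _).preimage (continuous_const_smul _)) |>.trans fun x hx => ?_
    · exact subset_tsupport _ hx
    · rintro rfl
      exact φ.notMem_tsupport_zero (by simpa using hx)

@[simp] lemma dil_apply (s : ℝ) (φ : PuncturedTest n) (x : RSpace n) :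
    dil s φ x = φ (Real.exp s • x) := rfl

lemma fderiv_dil (s : ℝ) (φ : PuncturedTest n) (x v : RSpace n) :
    fderiv ℝ (dil s φ) x v = Real.exp s * fderiv ℝ φ (Real.exp s • x) v := by
  have h1 : HasFDerivAt (fun x : RSpace n => Real.exp s • x)
      (Real.exp s • ContinuousLinearMap.id ℝ (RSpace n)) x :=
    (Real.exp s • ContinuousLinearMap.id ℝ (RSpace n)).hasFDerivAt
  have h2 : HasFDerivAt (dil s φ) _ x :=
    (φ.differentiable.differentiableAt (x := Real.exp s • x)).hasFDerivAt.comp x h1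
  rw [h2.fderiv]
  simp

lemma pd_dil (i : Fin n) (s : ℝ) (φ : PuncturedTest n) :
    pd i (dil s φ) = (Real.exp s : ℂ) • dil s (pd i φ) := by
  ext x
  exact fderiv_dil s φ x _

lemma dil_sub (s : ℝ) (φ ψ : PuncturedTest n) : dil s (φ - ψ) = dil s φ - dil s ψ := rfl

lemma inner_dil (s : ℝ) (φ ψ : PuncturedTest n) :
    inner ℂ (toLTwo (dil s φ)) (toLTwo ψ)
      = Real.exp (-(n * s)) * inner ℂ (toLTwo φ) (toLTwo (dil (-s) ψ)) := by
  rw [inner_toLTwo, inner_toLTwo]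
  have h := Measure.integral_comp_smul_of_nonneg (volume : Measure (RSpace n))
    (fun x => dil (-s) ψ x * starRingEnd ℂ (φ x)) (Real.exp s) (hR := (Real.exp_pos s).le)
  simp only [dil_apply, smul_smul, ← Real.exp_add, neg_add_cancel, Real.exp_zero, one_smul] at h
  simp only [dil_apply]
  rw [h, finrank_euclideanSpace_fin, Complex.real_smul, ← Real.exp_nat_mul, ← Real.exp_neg]

lemma dil_dil (s t : ℝ) (φ : PuncturedTest n) : dil s (dil t φ) = dil (s + t) φ := by
  ext x
  simp [smul_smul, Real.exp_add, mul_comm]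

lemma dil_zero (φ : PuncturedTest n) : dil 0 φ = φ := by
  ext x; simp

lemma norm_dil_sq (s : ℝ) (φ : PuncturedTest n) :
    ‖toLTwo (dil s φ)‖ ^ 2 = Real.exp (-(n * s)) * ‖toLTwo φ‖ ^ 2 := by
  have h := inner_dil s φ (dil s φ)
  rw [dil_dil, neg_add_cancel, dil_zero, inner_self_eq_norm_sq_to_K,
    inner_self_eq_norm_sq_to_K] at h
  apply Complex.ofReal_injective
  push_cast
  push_cast at h
  exact h

lemma norm_dil_le {s : ℝ} (hs : |s| ≤ 1) (φ : PuncturedTest n) :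
    ‖toLTwo (dil s φ)‖ ≤ Real.exp n * ‖toLTwo φ‖ := by
  refine le_of_sq_le_sq ?_ (by positivity)
  rw [norm_dil_sq, mul_pow, ← Real.exp_nat_mul]
  gcongr
  have h1 := (abs_le.mp hs).1
  have h2 : (0 : ℝ) ≤ n := Nat.cast_nonneg n
  push_cast
  nlinarith

lemma norm_pd_dil_le {s : ℝ} (hs : |s| ≤ 1) (i : Fin n) (φ : PuncturedTest n) :
    ‖toLTwo (pd i (dil s φ))‖ ≤ Real.exp (n + 1) * ‖toLTwo (pd i φ)‖ := by
  rw [pd_dil, map_smul, norm_smul, Complex.norm_real, Real.norm_eq_abs, Real.abs_exp]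
  calc Real.exp s * ‖toLTwo (dil s (pd i φ))‖
      ≤ Real.exp 1 * (Real.exp n * ‖toLTwo (pd i φ)‖) := by
        gcongr
        · exact (abs_le.mp hs).2
        · exact norm_dil_le hs _
    _ = Real.exp (n + 1) * ‖toLTwo (pd i φ)‖ := by rw [Real.exp_add]; ring

lemma exists_bound_support (φ : PuncturedTest n) :
    ∃ R : ℝ, 0 < R ∧ ∀ x, R < ‖x‖ → φ x = 0 := by
  obtain ⟨R, hR⟩ := φ.hasCompactSupport.isCompact.isBounded.exists_norm_le
  refine ⟨max R 1, by positivity, fun x hx => ?_⟩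
  by_contra h
  exact absurd (hR x (subset_tsupport _ h)) (not_le.mpr ((le_max_left _ _).trans_lt hx))

lemma exists_bound (φ : PuncturedTest n) : ∃ M : ℝ, 0 < M ∧ ∀ x, ‖φ x‖ ≤ M := by
  obtain ⟨M, hM⟩ := φ.continuous.bounded_above_of_compact_support φ.hasCompactSupport
  exact ⟨max M 1, by positivity, fun x => (hM x).trans (le_max_left _ _)⟩

lemma dil_eq_zero {φ : PuncturedTest n} {R : ℝ} (hR : ∀ x, R < ‖x‖ → φ x = 0) {s : ℝ}
    (hs : |s| ≤ 2) {x : RSpace n} (hx : Real.exp 2 * R < ‖x‖) : dil s φ x = 0 := by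
  refine hR _ ?_
  rw [norm_smul, Real.norm_eq_abs, Real.abs_exp]
  have h1 : Real.exp (-2) ≤ Real.exp s := Real.exp_le_exp.mpr (abs_le.mp hs).1
  calc R = Real.exp (-2) * (Real.exp 2 * R) := by
        rw [← mul_assoc, ← Real.exp_add]; simp
    _ < Real.exp (-2) * ‖x‖ := by gcongr
    _ ≤ Real.exp s * ‖x‖ := by gcongr

lemma tendsto_dil (φ : PuncturedTest n) :
    Tendsto (fun s => toLTwo (dil s φ)) (𝓝 0) (𝓝 (toLTwo φ)) := by
  classical
  obtain ⟨R, hR0, hR⟩ := φ.exists_bound_support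
  obtain ⟨M, hM0, hM⟩ := φ.exists_bound
  rw [tendsto_iff_norm_sub_tendsto_zero]
  have h : Tendsto (fun s => ∫ x, ‖(dil s φ - φ) x‖ ^ 2) (𝓝 0)
      (𝓝 (∫ _ : RSpace n, (0 : ℝ))) := by
    refine tendsto_integral_filter_of_dominated_convergence
      ((Metric.closedBall (0 : RSpace n) (Real.exp 2 * R)).indicator fun _ => (2 * M) ^ 2)
      (Eventually.of_forall fun s => ?_) ?_ ?_ (ae_of_all _ fun x => ?_)
    · exact ((dil s φ - φ).continuous.norm.pow 2).aestronglyMeasurable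
    · filter_upwards [Metric.ball_mem_nhds (0 : ℝ) zero_lt_two] with s hs
      have hs2 : |s| ≤ 2 := by simpa using (Metric.mem_ball.mp hs).le
      refine ae_of_all _ fun x => ?_
      rw [Set.indicator_apply]
      split_ifs with hx
      · rw [norm_pow, norm_norm]
        gcongr
        change ‖dil s φ x - φ x‖ ≤ _
        have h3 : ‖dil s φ x‖ ≤ M := hM _
        exact (norm_sub_le _ _).trans (by linarith [hM x])
      · have hx' : Real.exp 2 * R < ‖x‖ := by simpa using hx
        have h1 : dil s φ x = 0 := dil_eq_zero hR hs2 hx'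
        have h2 := dil_eq_zero hR (s := 0) (by simp) hx'
        rw [dil_zero] at h2
        change ‖‖dil s φ x - φ x‖ ^ 2‖ ≤ 0
        simp [h1, h2]
    · exact (integrable_indicator_iff Metric.isClosed_closedBall.measurableSet).mpr
        (integrableOn_const (isCompact_closedBall _ _).measure_lt_top.ne)
    · have hc : Continuous fun s => ‖(dil s φ - φ) x‖ ^ 2 := by
        change Continuous fun s => ‖φ (Real.exp s • x) - φ x‖ ^ 2
        have := φ.continuous
        fun_prop
      have h0 := hc.tendsto 0
      rwa [dil_zero, sub_self, show ‖(0 : PuncturedTest n) x‖ ^ 2 = 0 by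
        change ‖(0 : ℂ)‖ ^ 2 = 0; simp] at h0
  rw [integral_zero] at h
  have h2 := h.sqrt
  simp only [Real.sqrt_zero] at h2
  refine h2.congr fun s => ?_
  rw [← norm_toLTwo_sq, map_sub, Real.sqrt_sq (norm_nonneg _)]

/-- The product of a test function with `|x|⁻¹`. -/
def invR : PuncturedTest n → PuncturedTest n :=
  radialMul (fun r => ((r⁻¹ : ℝ) : ℂ)) fun r hr =>
    Complex.ofRealCLM.contDiff.contDiffAt.comp r (contDiffAt_inv ℝ hr.ne')

@[simp] lemma invR_apply (φ : PuncturedTest n) (x : RSpace n) :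
    invR φ x = ((‖x‖⁻¹ : ℝ) : ℂ) * φ x := rfl

/-- The radial derivative of a test function. -/
def rad (φ : PuncturedTest n) : LTwo n := ∑ i, mulLp (xhat i) (memLp_xhat i) (toLTwo (pd i φ))

lemma rad_ae (φ : PuncturedTest n) :
    rad φ =ᵐ[volume] fun x => ((‖x‖⁻¹ : ℝ) : ℂ) * fderiv ℝ φ x x := by
  have h1 := Lp.coeFn_finsetSum Finset.univ
    fun i : Fin n => mulLp (xhat i) (memLp_xhat i) (toLTwo (pd i φ))
  have h2 : ∀ᵐ x, ∀ i : Fin n, mulLp (xhat i) (memLp_xhat i) (toLTwo (pd i φ)) x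
      = (xhat i x : ℂ) * toLTwo (pd i φ) x := ae_all_iff.mpr fun i => mulLp_ae _ _
  have h3 : ∀ᵐ x, ∀ i : Fin n, toLTwo (pd i φ) x = partialDeriv i φ x :=
    ae_all_iff.mpr fun i => (pd i φ).toLTwo_ae
  filter_upwards [h1, h2, h3] with x hx1 hx2 hx3
  rw [rad, hx1, fderiv_apply_eq_sum, Finset.mul_sum, Finset.sum_apply]
  refine Finset.sum_congr rfl fun i _ => ?_
  rw [hx2, hx3, xhat]
  push_cast
  ring

end PuncturedTest

namespace PuncturedTest

lemma hasDerivAt_dil (φ : PuncturedTest n) (x : RSpace n) (s : ℝ) :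
    HasDerivAt (fun s => dil s φ x) (fderiv ℝ (dil s φ) x x) s := by
  have h1 : HasDerivAt (fun s : ℝ => Real.exp s • x) (Real.exp s • x) s :=
    (Real.hasDerivAt_exp s).smul_const x
  have h2 := (φ.differentiable.differentiableAt (x := Real.exp s • x)).hasFDerivAt.comp_hasDerivAt
    s h1
  rw [fderiv_dil]
  simpa [Function.comp_def] using h2

/-- The factor `|x|⁻¹` in `invR` turns the generator `x·∇` of dilations into the radial derivative,
whose `L²` norm is controlled by the gradient, independently of the support of `φ`. -/
lemma hasDerivAt_inner_dil (φ : PuncturedTest n) (Y : LTwo n) {s : ℝ} (hs : |s| ≤ 1) :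
    HasDerivAt (fun s => inner ℂ (toLTwo (invR (dil s φ))) Y) (inner ℂ (rad (dil s φ)) Y) s := by
  classical
  obtain ⟨R, hR0, hR⟩ := φ.exists_bound_support
  obtain ⟨M, hM⟩ := φ.continuous_fderiv.bounded_above_of_compact_support
    (φ.hasCompactSupport.fderiv ℝ)
  have hM0 : 0 ≤ M := (norm_nonneg _).trans (hM 0)
  set B := Metric.closedBall (0 : RSpace n) (Real.exp 2 * R) with hB
  have e1 : ∀ s, inner ℂ (toLTwo (invR (dil s φ))) Y
      = ∫ x, Y x * starRingEnd ℂ (((‖x‖⁻¹ : ℝ) : ℂ) * dil s φ x) := fun s => by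
    rw [inner_eq_integral]
    refine integral_congr_ae ?_
    filter_upwards [(invR (dil s φ)).toLTwo_ae] with x hx
    rw [hx, invR_apply]
  have e2 : ∀ s, inner ℂ (rad (dil s φ)) Y
      = ∫ x, Y x * starRingEnd ℂ (((‖x‖⁻¹ : ℝ) : ℂ) * fderiv ℝ (dil s φ) x x) := fun s => by
    rw [inner_eq_integral]
    refine integral_congr_ae ?_
    filter_upwards [rad_ae (dil s φ)] with x hx
    rw [hx]
  simp only [e1, e2]
  refine (hasDerivAt_integral_of_dominated_loc_of_deriv_le (𝕜 := ℝ) (E := ℂ) (s := Metric.ball s 1)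
    (F := fun s x => Y x * starRingEnd ℂ (((‖x‖⁻¹ : ℝ) : ℂ) * dil s φ x))
    (F' := fun s x => Y x * starRingEnd ℂ (((‖x‖⁻¹ : ℝ) : ℂ) * fderiv ℝ (dil s φ) x x))
    (bound := B.indicator fun x => ‖Y x‖ * (Real.exp 2 * M)) (Metric.ball_mem_nhds s one_pos)
    (Eventually.of_forall fun s => ?_) ?_ ?_ (ae_of_all _ fun x => ?_) ?_
    (ae_of_all _ fun x t _ => ?_)).2
  · have h := (integrable_mul_conj (toLTwo (invR (dil s φ))) Y).aestronglyMeasurable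
    refine h.congr ?_
    filter_upwards [(invR (dil s φ)).toLTwo_ae] with x hx
    rw [hx, invR_apply]
  · refine (integrable_mul_conj (toLTwo (invR (dil s φ))) Y).congr ?_
    filter_upwards [(invR (dil s φ)).toLTwo_ae] with x hx
    rw [hx, invR_apply]
  · refine (integrable_mul_conj (rad (dil s φ)) Y).aestronglyMeasurable.congr ?_
    filter_upwards [rad_ae (dil s φ)] with x hx
    rw [hx]
  -- Here `|t| ≤ 2`, so the dilated functions live in one fixed ball, on which the factor `|x|⁻¹`
  -- cancels the `|x|` from the derivative along `x`.
  · intro t ht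
    have ht2 : |t| ≤ 2 := by
      have h1 : |t - s| < 1 := by simpa [Real.dist_eq] using ht
      have h2 := abs_add_le (t - s) s
      rw [sub_add_cancel] at h2
      linarith
    rw [Set.indicator_apply]
    split_ifs with hx
    · rw [norm_mul, RCLike.norm_conj, norm_mul, fderiv_dil, norm_mul, Complex.norm_real,
        Complex.norm_real, norm_inv, norm_norm, Real.norm_eq_abs, Real.abs_exp]
      refine mul_le_mul_of_nonneg_left ?_ (norm_nonneg _)
      have h3 : ‖fderiv ℝ φ (Real.exp t • x) x‖ ≤ M * ‖x‖ :=
        (ContinuousLinearMap.le_opNorm _ _).trans (by gcongr; exact hM _)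
      have h4 : Real.exp t ≤ Real.exp 2 := Real.exp_le_exp.mpr (abs_le.mp ht2).2
      calc ‖x‖⁻¹ * (Real.exp t * ‖fderiv ℝ φ (Real.exp t • x) x‖)
          ≤ ‖x‖⁻¹ * (Real.exp 2 * (M * ‖x‖)) := by gcongr
        _ = (Real.exp 2 * M) * (‖x‖⁻¹ * ‖x‖) := by ring
        _ ≤ (Real.exp 2 * M) * 1 := by gcongr; exact inv_mul_le_one
        _ = _ := mul_one _
    · have hx' : Real.exp 2 * R < ‖x‖ := by simpa [hB] using hx
      have h1 : dil t φ =ᶠ[𝓝 x] fun _ => (0 : ℂ) := by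
        filter_upwards [(isOpen_lt continuous_const continuous_norm).mem_nhds hx'] with y hy
        exact dil_eq_zero hR ht2 hy
      rw [h1.fderiv_eq]
      simp
  · have hY : MemLp (fun x => (Y x)) 2 (volume.restrict B) := (Lp.memLp Y).restrict B
    have : IsFiniteMeasure (volume.restrict B) :=
      ⟨by simpa using (isCompact_closedBall _ _).measure_lt_top⟩
    exact (integrable_indicator_iff Metric.isClosed_closedBall.measurableSet).mpr
      ((hY.integrable one_le_two).norm.mul_const _)
  · have h1 := (hasDerivAt_dil φ x t).const_mul (((‖x‖⁻¹ : ℝ) : ℂ))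
    have h2 := (Complex.conjCLE : ℂ →L[ℝ] ℂ).hasFDerivAt.comp_hasDerivAt t h1
    exact h2.const_mul (Y x)

lemma rad_sub (φ ψ : PuncturedTest n) : rad (φ - ψ) = rad φ - rad ψ := by
  simp [rad, Finset.sum_sub_distrib]

/-- The sum of the `L²` norms of the partial derivatives. -/
def gradNorm (φ : PuncturedTest n) : ℝ := ∑ i, ‖toLTwo (pd i φ)‖

lemma gradNorm_nonneg (φ : PuncturedTest n) : 0 ≤ gradNorm φ :=
  Finset.sum_nonneg fun _ _ => norm_nonneg _

lemma gradNorm_add_le (φ ψ : PuncturedTest n) : gradNorm (φ + ψ) ≤ gradNorm φ + gradNorm ψ := by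
  simp only [gradNorm, ← Finset.sum_add_distrib, map_add]
  exact Finset.sum_le_sum fun i _ => norm_add_le _ _

lemma gradNorm_neg (φ : PuncturedTest n) : gradNorm (-φ) = gradNorm φ := by
  simp only [gradNorm, map_neg, norm_neg]

lemma gradNorm_dil_le {s : ℝ} (hs : |s| ≤ 1) (φ : PuncturedTest n) :
    gradNorm (dil s φ) ≤ Real.exp (n + 1) * gradNorm φ := by
  rw [gradNorm, gradNorm, Finset.mul_sum]
  exact Finset.sum_le_sum fun i _ => norm_pd_dil_le hs i φ

lemma norm_rad_le (φ : PuncturedTest n) : ‖rad φ‖ ≤ gradNorm φ := by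
  refine (norm_sum_le _ _).trans (Finset.sum_le_sum fun i _ => ?_)
  simpa using norm_mulLp_le (memLp_xhat i) (ae_of_all _ (abs_xhat_le i)) (toLTwo (pd i φ))

lemma tendsto_gradNorm_dil_sub (φ : PuncturedTest n) :
    Tendsto (fun s => gradNorm (dil s φ - φ)) (𝓝 0) (𝓝 0) := by
  have h : ∀ i ∈ Finset.univ, Tendsto (fun s => ‖toLTwo (pd i (dil s φ - φ))‖) (𝓝 0) (𝓝 0) := by
    intro i _
    have h1 : Tendsto (fun s : ℝ => (Real.exp s : ℂ) • toLTwo (dil s (pd i φ))) (𝓝 0)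
        (𝓝 ((Real.exp 0 : ℂ) • toLTwo (pd i φ))) :=
      (Complex.continuous_ofReal.comp Real.continuous_exp).continuousAt.tendsto.smul
        (tendsto_dil (pd i φ))
    have h2 := (h1.sub_const (toLTwo (pd i φ))).norm
    simp only [Real.exp_zero, Complex.ofReal_one, one_smul, sub_self, norm_zero] at h2
    refine h2.congr fun s => ?_
    rw [map_sub, map_sub, pd_dil, map_smul]
  simpa [gradNorm] using tendsto_finsetSum _ h

/-- Mean value inequality on `[-t, t]` for the pairing minus its linear part at `0`. The symmetric
difference quotient thus approximates the radial derivative with an error governed only by how much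
dilations move `∇φ`. -/
lemma norm_inner_dil_sub_le (φ : PuncturedTest n) (Y : LTwo n) {t M : ℝ} (ht0 : 0 ≤ t)
    (ht1 : t ≤ 1) (hM : ∀ s, |s| ≤ t → gradNorm (dil s φ - φ) ≤ M) :
    ‖inner ℂ (toLTwo (invR (dil t φ))) Y - inner ℂ (toLTwo (invR (dil (-t) φ))) Y
      - 2 * t * inner ℂ (rad φ) Y‖ ≤ 2 * t * ‖Y‖ * M := by
  set f : ℝ → ℂ := fun s => inner ℂ (toLTwo (invR (dil s φ))) Y - s * inner ℂ (rad φ) Y with hf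
  have h1 : ∀ s ∈ Set.Icc (-t) t, HasDerivWithinAt f
      (inner ℂ (rad (dil s φ)) Y - inner ℂ (rad φ) Y) (Set.Icc (-t) t) s := by
    intro s hs
    have h2 : HasDerivAt (fun s : ℝ => (s : ℂ) * inner ℂ (rad φ) Y) (inner ℂ (rad φ) Y) s := by
      simpa using (Complex.ofRealCLM.hasDerivAt (x := s)).mul_const (inner ℂ (rad φ) Y)
    exact ((hasDerivAt_inner_dil φ Y ((abs_le.mpr hs).trans ht1)).sub h2).hasDerivWithinAt
  have h3 : ∀ s ∈ Set.Icc (-t) t,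
      ‖inner ℂ (rad (dil s φ)) Y - inner ℂ (rad φ) Y‖ ≤ ‖Y‖ * M := by
    intro s hs
    rw [← inner_sub_left, ← rad_sub, mul_comm]
    refine (norm_inner_le_norm _ _).trans ?_
    gcongr
    exact (norm_rad_le _).trans (hM s (abs_le.mpr hs))
  have h4 := (convex_Icc (-t) t).norm_image_sub_le_of_norm_hasDerivWithin_le h1 h3
    (Set.left_mem_Icc.mpr (by linarith)) (Set.right_mem_Icc.mpr (by linarith))
  have h5 : f t - f (-t) = inner ℂ (toLTwo (invR (dil t φ))) Y
      - inner ℂ (toLTwo (invR (dil (-t) φ))) Y - 2 * t * inner ℂ (rad φ) Y := by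
    simp only [hf]; push_cast; ring
  rw [h5, sub_neg_eq_add, Real.norm_of_nonneg (by linarith)] at h4
  linarith

/-- Changing variables moves the dilation to the other factor: the pairings at `t` and `-t` are
conjugate up to the scaling factor `e^{(n-2)t}`, where `n` comes from the volume and `2` from the
two derivatives. This replaces the commutator of the Laplacian with dilations. -/
lemma re_inner_pd_dil_sub (φ : PuncturedTest n) (t : ℝ) (i : Fin n) :
    (inner ℂ (toLTwo (pd i (dil t φ))) (toLTwo (pd i φ))
      - inner ℂ (toLTwo (pd i (dil (-t) φ))) (toLTwo (pd i φ))).re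
      = (1 - Real.exp ((n - 2) * t))
        * (inner ℂ (toLTwo (pd i (dil t φ))) (toLTwo (pd i φ))).re := by
  have h : (inner ℂ (toLTwo (pd i (dil (-t) φ))) (toLTwo (pd i φ))).re
      = Real.exp ((n - 2) * t) * (inner ℂ (toLTwo (pd i (dil t φ))) (toLTwo (pd i φ))).re := by
    rw [pd_dil, pd_dil, map_smul, map_smul, inner_smul_left, inner_smul_left, inner_dil, neg_neg,
      Complex.conj_ofReal, Complex.conj_ofReal, Complex.re_ofReal_mul, Complex.re_ofReal_mul,
      Complex.re_ofReal_mul, ← inner_conj_symm, Complex.conj_re, ← mul_assoc, ← mul_assoc,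
      ← Real.exp_add, ← Real.exp_add]
    congr 2
    ring
  rw [Complex.sub_re, h]
  ring

end PuncturedTest

/-- The radial derivative. -/
def radC : FormSpace n →L[ℂ] LTwo n := ∑ i, (mulLp (xhat i) (memLp_xhat i)).comp (gradC i)

lemma radC_apply (a : FormSpace n) :
    radC a = ∑ i, mulLp (xhat i) (memLp_xhat i) (gradC i a) := by
  simp [radC, sum_apply]

lemma norm_sum_inner_le (x y : Fin n → LTwo n) :
    ‖∑ i, inner ℂ (x i) (y i)‖ ≤ (∑ i, ‖x i‖) * ∑ i, ‖y i‖ := by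
  refine (norm_sum_le _ _).trans ?_
  rw [Finset.sum_mul]
  refine Finset.sum_le_sum fun i _ => (norm_inner_le_norm _ _).trans ?_
  gcongr
  exact Finset.single_le_sum (f := fun i => ‖y i‖) (fun _ _ => norm_nonneg _) (Finset.mem_univ i)

/-- The equation is tested with the difference `φ(eᵗ·) - φ(e⁻ᵗ·)`, an admissible substitute for `2t
x·∇φ`. The error from replacing `G` by `∇φ` carries no factor `t`, but vanishes when `φ` runs
through an approximating sequence at fixed `t`. -/
lemma abs_virial_test_le {G : Fin n → LTwo n} {Y : LTwo n}
    (hY : ∀ φ : PuncturedTest n,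
      ∑ i, inner ℂ (toLTwo (pd i φ)) (G i) = inner ℂ (toLTwo (invR φ)) Y)
    (φ : PuncturedTest n) {t M : ℝ} (ht0 : 0 ≤ t) (ht1 : t ≤ 1)
    (hM : ∀ s, |s| ≤ t → gradNorm (dil s φ - φ) ≤ M) :
    |(1 - Real.exp ((n - 2) * t)) * ∑ i, ‖toLTwo (pd i φ)‖ ^ 2
        - 2 * t * (inner ℂ (rad φ) Y).re|
      ≤ |1 - Real.exp ((n - 2) * t)| * (M * gradNorm φ)
        + 2 * Real.exp (n + 1) * gradNorm φ * ∑ i, ‖toLTwo (pd i φ) - G i‖ + 2 * t * ‖Y‖ * M := by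
  set e := Real.exp ((n - 2) * t) with he
  have habs : |t| ≤ t := (abs_of_nonneg ht0).le
  set P : ℂ := ∑ i, inner ℂ (toLTwo (pd i (dil t φ))) (toLTwo (pd i φ)) with hP
  set D : ℂ := inner ℂ (toLTwo (invR (dil t φ))) Y - inner ℂ (toLTwo (invR (dil (-t) φ))) Y with hD
  have h1 : ‖P - ∑ i, inner ℂ (toLTwo (pd i φ)) (toLTwo (pd i φ))‖ ≤ M * gradNorm φ := by
    rw [hP, ← Finset.sum_sub_distrib]
    simp only [← inner_sub_left, ← map_sub]
    refine (norm_sum_inner_le _ _).trans ?_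
    have := gradNorm_nonneg φ
    exact mul_le_mul_of_nonneg_right (hM t habs) this
  have h2 : (1 - e) * P.re - D.re = (∑ i, inner ℂ (toLTwo (pd i (dil t φ - dil (-t) φ)))
      (toLTwo (pd i φ) - G i)).re := by
    simp only [inner_sub_right, Finset.sum_sub_distrib, hY]
    rw [Complex.sub_re]
    congr 1
    · rw [hP, Complex.re_sum, Complex.re_sum, Finset.mul_sum]
      refine Finset.sum_congr rfl fun i _ => ?_
      rw [map_sub, map_sub, inner_sub_left, re_inner_pd_dil_sub]
    · rw [← Complex.sub_re, ← inner_sub_left, ← map_sub]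
      congr 3
      ext x
      exact (mul_sub _ _ _).symm
  have h3 : ‖∑ i, inner ℂ (toLTwo (pd i (dil t φ - dil (-t) φ))) (toLTwo (pd i φ) - G i)‖
      ≤ 2 * Real.exp (n + 1) * gradNorm φ * ∑ i, ‖toLTwo (pd i φ) - G i‖ := by
    refine (norm_sum_inner_le _ _).trans ?_
    gcongr
    have h4 := gradNorm_add_le (dil t φ) (-dil (-t) φ)
    rw [gradNorm_neg, ← sub_eq_add_neg] at h4
    have h5 := gradNorm_dil_le (habs.trans ht1) φ
    have h6 := gradNorm_dil_le (s := -t) (by rw [abs_neg]; exact habs.trans ht1) φ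
    change gradNorm (dil t φ - dil (-t) φ) ≤ _
    linarith
  have h7 := norm_inner_dil_sub_le φ Y ht0 ht1 hM
  have h8 : ∑ i, ‖toLTwo (pd i φ)‖ ^ 2
      = (∑ i, inner ℂ (toLTwo (pd i φ)) (toLTwo (pd i φ))).re := by
    rw [Complex.re_sum]
    exact Finset.sum_congr rfl fun i _ => (inner_self_eq_norm_sq (𝕜 := ℂ) _).symm
  have h9 : (D - 2 * t * inner ℂ (rad φ) Y).re = D.re - 2 * t * (inner ℂ (rad φ) Y).re := by
    rw [Complex.sub_re, show (2 * t * inner ℂ (rad φ) Y : ℂ) = ((2 * t : ℝ) : ℂ) *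
      inner ℂ (rad φ) Y by push_cast; ring, Complex.re_ofReal_mul]
  have h10 : (1 - e) * ∑ i, ‖toLTwo (pd i φ)‖ ^ 2 - 2 * t * (inner ℂ (rad φ) Y).re
      = -((1 - e) * (P - ∑ i, inner ℂ (toLTwo (pd i φ)) (toLTwo (pd i φ))).re)
        + ((1 - e) * P.re - D.re) + (D - 2 * t * inner ℂ (rad φ) Y).re := by
    rw [h9, h8, Complex.sub_re]; ring
  rw [h10, h2]
  refine (abs_add_three _ _ _).trans ?_
  rw [abs_neg, abs_mul]
  have h11 := (Complex.abs_re_le_norm _).trans h1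
  gcongr
  · exact (Complex.abs_re_le_norm _).trans h3
  · exact (Complex.abs_re_le_norm _).trans h7

/-- The virial identity for the Laplacian and the generator of dilations. -/
theorem FormSetup.re_inner_radC {V W w : RSpace n → ℝ} (S : FormSetup V W w) {a : FormSpace n}
    (ha : a ∈ S.dom) {Y : LTwo n}
    (hY : ∀ φ : PuncturedTest n,
      ∑ i, inner ℂ (toLTwo (pd i φ)) (gradC i a) = inner ℂ (toLTwo (invR φ)) Y) :
    (inner ℂ (radC a) Y).re = (1 - n / 2) * ∑ i, ‖gradC i a‖ ^ 2 := by
  obtain ⟨φ, hφ⟩ := S.exists_seq ha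
  set K := Real.exp (n + 1) with hK
  set g := ∑ i, ‖gradC i a‖ with hg
  have hg0 : 0 ≤ g := Finset.sum_nonneg fun _ _ => norm_nonneg _
  have hpd : ∀ i, Tendsto (fun j => toLTwo (pd i (φ j))) atTop (𝓝 (gradC i a)) := fun i =>
    ((gradC i).continuous.tendsto a).comp hφ
  have hgn : Tendsto (fun j => gradNorm (φ j)) atTop (𝓝 g) :=
    tendsto_finsetSum _ fun i _ => (hpd i).norm
  have hsq : Tendsto (fun j => ∑ i, ‖toLTwo (pd i (φ j))‖ ^ 2) atTop
      (𝓝 (∑ i, ‖gradC i a‖ ^ 2)) := tendsto_finsetSum _ fun i _ => (hpd i).norm.pow 2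
  have hrad : Tendsto (fun j => rad (φ j)) atTop (𝓝 (radC a)) := by
    rw [radC_apply]
    exact tendsto_finsetSum _ fun i _ =>
      ((mulLp (xhat i) (memLp_xhat i)).continuous.tendsto _).comp (hpd i)
  have hdist : Tendsto (fun j => ∑ i, ‖toLTwo (pd i (φ j)) - gradC i a‖) atTop (𝓝 0) := by
    have := tendsto_finsetSum Finset.univ fun i _ => ((hpd i).sub_const (gradC i a)).norm
    simpa using this
  -- The order of limits matters: the approximation index goes to infinity at fixed `t`, then the
  -- inequality is divided by `t` and `t → 0`, and finally `η → 0`.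
  have key : ∀ η : ℝ, 0 < η → ∀ᶠ t : ℝ in 𝓝[>] 0,
      |(1 - Real.exp ((n - 2) * t)) * ∑ i, ‖gradC i a‖ ^ 2 - 2 * t * (inner ℂ (radC a) Y).re|
        ≤ (|1 - Real.exp ((n - 2) * t)| * g + 2 * t * ‖Y‖) * (3 * η) := by
    intro η hη
    have h1 : ∀ᶠ j in atTop, (K + 1) * ∑ i, ‖toLTwo (pd i (φ j)) - gradC i a‖ < η := by
      have := hdist.const_mul (K + 1)
      rw [mul_zero] at this
      exact this.eventually_lt_const hη
    obtain ⟨l, hl⟩ := h1.exists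
    have h2 := (tendsto_gradNorm_dil_sub (φ l)).eventually_lt_const hη
    obtain ⟨r, hr0, hr⟩ := Metric.eventually_nhds_iff.mp h2
    have h3 : ∀ᶠ t : ℝ in 𝓝[>] 0, t < min r 1 :=
      (eventually_lt_nhds (lt_min hr0 one_pos)).filter_mono nhdsWithin_le_nhds
    filter_upwards [h3, self_mem_nhdsWithin] with t ht ht0
    have ht0' : (0 : ℝ) < t := ht0
    have ht1 : t ≤ 1 := (ht.trans_le (min_le_right _ _)).le
    -- Dilations with `|s| ≤ 1` are uniformly bounded for the gradient norm, so strong continuity at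
    -- the single function `φ l` transfers to every `φ j` up to its distance from `φ l`.
    have h4 : ∀ j, ∀ s, |s| ≤ t → gradNorm (dil s (φ j) - φ j)
        ≤ η + (K + 1) * gradNorm (φ j - φ l) := by
      intro j s hs
      have h5 : gradNorm (dil s (φ l) - φ l) < η := hr (by
        rw [Real.dist_eq, sub_zero]
        exact (hs.trans_lt ht).trans_le (min_le_left _ _))
      have h6 : dil s (φ j) - φ j = (dil s (φ l) - φ l) + (dil s (φ j - φ l) + -(φ j - φ l)) := by
        rw [dil_sub]; abel
      have h7 := gradNorm_add_le (dil s (φ l) - φ l) (dil s (φ j - φ l) + -(φ j - φ l))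
      have h8 := gradNorm_add_le (dil s (φ j - φ l)) (-(φ j - φ l))
      have h9 := gradNorm_dil_le (hs.trans ht1) (φ j - φ l)
      rw [gradNorm_neg] at h8
      rw [← h6] at h7
      linarith
    have h5 : Tendsto (fun j => gradNorm (φ j - φ l)) atTop
        (𝓝 (∑ i, ‖toLTwo (pd i (φ l)) - gradC i a‖)) := by
      have := tendsto_finsetSum Finset.univ fun i _ => ((hpd i).sub_const (toLTwo (pd i (φ l)))).norm
      simp only [norm_sub_rev (toLTwo (pd _ (φ l)))]
      simpa only [gradNorm, map_sub] using this
    have h6 := fun j => abs_virial_test_le hY (φ j) ht0'.le ht1 (h4 j)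
    have h7 := (h5.const_mul (K + 1)).const_add η
    have h8 := le_of_tendsto_of_tendsto'
      ((hsq.const_mul (1 - Real.exp ((n - 2) * t))).sub (((Complex.continuous_re.tendsto _).comp
        (hrad.inner tendsto_const_nhds)).const_mul (2 * t))).abs
      ((((h7.mul hgn).const_mul |1 - Real.exp ((n - 2) * t)|).add
        ((hgn.const_mul (2 * K)).mul hdist)).add (h7.const_mul (2 * t * ‖Y‖))) h6
    refine h8.trans ?_
    have h10 : η + (K + 1) * ∑ i, ‖toLTwo (pd i (φ l)) - gradC i a‖ ≤ 3 * η := by linarith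
    calc _ = (|1 - Real.exp ((n - 2) * t)| * g + 2 * t * ‖Y‖)
          * (η + (K + 1) * ∑ i, ‖toLTwo (pd i (φ l)) - gradC i a‖) := by ring
      _ ≤ _ := by gcongr
  -- The derivative of `1 - e^{(n-2)t}` at `0` produces the coefficient `-(n-2)`; halving it gives
  -- `1 - n/2`.
  have hder : Tendsto (fun t : ℝ => t⁻¹ * (1 - Real.exp ((n - 2) * t))) (𝓝[>] 0)
      (𝓝 (-((n : ℝ) - 2))) := by
    have h1 : HasDerivAt (fun t : ℝ => 1 - Real.exp ((n - 2) * t)) (-((n : ℝ) - 2)) 0 := by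
      have h2 : HasDerivAt (fun t : ℝ => ((n : ℝ) - 2) * t) ((n : ℝ) - 2) 0 := by
        simpa using (hasDerivAt_id (0 : ℝ)).const_mul ((n : ℝ) - 2)
      simpa using h2.exp.const_sub 1
    have h3 := h1.tendsto_slope_zero_right
    simpa using h3
  have key2 : ∀ η : ℝ, 0 < η →
      |-((n : ℝ) - 2) * ∑ i, ‖gradC i a‖ ^ 2 - 2 * (inner ℂ (radC a) Y).re|
        ≤ (|-((n : ℝ) - 2)| * g + 2 * ‖Y‖) * (3 * η) := by
    intro η hη
    refine le_of_tendsto_of_tendsto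
      ((hder.mul_const (∑ i, ‖gradC i a‖ ^ 2)).sub_const (2 * (inner ℂ (radC a) Y).re)).abs
      (((hder.abs.mul_const g).add_const (2 * ‖Y‖)).mul_const (3 * η)) ?_
    filter_upwards [key η hη, self_mem_nhdsWithin] with t ht ht0
    have ht0' : (0 : ℝ) < t := ht0
    have h1 := mul_le_mul_of_nonneg_left ht (inv_pos.mpr ht0').le
    rw [← abs_of_pos (inv_pos.mpr ht0'), ← abs_mul, abs_of_pos (inv_pos.mpr ht0')] at h1
    rw [abs_mul, abs_of_pos (inv_pos.mpr ht0')]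
    convert h1 using 1
    · congr 1
      field_simp
    · field_simp
  have h0 : |-((n : ℝ) - 2) * ∑ i, ‖gradC i a‖ ^ 2 - 2 * (inner ℂ (radC a) Y).re| ≤ 0 := by
    refine le_of_forall_pos_le_add fun ε hε => ?_
    have hB : 0 < 3 * (|-((n : ℝ) - 2)| * g + 2 * ‖Y‖ + 1) := by positivity
    refine (key2 (ε / (3 * (|-((n : ℝ) - 2)| * g + 2 * ‖Y‖ + 1))) (by positivity)).trans ?_
    rw [zero_add, ← mul_div_assoc, ← mul_div_assoc, div_le_iff₀ hB]
    nlinarith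
  have h1 := abs_nonpos_iff.mp h0
  linarith

/-! ### Radial multipliers, the spherical phase and covariant derivatives -/

namespace PuncturedTest

lemma contDiffAt_ofReal_comp {χ : ℝ → ℝ} {r : ℝ} (hχ : ContDiffAt ℝ ∞ χ r) :
    ContDiffAt ℝ ∞ (fun r => (χ r : ℂ)) r :=
  Complex.ofRealCLM.contDiff.contDiffAt.comp r hχ

/-- The product of a test function with a real radial function. -/
def rmul (χ : ℝ → ℝ) (hχ : ∀ r, 0 < r → ContDiffAt ℝ ∞ χ r) : PuncturedTest n → PuncturedTest n :=
  radialMul (fun r => (χ r : ℂ)) fun r hr => contDiffAt_ofReal_comp (hχ r hr)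

@[simp] lemma rmul_apply (χ : ℝ → ℝ) (hχ : ∀ r, 0 < r → ContDiffAt ℝ ∞ χ r)
    (φ : PuncturedTest n) (x : RSpace n) : rmul χ hχ φ x = (χ ‖x‖ : ℂ) * φ x := rfl

/-- The product of a test function with a component of the radial unit vector field. -/
def xhatMul (i : Fin n) : PuncturedTest n → PuncturedTest n :=
  smoothMul (fun x => (xhat i x : ℂ)) fun x hx => by
    have h1 : ContDiffAt ℝ ∞ (fun x : RSpace n => x i) x :=
      (EuclideanSpace.proj i : RSpace n →L[ℝ] ℝ).contDiff.contDiffAt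
    exact Complex.ofRealCLM.contDiff.contDiffAt.comp x
      (h1.div (contDiffAt_norm ℝ hx) (norm_ne_zero_iff.mpr hx))

@[simp] lemma xhatMul_apply (i : Fin n) (φ : PuncturedTest n) (x : RSpace n) :
    xhatMul i φ x = (xhat i x : ℂ) * φ x := rfl

lemma toLTwo_xhatMul (i : Fin n) (φ : PuncturedTest n) :
    toLTwo (xhatMul i φ) = mulLp (xhat i) (memLp_xhat i) (toLTwo φ) := by
  refine Lp.ext ?_
  filter_upwards [(xhatMul i φ).toLTwo_ae, mulLp_ae (memLp_xhat i) (toLTwo φ), φ.toLTwo_ae]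
    with x h1 h2 h3
  rw [h1, h2, h3, xhatMul_apply]

lemma toLTwo_rmul {χ : ℝ → ℝ} (hχ : ∀ r, 0 < r → ContDiffAt ℝ ∞ χ r)
    (hb : MemLp (fun x : RSpace n => χ ‖x‖) ∞ volume) (φ : PuncturedTest n) :
    toLTwo (rmul χ hχ φ) = mulLp (fun x => χ ‖x‖) hb (toLTwo φ) := by
  refine Lp.ext ?_
  filter_upwards [(rmul χ hχ φ).toLTwo_ae, mulLp_ae hb (toLTwo φ), φ.toLTwo_ae] with x h1 h2 h3
  rw [h1, h2, h3, rmul_apply]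

lemma pd_rmul {χ χ' : ℝ → ℝ} (hχ : ∀ r, 0 < r → ContDiffAt ℝ ∞ χ r)
    (hχ' : ∀ r, 0 < r → ContDiffAt ℝ ∞ χ' r)
    (hd : ∀ r, 0 < r → HasDerivAt χ (χ' r) r) (φ : PuncturedTest n) (i : Fin n) :
    pd i (rmul χ hχ φ) = rmul χ hχ (pd i φ) + rmul χ' hχ' (xhatMul i φ) := by
  ext x
  have h := partialDeriv_radialMul (fun r hr => contDiffAt_ofReal_comp (hχ r hr))
    (fun r hr => (hd r hr).ofReal_comp) φ i x
  refine h.trans ?_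
  change _ = (χ ‖x‖ : ℂ) * partialDeriv i φ x + (χ' ‖x‖ : ℂ) * ((xhat i x : ℂ) * φ x)
  rw [xhat]
  ring

/-- The spherical phase `e^{-ikr}`. -/
def phase (k r : ℝ) : ℂ := Complex.exp (((-(k * r) : ℝ) : ℂ) * Complex.I)

lemma norm_phase (k r : ℝ) : ‖phase k r‖ = 1 := Complex.norm_exp_ofReal_mul_I _

lemma hasDerivAt_phase (k r : ℝ) : HasDerivAt (phase k) (-(Complex.I * k) * phase k r) r := by
  have h1 : HasDerivAt (fun r : ℝ => -(k * r)) (-k) r := by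
    simpa [neg_mul] using (hasDerivAt_id r).const_mul (-k)
  have h2 := (h1.ofReal_comp.mul_const Complex.I).cexp
  refine h2.congr_deriv ?_
  rw [phase]
  push_cast
  ring

lemma contDiff_phase (k : ℝ) : ContDiff ℝ ∞ (phase k) := by
  unfold phase
  have h1 : ContDiff ℝ ∞ fun r : ℝ => -(k * r) := by fun_prop
  exact ((Complex.ofRealCLM.contDiff.comp h1).mul contDiff_const).cexp

/-- The product of a test function with `σ(r) e^{-ikr}`. -/
def phaseMul (k : ℝ) (σ : ℝ → ℝ) (hσ : ∀ r, 0 < r → ContDiffAt ℝ ∞ σ r) :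
    PuncturedTest n → PuncturedTest n :=
  radialMul (fun r => (σ r : ℂ) * phase k r) fun r hr =>
    (contDiffAt_ofReal_comp (hσ r hr)).mul (contDiff_phase k).contDiffAt

lemma norm_phaseMul_apply (k : ℝ) {σ : ℝ → ℝ} (hσ : ∀ r, 0 < r → ContDiffAt ℝ ∞ σ r)
    (φ : PuncturedTest n) (x : RSpace n) : ‖phaseMul k σ hσ φ x‖ = |σ ‖x‖| * ‖φ x‖ := by
  rw [phaseMul, radialMul_apply, norm_mul, norm_mul, norm_phase, mul_one, Complex.norm_real,
    Real.norm_eq_abs]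

/-- The covariant derivative `∂ᵢ - i k x̂ᵢ`. -/
def covT (k : ℝ) (i : Fin n) (φ : PuncturedTest n) : PuncturedTest n :=
  pd i φ - (Complex.I * k) • xhatMul i φ

/-- Differentiating `σ e^{-ikr} φ` gives the unimodular factor `e^{-ikr}` times `σ (∂ᵢ - i k x̂ᵢ)φ +
σ' x̂ᵢ φ`, and that factor is invisible to the norm. -/
lemma norm_pd_phaseMul (k : ℝ) {σ σ' : ℝ → ℝ} (hσ : ∀ r, 0 < r → ContDiffAt ℝ ∞ σ r)
    (hσ' : ∀ r, 0 < r → ContDiffAt ℝ ∞ σ' r) (hd : ∀ r, 0 < r → HasDerivAt σ (σ' r) r)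
    (φ : PuncturedTest n) (i : Fin n) :
    ‖toLTwo (pd i (phaseMul k σ hσ φ))‖
      = ‖toLTwo (rmul σ hσ (covT k i φ)) + toLTwo (rmul σ' hσ' (xhatMul i φ))‖ := by
  rw [← map_add, ← sq_eq_sq₀ (norm_nonneg _) (norm_nonneg _), norm_toLTwo_sq, norm_toLTwo_sq]
  refine integral_congr_ae (ae_of_all _ fun x => ?_)
  have h : pd i (phaseMul k σ hσ φ) x = phase k ‖x‖ *
      (rmul σ hσ (covT k i φ) + rmul σ' hσ' (xhatMul i φ)) x := by
    have h1 := partialDeriv_radialMul (n := n) (χ := fun r => (σ r : ℂ) * phase k r)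
      (fun r hr => (contDiffAt_ofReal_comp (hσ r hr)).mul (contDiff_phase k).contDiffAt)
      (fun r hr => (hd r hr).ofReal_comp.mul (hasDerivAt_phase k r)) φ i x
    refine h1.trans ?_
    change _ = phase k ‖x‖ * ((σ ‖x‖ : ℂ) * (partialDeriv i φ x
      - (Complex.I * k) * ((xhat i x : ℂ) * φ x)) + (σ' ‖x‖ : ℂ) * ((xhat i x : ℂ) * φ x))
    rw [xhat]
    ring
  change ‖pd i (phaseMul k σ hσ φ) x‖ ^ 2 = _
  rw [h, norm_mul, norm_phase, one_mul]

lemma inner_toLTwo_congr {f g f' g' : PuncturedTest n}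
    (h : ∀ x, x ≠ 0 → g x * starRingEnd ℂ (f x) = g' x * starRingEnd ℂ (f' x)) :
    inner ℂ (toLTwo f) (toLTwo g) = inner ℂ (toLTwo f') (toLTwo g') := by
  rw [inner_toLTwo, inner_toLTwo]
  refine integral_congr_ae (ae_of_all _ fun x => ?_)
  by_cases hx : x = 0
  · simp [hx, apply_zero]
  · exact h x hx

lemma toLTwo_congr {f g : PuncturedTest n} (h : ∀ x, x ≠ 0 → f x = g x) : toLTwo f = toLTwo g := by
  congr 1
  ext x
  by_cases hx : x = 0
  · simp [hx, apply_zero]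
  · exact h x hx

/-- Integration by parts for radial vector fields. -/
lemma integral_radial_mul_normSq {χ χ' : ℝ → ℝ} (hχ : ∀ r, 0 < r → ContDiffAt ℝ ∞ χ r)
    (hχ' : ∀ r, 0 < r → ContDiffAt ℝ ∞ χ' r) (hd : ∀ r, 0 < r → HasDerivAt χ (χ' r) r)
    (φ : PuncturedTest n) :
    ∫ x, (n * χ ‖x‖ + ‖x‖ * χ' ‖x‖) * ‖φ x‖ ^ 2
      = - (2 * (inner ℂ (toLTwo (rmul (fun r => r * χ r)
          (fun r hr => contDiffAt_id.mul (hχ r hr)) φ)) (rad φ)).re) := by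
  set ψ := rmul χ hχ (normSq φ) with hψ
  -- The vector field is `x χ(|x|)`, of divergence `n χ + r χ'`, and it is paired with the density
  -- `|φ|²`.
  have h0 := integral_euler ψ
  have h1 : ∀ x : RSpace n, (n : ℂ) * ψ x + fderiv ℝ ψ x x
      = (((n * χ ‖x‖ + ‖x‖ * χ' ‖x‖) * ‖φ x‖ ^ 2
        + 2 * (starRingEnd ℂ ((‖x‖ * χ ‖x‖ : ℝ) * φ x)
            * (((‖x‖⁻¹ : ℝ) : ℂ) * fderiv ℝ φ x x)).re : ℝ) : ℂ) := by
    intro x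
    have e1 : fderiv ℝ ψ x x = (χ ‖x‖ : ℂ) * fderiv ℝ (normSq φ) x x
        + ((‖x‖ * χ' ‖x‖ : ℝ) : ℂ) * normSq φ x := by
      rw [fderiv_apply_eq_sum, fderiv_apply_eq_sum, Finset.mul_sum]
      have e2 : ∀ i, (x i : ℂ) * partialDeriv i ψ x = (χ ‖x‖ : ℂ) * ((x i : ℂ)
          * partialDeriv i (normSq φ) x) + (x i : ℂ) * (xhat i x : ℂ) * ((χ' ‖x‖ : ℂ)
            * normSq φ x) := by
        intro i
        have := partialDeriv_radialMul (fun r hr => contDiffAt_ofReal_comp (hχ r hr))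
          (fun r hr => (hd r hr).ofReal_comp) (normSq φ) i x
        rw [hψ, rmul, this, xhat]
        ring
      simp only [e2, Finset.sum_add_distrib, ← Finset.sum_mul]
      congr 1
      have e3 : ∑ i, (x i : ℂ) * (xhat i x : ℂ) = ((‖x‖ : ℝ) : ℂ) := by
        by_cases hx : x = 0
        · simp [hx]
        · have h4 : ‖x‖ ≠ 0 := norm_ne_zero_iff.mpr hx
          have h5 : ∑ i, x i * xhat i x = ‖x‖ := by
            simp only [xhat, mul_div_assoc', ← Finset.sum_div, ← sq]
            rw [← EuclideanSpace.real_norm_sq_eq]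
            field_simp
          rw [← h5]
          push_cast
          rfl
      rw [e3]
      push_cast
      ring
    by_cases hx : x = 0
    · simp [hx, apply_zero, hψ]
    have h4 : (‖x‖ : ℂ) ≠ 0 := by exact_mod_cast norm_ne_zero_iff.mpr hx
    rw [e1, fderiv_normSq, hψ, rmul_apply, normSq_apply, Complex.mul_conj,
      Complex.normSq_eq_norm_sq]
    have e5 : starRingEnd ℂ ((‖x‖ * χ ‖x‖ : ℝ) * φ x) * (((‖x‖⁻¹ : ℝ) : ℂ) * fderiv ℝ φ x x)
        = (χ ‖x‖ : ℂ) * (starRingEnd ℂ (φ x) * fderiv ℝ φ x x) := by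
      rw [map_mul, Complex.conj_ofReal]
      push_cast
      field_simp
    rw [e5, Complex.re_ofReal_mul]
    push_cast
    ring
  simp only [h1] at h0
  rw [integral_complex_ofReal, Complex.ofReal_eq_zero] at h0
  set f := rmul (fun r => r * χ r) (fun r hr => contDiffAt_id.mul (hχ r hr)) φ with hf
  have hae : (fun x => rad φ x * starRingEnd ℂ (toLTwo f x)) =ᵐ[volume]
      fun x => starRingEnd ℂ ((‖x‖ * χ ‖x‖ : ℝ) * φ x) * (((‖x‖⁻¹ : ℝ) : ℂ) * fderiv ℝ φ x x) := by
    filter_upwards [rad_ae φ, f.toLTwo_ae] with x h2 h3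
    rw [h2, h3, hf, rmul_apply, mul_comm]
  have hint := (integrable_mul_conj (toLTwo f) (rad φ)).congr hae
  have h2 : (inner ℂ (toLTwo f) (rad φ)).re = ∫ x, (starRingEnd ℂ ((‖x‖ * χ ‖x‖ : ℝ) * φ x)
      * (((‖x‖⁻¹ : ℝ) : ℂ) * fderiv ℝ φ x x)).re := by
    rw [inner_eq_integral, integral_congr_ae hae]
    exact (integral_re hint).symm
  have h3 : Integrable fun x : RSpace n => (n * χ ‖x‖ + ‖x‖ * χ' ‖x‖) * ‖φ x‖ ^ 2 := by
    set g := rmul (fun r => n * χ r + r * χ' r)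
      (fun r hr => (contDiffAt_const.mul (hχ r hr)).add (contDiffAt_id.mul (hχ' r hr)))
      (normSq φ) with hg
    have h4 : Integrable g := g.continuous.integrable_of_hasCompactSupport g.hasCompactSupport
    refine h4.re.congr (ae_of_all _ fun x => ?_)
    change ((((n * χ ‖x‖ + ‖x‖ * χ' ‖x‖ : ℝ) : ℂ)) * (φ x * starRingEnd ℂ (φ x))).re = _
    rw [Complex.mul_conj, Complex.normSq_eq_norm_sq, ← Complex.ofReal_mul, Complex.ofReal_re]
  have h6 : Integrable fun x => (starRingEnd ℂ ((‖x‖ * χ ‖x‖ : ℝ) * φ x)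
      * (((‖x‖⁻¹ : ℝ) : ℂ) * fderiv ℝ φ x x)).re := hint.re
  rw [integral_add h3 (h6.const_mul 2), integral_const_mul, ← h2] at h0
  linarith

end PuncturedTest

lemma memLp_radial {χ : ℝ → ℝ} (hm : Measurable χ) {C : ℝ} (h : ∀ r, 0 ≤ r → |χ r| ≤ C) :
    MemLp (fun x : RSpace n => χ ‖x‖) ∞ volume :=
  memLp_top_of_bound (hm.comp measurable_norm).aestronglyMeasurable C
    (ae_of_all _ fun x => h _ (norm_nonneg x))

lemma mulLp_one (f : LTwo n) (h : MemLp (fun _ : RSpace n => (1 : ℝ)) ∞ volume) :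
    mulLp (fun _ => 1) h f = f := by
  refine Lp.ext ?_
  filter_upwards [mulLp_ae h f] with x hx
  rw [hx]; simp

lemma inner_mulLp_self_im {b : RSpace n → ℝ} (hb : MemLp b ∞ volume) (f : LTwo n) :
    (inner ℂ (mulLp b hb f) f).im = 0 := by
  rw [← Complex.conj_eq_iff_im, inner_conj_symm, inner_mulLp]

lemma mulLp_comm {b c : RSpace n → ℝ} (hb : MemLp b ∞ volume) (hc : MemLp c ∞ volume)
    (f : LTwo n) : mulLp b hb (mulLp c hc f) = mulLp c hc (mulLp b hb f) := by
  refine Lp.ext ?_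
  filter_upwards [mulLp_ae hb (mulLp c hc f), mulLp_ae hc f, mulLp_ae hc (mulLp b hb f),
    mulLp_ae hb f] with x h1 h2 h3 h4
  rw [h1, h2, h3, h4]
  ring

lemma ae_ne_zero (hn : 2 ≤ n) : ∀ᵐ x : RSpace n, x ≠ 0 := by
  have : Nontrivial (RSpace n) := by
    have : Nonempty (Fin n) := ⟨⟨0, by omega⟩⟩
    infer_instance
  exact Measure.ae_ne volume 0

lemma sum_mulLp_xhat_sq (hn : 2 ≤ n) (f : LTwo n) :
    ∑ i, mulLp (xhat i) (memLp_xhat i) (mulLp (xhat i) (memLp_xhat i) f) = f := by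
  refine Lp.ext ?_
  have h1 := Lp.coeFn_finsetSum Finset.univ
    fun i : Fin n => mulLp (xhat i) (memLp_xhat i) (mulLp (xhat i) (memLp_xhat i) f)
  have h2 : ∀ᵐ x, ∀ i : Fin n, mulLp (xhat i) (memLp_xhat i) (mulLp (xhat i) (memLp_xhat i) f) x
      = (xhat i x : ℂ) * mulLp (xhat i) (memLp_xhat i) f x := ae_all_iff.mpr fun i => mulLp_ae _ _
  have h3 : ∀ᵐ x, ∀ i : Fin n, mulLp (xhat i) (memLp_xhat i) f x = (xhat i x : ℂ) * f x :=
    ae_all_iff.mpr fun i => mulLp_ae _ _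
  filter_upwards [h1, h2, h3, ae_ne_zero hn] with x hx1 hx2 hx3 hx4
  rw [hx1, Finset.sum_apply]
  simp only [hx2, hx3, ← mul_assoc, ← sq, ← Finset.sum_mul]
  have := sum_xhat_sq hx4
  rw [show ∑ i, (xhat i x : ℂ) ^ 2 = ((∑ i, xhat i x ^ 2 : ℝ) : ℂ) by push_cast; rfl, this]
  simp

/-- The covariant gradient components `∂ᵢ - i k x̂ᵢ`. -/
def covC (k : ℝ) (i : Fin n) : FormSpace n →L[ℂ] LTwo n :=
  gradC i - (Complex.I * k) • (mulLp (xhat i) (memLp_xhat i)).comp (obsC 0)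

lemma covC_apply (k : ℝ) (i : Fin n) (a : FormSpace n) :
    covC k i a = gradC i a - (Complex.I * k) • mulLp (xhat i) (memLp_xhat i) (obsC 0 a) := rfl

lemma sum_mulLp_covC (hn : 2 ≤ n) (k : ℝ) (a : FormSpace n) :
    ∑ i, mulLp (xhat i) (memLp_xhat i) (covC k i a) = radC a - (Complex.I * k) • obsC 0 a := by
  simp only [covC_apply, map_sub, map_smul, Finset.sum_sub_distrib, ← Finset.smul_sum,
    sum_mulLp_xhat_sq hn, radC_apply]

/-- Expansion of the square, with `Σ x̂ᵢ² = 1` and `Σ x̂ᵢ ∂ᵢ = ∂ᵣ`. The cross term is the weighted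
radial flux, the only term depending on the sign of `k`. -/
lemma sum_inner_covC (hn : 2 ≤ n) {b : RSpace n → ℝ} (hb : MemLp b ∞ volume) (k : ℝ)
    (a : FormSpace n) :
    ∑ i, (inner ℂ (mulLp b hb (covC k i a)) (covC k i a)).re
      = ∑ i, (inner ℂ (mulLp b hb (gradC i a)) (gradC i a)).re
        + k ^ 2 * (inner ℂ (mulLp b hb (obsC 0 a)) (obsC 0 a)).re
        - 2 * k * (inner ℂ (mulLp b hb (obsC 0 a)) (radC a)).im := by
  set u := obsC 0 a
  set X : Fin n → LTwo n →L[ℂ] LTwo n := fun i => mulLp (xhat i) (memLp_xhat i) with hX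
  have h1 : ∀ i, (inner ℂ (mulLp b hb (covC k i a)) (covC k i a)).re
      = (inner ℂ (mulLp b hb (gradC i a)) (gradC i a)).re
        + k ^ 2 * (inner ℂ (mulLp b hb u) (X i (X i u))).re
        - 2 * k * (inner ℂ (mulLp b hb u) (X i (gradC i a))).im := by
    intro i
    have e1 : inner ℂ (mulLp b hb (X i u)) (gradC i a) = inner ℂ (mulLp b hb u) (X i (gradC i a)) := by
      rw [hX, mulLp_comm, inner_mulLp]
    have e2 : inner ℂ (mulLp b hb (X i u)) (X i u) = inner ℂ (mulLp b hb u) (X i (X i u)) := by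
      rw [hX, mulLp_comm, inner_mulLp]
    have e3 : inner ℂ (mulLp b hb (gradC i a)) (X i u)
        = starRingEnd ℂ (inner ℂ (mulLp b hb u) (X i (gradC i a))) := by
      rw [← e1, inner_conj_symm, inner_mulLp]
    rw [covC_apply]
    change (inner ℂ (mulLp b hb (gradC i a - (Complex.I * k) • X i u))
      (gradC i a - (Complex.I * k) • X i u)).re = _
    rw [map_sub, map_smul, inner_sub_left, inner_sub_right, inner_sub_right, inner_smul_left,
      inner_smul_left, inner_smul_right, inner_smul_right, e1, e2, e3]
    simp only [map_mul, Complex.conj_I, Complex.conj_ofReal, Complex.sub_re, Complex.mul_re,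
      Complex.mul_im, Complex.I_re, Complex.I_im, Complex.neg_re, Complex.neg_im,
      Complex.ofReal_re, Complex.ofReal_im, Complex.conj_re, Complex.conj_im]
    ring
  have h2 : ∑ i, (inner ℂ (mulLp b hb u) (X i (X i u))).re = (inner ℂ (mulLp b hb u) u).re := by
    rw [← Complex.re_sum, ← inner_sum, sum_mulLp_xhat_sq hn]
  have h3 : ∑ i, (inner ℂ (mulLp b hb u) (X i (gradC i a))).im
      = (inner ℂ (mulLp b hb u) (radC a)).im := by
    rw [← Complex.im_sum, ← inner_sum, radC_apply]
  simp only [h1, Finset.sum_sub_distrib, Finset.sum_add_distrib, ← Finset.mul_sum, h2, h3]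

/-! ### Truncations of the weight `|x|` -/

/-- The weight `(1 + κ r)⁻¹`. -/
def theta (κ r : ℝ) : ℝ := (1 + κ * r)⁻¹

/-- The truncated radial weight `r (1 + κ r)⁻¹`. -/
def rho (κ r : ℝ) : ℝ := r * theta κ r

lemma theta_pos {κ r : ℝ} (hκ : 0 < κ) (hr : 0 ≤ r) : 0 < theta κ r := by
  unfold theta; positivity

lemma theta_le_one {κ r : ℝ} (hκ : 0 < κ) (hr : 0 ≤ r) : theta κ r ≤ 1 := by
  unfold theta
  exact inv_le_one_of_one_le₀ (by nlinarith)

lemma abs_theta_le {κ : ℝ} (hκ : 0 < κ) (r : ℝ) (hr : 0 ≤ r) : |theta κ r| ≤ 1 := by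
  rw [abs_of_pos (theta_pos hκ hr)]; exact theta_le_one hκ hr

lemma abs_theta_sq_le {κ : ℝ} (hκ : 0 < κ) (r : ℝ) (hr : 0 ≤ r) : |theta κ r ^ 2| ≤ 1 := by
  rw [abs_pow]; exact pow_le_one₀ (abs_nonneg _) (abs_theta_le hκ r hr)

lemma rho_nonneg {κ r : ℝ} (hκ : 0 < κ) (hr : 0 ≤ r) : 0 ≤ rho κ r :=
  mul_nonneg hr (theta_pos hκ hr).le

lemma abs_rho_le {κ : ℝ} (hκ : 0 < κ) (r : ℝ) (hr : 0 ≤ r) : |rho κ r| ≤ κ⁻¹ := by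
  rw [abs_of_nonneg (rho_nonneg hκ hr), rho, theta, ← div_eq_mul_inv, div_le_iff₀ (by positivity)]
  field_simp
  linarith

lemma measurable_theta (κ : ℝ) : Measurable (theta κ) := by unfold theta; fun_prop

lemma measurable_rho (κ : ℝ) : Measurable (rho κ) := measurable_id.mul (measurable_theta κ)

lemma contDiffAt_theta {κ r : ℝ} (hκ : 0 < κ) (hr : 0 < r) : ContDiffAt ℝ ∞ (theta κ) r := by
  unfold theta
  have h1 : ContDiffAt ℝ ∞ (fun r => 1 + κ * r) r := by fun_prop
  exact h1.inv (by positivity)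

lemma contDiffAt_rho {κ r : ℝ} (hκ : 0 < κ) (hr : 0 < r) : ContDiffAt ℝ ∞ (rho κ) r :=
  contDiffAt_id.mul (contDiffAt_theta hκ hr)

lemma hasDerivAt_theta {κ r : ℝ} (hκ : 0 < κ) (hr : 0 < r) :
    HasDerivAt (theta κ) (-κ * theta κ r ^ 2) r := by
  have h1 : HasDerivAt (fun r => 1 + κ * r) κ r := by
    simpa using ((hasDerivAt_id r).const_mul κ).const_add 1
  have h2 : HasDerivAt (theta κ) _ r := h1.fun_inv (by positivity)
  refine h2.congr_deriv ?_
  rw [theta]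
  field_simp

/-- Because the derivative is `θ²`, it stays between `0` and `1` uniformly in `κ` and tends to `1`
as `κ → 0`, while `ρ` itself is bounded for each `κ`. -/
lemma hasDerivAt_rho {κ r : ℝ} (hκ : 0 < κ) (hr : 0 < r) :
    HasDerivAt (rho κ) (theta κ r ^ 2) r := by
  have h : HasDerivAt (rho κ) _ r := (hasDerivAt_id r).mul (hasDerivAt_theta hκ hr)
  refine h.congr_deriv ?_
  have : 0 < 1 + κ * r := by positivity
  simp only [id, theta]
  field_simp
  ring

lemma memLp_theta {κ : ℝ} (hκ : 0 < κ) : MemLp (fun x : RSpace n => theta κ ‖x‖) ∞ volume :=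
  memLp_radial (measurable_theta κ) (abs_theta_le hκ)

lemma memLp_theta_sq {κ : ℝ} (hκ : 0 < κ) :
    MemLp (fun x : RSpace n => theta κ ‖x‖ ^ 2) ∞ volume :=
  memLp_radial (χ := fun r => theta κ r ^ 2) ((measurable_theta κ).pow_const 2) (abs_theta_sq_le hκ)

lemma memLp_rho {κ : ℝ} (hκ : 0 < κ) : MemLp (fun x : RSpace n => rho κ ‖x‖) ∞ volume :=
  memLp_radial (measurable_rho κ) (abs_rho_le hκ)

/-! ### The equation with radial weights and positivity of the form -/

namespace FormSetup

variable {V W w : RSpace n → ℝ} (S : FormSetup V W w)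

lemma covC_embed (k : ℝ) (i : Fin n) (φ : PuncturedTest n) :
    covC k i (S.embed φ) = toLTwo (covT k i φ) := by
  rw [covC_apply, gradC_embed, obsC_zero_embed, covT, map_sub, map_smul, toLTwo_xhatMul]

lemma radC_embed (φ : PuncturedTest n) : radC (S.embed φ) = rad φ := radC_apply _

lemma obsC_embed_rmul {χ : ℝ → ℝ} (hχ : ∀ r, 0 < r → ContDiffAt ℝ ∞ χ r)
    (hb : MemLp (fun x : RSpace n => χ ‖x‖) ∞ volume) (k : Fin 7) (φ : PuncturedTest n) :
    obsC k (S.embed (rmul χ hχ φ)) = mulLp (fun x => χ ‖x‖) hb (obsC k (S.embed φ)) := by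
  refine Lp.ext ?_
  filter_upwards [S.obsC_embed_ae k (rmul χ hχ φ), mulLp_ae hb (obsC k (S.embed φ)),
    S.obsC_embed_ae k φ] with x h1 h2 h3
  rw [h1, h2, h3, rmul_apply]
  ring

/-- The equation tested with `χ u`. It is tested with `χ φ` for test functions `φ`, and `φ` is then
replaced by `u` by closure; boundedness of `χ` and `χ'` makes each term continuous in the form norm
of `φ`. -/
lemma weighted_equation {a : FormSpace n} (ha : a ∈ S.dom) {z : ℂ} {F : LTwo n}
    (hEq : ∀ φ, qform a (S.embed φ) - z * inner ℂ (toLTwo φ) (obsC 0 a) = inner ℂ (toLTwo φ) F)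
    {χ χ' : ℝ → ℝ} (hχ : ∀ r, 0 < r → ContDiffAt ℝ ∞ χ r)
    (hχ' : ∀ r, 0 < r → ContDiffAt ℝ ∞ χ' r) (hd : ∀ r, 0 < r → HasDerivAt χ (χ' r) r)
    (hb : MemLp (fun x : RSpace n => χ ‖x‖) ∞ volume)
    (hb' : MemLp (fun x : RSpace n => χ' ‖x‖) ∞ volume) :
    ∑ i, inner ℂ (mulLp _ hb (gradC i a)) (gradC i a)
      + inner ℂ (mulLp _ hb' (obsC 0 a)) (radC a)
      + inner ℂ (mulLp _ hb (obsC 1 a)) (obsC 2 a)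
      - z * inner ℂ (mulLp _ hb (obsC 0 a)) (obsC 0 a)
      = inner ℂ (mulLp _ hb (obsC 0 a)) F := by
  refine S.dom_induction (P := fun c => ∑ i, inner ℂ (mulLp _ hb (gradC i c)) (gradC i a)
      + inner ℂ (mulLp _ hb' (obsC 0 c)) (radC a)
      + inner ℂ (mulLp _ hb (obsC 1 c)) (obsC 2 a)
      - z * inner ℂ (mulLp _ hb (obsC 0 c)) (obsC 0 a)
      = inner ℂ (mulLp _ hb (obsC 0 c)) F) (isClosed_eq (by fun_prop) (by fun_prop)) ?_ ha
  intro φ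
  have h := hEq (rmul χ hχ φ)
  rw [qform, S.obsC_embed_rmul hχ hb, toLTwo_rmul hχ hb] at h
  rw [obsC_zero_embed, ← h]
  congr 2
  simp only [gradC_embed, pd_rmul hχ hχ' hd, map_add, inner_add_left, Finset.sum_add_distrib]
  congr 1
  · exact Finset.sum_congr rfl fun i _ => by rw [toLTwo_rmul hχ hb]
  · rw [radC_apply, inner_sum]
    refine Finset.sum_congr rfl fun i _ => ?_
    rw [toLTwo_rmul hχ' hb', toLTwo_xhatMul, mulLp_comm hb', inner_mulLp (memLp_xhat i)]

lemma inner_obsC_im {a : FormSpace n} (ha : a ∈ S.dom) {b : RSpace n → ℝ} (hb : MemLp b ∞ volume) :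
    (inner ℂ (mulLp b hb (obsC 1 a)) (obsC 2 a)).im = 0 := by
  rw [← Complex.conj_eq_iff_im, inner_conj_symm, ← inner_mulLp, inner_eq_integral,
    inner_eq_integral]
  refine integral_congr_ae ?_
  filter_upwards [mulLp_ae hb (obsC 1 a), mulLp_ae hb (obsC 2 a), S.obsC_ae ha 1, S.obsC_ae ha 2]
    with x h1 h2 h3 h4
  rw [h1, h2, h3, h4]
  simp only [map_mul, Complex.conj_ofReal]
  ring

end FormSetup

namespace FormSetup

variable {V W w : RSpace n → ℝ} (S : FormSetup V W w)

lemma inner_obsC_phaseMul (k : ℝ) {σ ρ : ℝ → ℝ} (hσ : ∀ r, 0 < r → ContDiffAt ℝ ∞ σ r)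
    (hb : MemLp (fun x : RSpace n => ρ ‖x‖) ∞ volume) (h : ∀ r, 0 < r → σ r ^ 2 = ρ r)
    (k₁ k₂ : Fin 7) (φ : PuncturedTest n) :
    inner ℂ (obsC k₁ (S.embed (phaseMul k σ hσ φ))) (obsC k₂ (S.embed (phaseMul k σ hσ φ)))
      = inner ℂ (mulLp _ hb (obsC k₁ (S.embed φ))) (obsC k₂ (S.embed φ)) := by
  rw [inner_eq_integral, inner_eq_integral]
  refine integral_congr_ae ?_
  filter_upwards [S.obsC_embed_ae k₁ (phaseMul k σ hσ φ), S.obsC_embed_ae k₂ (phaseMul k σ hσ φ),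
    mulLp_ae hb (obsC k₁ (S.embed φ)), S.obsC_embed_ae k₁ φ, S.obsC_embed_ae k₂ φ,
    ae_ne_zero S.two_le] with x h1 h2 h3 h4 h5 hx
  rw [h1, h2, h3, h4, h5, phaseMul, radialMul_apply, ← h _ (norm_pos_iff.mpr hx)]
  have hp : phase k ‖x‖ * starRingEnd ℂ (phase k ‖x‖) = 1 := by
    rw [Complex.mul_conj, Complex.normSq_eq_norm_sq, norm_phase]; simp
  simp only [map_mul, Complex.conj_ofReal]
  push_cast
  linear_combination ((obs V W w k₂ x : ℂ) * (obs V W w k₁ x : ℂ) * (σ ‖x‖ : ℂ) ^ 2 * φ x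
    * starRingEnd ℂ (φ x)) * hp

include S in
-- The field `x/|x|` has divergence `(n-1)/|x|`, and `n - 1 ≥ 1`. Replacing `∂ᵣ` by `∂ᵣ - i k` is
-- free because `⟨φ, i k φ⟩` is purely imaginary. Unlike Hardy's inequality, this half-order version
-- holds in dimension two.
lemma integral_inv_norm_mul_le (k : ℝ) (φ : PuncturedTest n) :
    ∫ x, ‖x‖⁻¹ * ‖φ x‖ ^ 2 ≤ 2 * (‖toLTwo φ‖ * ∑ i, ‖toLTwo (covT k i φ)‖) := by
  have h1 := integral_radial_mul_normSq (χ := fun r => r⁻¹) (χ' := fun r => -(r ^ 2)⁻¹)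
    (fun r hr => contDiffAt_inv ℝ hr.ne') (fun r hr => by
      have : ContDiffAt ℝ ∞ (fun r : ℝ => r ^ 2) r := by fun_prop
      exact (this.inv (by positivity)).neg) (fun r hr => hasDerivAt_inv hr.ne') φ
  have h2 : toLTwo (rmul (fun r => r * r⁻¹)
      (fun r hr => contDiffAt_id.mul (contDiffAt_inv ℝ hr.ne')) φ) = toLTwo φ :=
    toLTwo_congr fun x hx => by
      rw [rmul_apply, mul_inv_cancel₀ (norm_ne_zero_iff.mpr hx)]; simp
  have h3 : ∫ x : RSpace n, (n * ‖x‖⁻¹ + ‖x‖ * -(‖x‖ ^ 2)⁻¹) * ‖φ x‖ ^ 2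
      = (n - 1) * ∫ x, ‖x‖⁻¹ * ‖φ x‖ ^ 2 := by
    rw [← integral_const_mul]
    refine integral_congr_ae ?_
    filter_upwards [ae_ne_zero S.two_le] with x hx
    have := norm_ne_zero_iff.mpr hx
    field_simp
    ring
  have h4 : rad φ = ∑ i, mulLp (xhat i) (memLp_xhat i) (covC k i (S.embed φ))
      + (Complex.I * k) • toLTwo φ := by
    rw [sum_mulLp_covC S.two_le, radC_embed, obsC_zero_embed, sub_add_cancel]
  have h5 : (inner ℂ (toLTwo φ) (rad φ)).re
      = (inner ℂ (toLTwo φ) (∑ i, mulLp (xhat i) (memLp_xhat i) (covC k i (S.embed φ)))).re := by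
    rw [h4, inner_add_right, inner_smul_right, Complex.add_re, inner_self_eq_norm_sq_to_K]
    have : ((Complex.I * k) * ((‖toLTwo φ‖ : ℝ) : ℂ) ^ 2).re = 0 := by
      rw [show (Complex.I * k) * ((‖toLTwo φ‖ : ℝ) : ℂ) ^ 2
        = ((k * ‖toLTwo φ‖ ^ 2 : ℝ) : ℂ) * Complex.I by push_cast; ring, Complex.re_ofReal_mul]
      simp
    exact (congrArg _ this).trans (add_zero _)
  have h6 : ‖∑ i, mulLp (xhat i) (memLp_xhat i) (covC k i (S.embed φ))‖
      ≤ ∑ i, ‖toLTwo (covT k i φ)‖ := by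
    refine (norm_sum_le _ _).trans (Finset.sum_le_sum fun i _ => ?_)
    rw [covC_embed]
    simpa using norm_mulLp_le (memLp_xhat i) (ae_of_all _ (abs_xhat_le i)) (toLTwo (covT k i φ))
  have h7 : -(inner ℂ (toLTwo φ) (rad φ)).re ≤ ‖toLTwo φ‖ * ∑ i, ‖toLTwo (covT k i φ)‖ := by
    rw [h5]
    refine (neg_le_abs _).trans ((Complex.abs_re_le_norm _).trans
      ((norm_inner_le_norm _ _).trans ?_))
    gcongr
  have h8 : (0 : ℝ) ≤ ∫ x, ‖x‖⁻¹ * ‖φ x‖ ^ 2 := integral_nonneg fun x => by positivity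
  have h9 : (2 : ℝ) ≤ n := by exact_mod_cast S.two_le
  rw [h3, h2] at h1
  nlinarith

/-- With `σ = √ρ`, the square of `σ ∇ₖφ + σ' x̂ φ` is expanded. The cross term is governed by `2σσ'
= ρ' = θ²`, and the last term by `σ'² = θ³/(4r) ≤ 1/(4r)`, so `integral_inv_norm_mul_le` turns the
factor `1/4` into `1/2`. -/
lemma gradNormSq_phaseMul_le {κ : ℝ} (hκ : 0 < κ) (k : ℝ)
    (hσ : ∀ r, 0 < r → ContDiffAt ℝ ∞ (fun r => √(rho κ r)) r) (φ : PuncturedTest n) :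
    gradNormSq (phaseMul k (fun r => √(rho κ r)) hσ φ)
      ≤ ∑ i, (inner ℂ (mulLp _ (memLp_rho hκ) (covC k i (S.embed φ))) (covC k i (S.embed φ))).re
        + (inner ℂ (mulLp _ (memLp_theta_sq hκ) (toLTwo φ)) (rad φ)).re
        + 1 / 2 * (‖toLTwo φ‖ * ∑ i, ‖covC k i (S.embed φ)‖) := by
  set σ : ℝ → ℝ := fun r => √(rho κ r) with hσdef
  set σ' : ℝ → ℝ := fun r => theta κ r ^ 2 / (2 * √(rho κ r)) with hσ'def
  have hrho : ∀ r, 0 < r → 0 < rho κ r := fun r hr => mul_pos hr (theta_pos hκ hr.le)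
  have hd : ∀ r, 0 < r → HasDerivAt σ (σ' r) r := fun r hr =>
    (hasDerivAt_rho hκ hr).sqrt (hrho r hr).ne'
  have hσ' : ∀ r, 0 < r → ContDiffAt ℝ ∞ σ' r := fun r hr =>
    ((contDiffAt_theta hκ hr).pow 2).div (contDiffAt_const.mul (hσ r hr))
      (mul_ne_zero two_ne_zero (Real.sqrt_pos.mpr (hrho r hr)).ne')
  set g := toLTwo (rmul σ' hσ' φ) with hg
  set A : Fin n → LTwo n := fun i => toLTwo (rmul σ hσ (covT k i φ)) with hA
  set B : Fin n → LTwo n := fun i => toLTwo (rmul σ' hσ' (xhatMul i φ)) with hB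
  have hBg : ∀ i, B i = mulLp (xhat i) (memLp_xhat i) g := fun i => by
    rw [hB, hg, ← toLTwo_xhatMul]
    refine toLTwo_congr fun x _ => ?_
    simp only [rmul_apply, xhatMul_apply]
    ring
  have h1 : gradNormSq (phaseMul k σ hσ φ) = ∑ i, ‖A i‖ ^ 2 + 2 * ∑ i, (inner ℂ (A i) (B i)).re
      + ∑ i, ‖B i‖ ^ 2 := by
    rw [S.gradNormSq_eq, Finset.mul_sum, ← Finset.sum_add_distrib, ← Finset.sum_add_distrib]
    refine Finset.sum_congr rfl fun i _ => ?_
    rw [gradC_embed, norm_pd_phaseMul k hσ hσ' hd, norm_add_sq (𝕜 := ℂ)]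
    rfl
  have h2 : ∀ i, ‖A i‖ ^ 2
      = (inner ℂ (mulLp _ (memLp_rho hκ) (covC k i (S.embed φ))) (covC k i (S.embed φ))).re := by
    intro i
    rw [covC_embed, ← toLTwo_rmul (fun r hr => contDiffAt_rho hκ hr) (memLp_rho hκ)]
    have e1 : ‖A i‖ ^ 2 = (inner ℂ (A i) (A i)).re := (inner_self_eq_norm_sq (𝕜 := ℂ) _).symm
    rw [e1]
    congr 1
    refine inner_toLTwo_congr fun x hx => ?_
    simp only [rmul_apply, map_mul, Complex.conj_ofReal]
    have e2 : (σ ‖x‖ : ℂ) * (σ ‖x‖ : ℂ) = (rho κ ‖x‖ : ℂ) := by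
      rw [← Complex.ofReal_mul, Real.mul_self_sqrt (rho_nonneg hκ (norm_nonneg x))]
    rw [← e2]
    ring
  have h3 : ∀ i, inner ℂ (A i) (B i) = (1 / 2 : ℂ) * inner ℂ
      (mulLp (xhat i) (memLp_xhat i) (covC k i (S.embed φ)))
      (mulLp _ (memLp_theta_sq hκ) (toLTwo φ)) := by
    intro i
    rw [covC_embed, ← toLTwo_rmul (χ := fun r => theta κ r ^ 2)
      (fun r hr => (contDiffAt_theta hκ hr).pow 2) (memLp_theta_sq hκ), ← toLTwo_xhatMul,
      ← inner_smul_right, ← map_smul]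
    refine inner_toLTwo_congr fun x hx => ?_
    have e1 : σ ‖x‖ * σ' ‖x‖ = 1 / 2 * theta κ ‖x‖ ^ 2 := by
      have := (Real.sqrt_pos.mpr (hrho _ (norm_pos_iff.mpr hx))).ne'
      simp only [hσdef, hσ'def]
      field_simp
    have e2 : (σ ‖x‖ : ℂ) * (σ' ‖x‖ : ℂ) = (1 / 2 : ℂ) * ((theta κ ‖x‖ ^ 2 : ℝ) : ℂ) := by
      rw [← Complex.ofReal_mul, e1]; push_cast; ring
    change ((σ' ‖x‖ : ℂ) * ((xhat i x : ℂ) * φ x)) * starRingEnd ℂ ((σ ‖x‖ : ℂ) * covT k i φ x)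
      = ((1 / 2 : ℂ) * (((theta κ ‖x‖ ^ 2 : ℝ) : ℂ) * φ x))
        * starRingEnd ℂ ((xhat i x : ℂ) * covT k i φ x)
    simp only [map_mul, Complex.conj_ofReal]
    linear_combination ((xhat i x : ℂ) * φ x * starRingEnd ℂ (covT k i φ x)) * e2
  have h4 : 2 * ∑ i, (inner ℂ (A i) (B i)).re
      = (inner ℂ (mulLp _ (memLp_theta_sq hκ) (toLTwo φ)) (rad φ)).re := by
    rw [← Complex.re_sum]
    simp only [h3]
    rw [← Finset.mul_sum, ← sum_inner, sum_mulLp_covC S.two_le, radC_embed, obsC_zero_embed,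
      inner_sub_left, inner_smul_left, ← inner_mulLp, ← inner_mulLp,
      ← inner_conj_symm (mulLp _ (memLp_theta_sq hκ) (toLTwo φ)) (rad φ), Complex.conj_re]
    have e1 := inner_mulLp_self_im (memLp_theta_sq hκ) (toLTwo φ)
    have e2 : (starRingEnd ℂ (Complex.I * k)
        * inner ℂ (mulLp _ (memLp_theta_sq hκ) (toLTwo φ)) (toLTwo φ)).re = 0 := by
      simp [e1]
    rw [show (1 / 2 : ℂ) = ((1 / 2 : ℝ) : ℂ) by push_cast; rfl, Complex.re_ofReal_mul,
      Complex.sub_re, e2, inner_mulLp]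
    ring
  have h5 : ∑ i, ‖B i‖ ^ 2 = ‖g‖ ^ 2 := by
    have e1 : ∀ f : LTwo n, ‖f‖ ^ 2 = (inner ℂ f f).re := fun f =>
      (inner_self_eq_norm_sq (𝕜 := ℂ) _).symm
    simp only [hBg, e1, inner_mulLp]
    rw [← Complex.re_sum, ← inner_sum, sum_mulLp_xhat_sq S.two_le]
  have h6 : ‖g‖ ^ 2 ≤ 1 / 4 * ∫ x, ‖x‖⁻¹ * ‖φ x‖ ^ 2 := by
    rw [hg, norm_toLTwo_sq, ← integral_const_mul]
    refine integral_mono_of_nonneg (ae_of_all _ fun x => by positivity) ?_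
      (ae_of_all _ fun x => ?_)
    · have e1 : Integrable (invR (normSq φ)) :=
        (invR (normSq φ)).continuous.integrable_of_hasCompactSupport
          (invR (normSq φ)).hasCompactSupport
      refine (e1.re.const_mul (1 / 4)).congr (ae_of_all _ fun x => ?_)
      change 1 / 4 * (((‖x‖⁻¹ : ℝ) : ℂ) * (φ x * starRingEnd ℂ (φ x))).re = _
      rw [Complex.mul_conj, Complex.normSq_eq_norm_sq, ← Complex.ofReal_mul, Complex.ofReal_re]
    · by_cases hx : x = 0
      · simp [hx, apply_zero]
      have hx' : 0 < ‖x‖ := norm_pos_iff.mpr hx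
      have hr := hrho _ hx'
      have ht := theta_pos hκ hx'.le
      change ‖(σ' ‖x‖ : ℂ) * φ x‖ ^ 2 ≤ 1 / 4 * (‖x‖⁻¹ * ‖φ x‖ ^ 2)
      rw [norm_mul, Complex.norm_real, mul_pow, Real.norm_eq_abs, sq_abs, ← mul_assoc]
      gcongr
      have e3 : σ' ‖x‖ ^ 2 = 1 / 4 * (‖x‖⁻¹ * theta κ ‖x‖ ^ 3) := by
        simp only [hσ'def]
        rw [div_pow, mul_pow, Real.sq_sqrt hr.le, rho]
        field_simp
        norm_num
      rw [e3]
      have e4 : theta κ ‖x‖ ^ 3 ≤ 1 := pow_le_one₀ ht.le (theta_le_one hκ hx'.le)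
      have e5 : ‖x‖⁻¹ * theta κ ‖x‖ ^ 3 ≤ ‖x‖⁻¹ * 1 := by gcongr
      linarith
  have h7 := S.integral_inv_norm_mul_le k φ
  simp only [← S.covC_embed] at h7
  rw [h1, h4, h5]
  simp only [h2]
  linarith

/-- This is `Q_H ≥ 0` evaluated at `√ρ e^{-ikr} u`. The phase leaves the potential term unchanged,
and the square root of the weight costs only the last summand. -/
lemma radial_positivity {a : FormSpace n} (ha : a ∈ S.dom) {κ : ℝ} (hκ : 0 < κ) (k : ℝ) :
    0 ≤ ∑ i, (inner ℂ (mulLp _ (memLp_rho hκ) (covC k i a)) (covC k i a)).re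
        + (inner ℂ (mulLp _ (memLp_theta_sq hκ) (obsC 0 a)) (radC a)).re
        + (inner ℂ (mulLp _ (memLp_rho hκ) (obsC 1 a)) (obsC 2 a)).re
        + 1 / 2 * (‖obsC 0 a‖ * ∑ i, ‖covC k i a‖) := by
  refine S.dom_induction (P := fun a =>
    0 ≤ ∑ i, (inner ℂ (mulLp _ (memLp_rho hκ) (covC k i a)) (covC k i a)).re
        + (inner ℂ (mulLp _ (memLp_theta_sq hκ) (obsC 0 a)) (radC a)).re
        + (inner ℂ (mulLp _ (memLp_rho hκ) (obsC 1 a)) (obsC 2 a)).re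
        + 1 / 2 * (‖obsC 0 a‖ * ∑ i, ‖covC k i a‖)) (isClosed_le (by fun_prop) ?_) ?_ ha
  · have hre : Continuous Complex.re := Complex.continuous_re
    fun_prop
  intro φ
  have hσ : ∀ r, 0 < r → ContDiffAt ℝ ∞ (fun r => √(rho κ r)) r := fun r hr =>
    (contDiffAt_rho hκ hr).sqrt (mul_pos hr (theta_pos hκ hr.le)).ne'
  have h1 := S.gradNormSq_phaseMul_le hκ k hσ φ
  have h2 := S.qform_re_ge (S.embed_mem (phaseMul k (fun r => √(rho κ r)) hσ φ))
  rw [qform, S.inner_obsC_phaseMul k hσ (memLp_rho hκ) (fun r hr =>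
    Real.sq_sqrt (rho_nonneg hκ hr.le)), Complex.add_re, Complex.re_sum] at h2
  have h3 : ∑ i, (inner ℂ (gradC i (S.embed (phaseMul k (fun r => √(rho κ r)) hσ φ)))
      (gradC i (S.embed (phaseMul k (fun r => √(rho κ r)) hσ φ)))).re
      = gradNormSq (phaseMul k (fun r => √(rho κ r)) hσ φ) := by
    rw [S.gradNormSq_eq]
    exact Finset.sum_congr rfl fun i _ => inner_self_eq_norm_sq (𝕜 := ℂ) _
  rw [h3] at h2
  rw [obsC_zero_embed, radC_embed]
  linarith

end FormSetup

/-! ### Removal of the truncation -/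

lemma tendsto_mulLp {b : ℕ → RSpace n → ℝ} (hb : ∀ j, MemLp (b j) ∞ volume)
    (h1 : ∀ j, ∀ᵐ x, |b j x| ≤ 1) (h : ∀ᵐ x, Tendsto (fun j => b j x) atTop (𝓝 1)) (f : LTwo n) :
    Tendsto (fun j => mulLp (b j) (hb j) f) atTop (𝓝 f) := by
  rw [tendsto_iff_norm_sub_tendsto_zero]
  have e : ∀ j, ‖mulLp (b j) (hb j) f - f‖ ^ 2 = ∫ x, ((b j x - 1) ^ 2 * ‖f x‖ ^ 2) := by
    intro j
    have h2 : (‖mulLp (b j) (hb j) f - f‖ ^ 2 : ℝ)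
        = (inner ℂ (mulLp (b j) (hb j) f - f) (mulLp (b j) (hb j) f - f)).re :=
      (inner_self_eq_norm_sq (𝕜 := ℂ) _).symm
    rw [h2, inner_eq_integral]
    refine (integral_re (integrable_mul_conj _ _)).symm.trans (integral_congr_ae ?_)
    filter_upwards [Lp.coeFn_sub (mulLp (b j) (hb j) f) f, mulLp_ae (hb j) f] with x h3 h4
    rw [h3, Pi.sub_apply, h4, show (b j x : ℂ) * f x - f x = ((b j x - 1 : ℝ) : ℂ) * f x by
      push_cast; ring, Complex.mul_conj, Complex.normSq_eq_norm_sq, norm_mul, Complex.norm_real,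
      mul_pow, Real.norm_eq_abs, sq_abs]
    exact Complex.ofReal_re _
  have hf : Integrable fun x => ‖f x‖ ^ 2 := (Lp.memLp f).integrable_norm_pow (by simp)
  have h5 : Tendsto (fun j => ∫ x, ((b j x - 1) ^ 2 * ‖f x‖ ^ 2)) atTop
      (𝓝 (∫ _ : RSpace n, (0 : ℝ))) := by
    refine tendsto_integral_of_dominated_convergence (fun x => 4 * ‖f x‖ ^ 2) (fun j => ?_)
      (hf.const_mul 4) (fun j => ?_) ?_
    · exact (((hb j).aestronglyMeasurable.sub aestronglyMeasurable_const).pow 2).mul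
        hf.aestronglyMeasurable
    · filter_upwards [h1 j] with x hx
      rw [Real.norm_of_nonneg (by positivity)]
      gcongr
      have := abs_le.mp hx
      nlinarith
    · filter_upwards [h] with x hx
      have := ((hx.sub_const 1).pow 2).mul_const (‖f x‖ ^ 2)
      simpa using this
  rw [integral_zero] at h5
  have h6 := h5.sqrt
  rw [Real.sqrt_zero] at h6
  refine h6.congr fun j => ?_
  rw [← e, Real.sqrt_sq (norm_nonneg _)]

/-- A sequence of truncation parameters. -/
def kap (j : ℕ) : ℝ := 1 / (j + 1)

lemma kap_pos (j : ℕ) : 0 < kap j := by unfold kap; positivity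

lemma tendsto_theta_kap (r : ℝ) : Tendsto (fun j => theta (kap j) r) atTop (𝓝 1) := by
  have h : Tendsto kap atTop (𝓝 0) := tendsto_one_div_add_atTop_nhds_zero_nat
  have h2 := ((h.mul_const r).const_add 1).inv₀ (by simp)
  simpa [theta] using h2

lemma tendsto_mulLp_theta (f : LTwo n) :
    Tendsto (fun j => mulLp _ (memLp_theta (kap_pos j)) f) atTop (𝓝 f) :=
  tendsto_mulLp _ (fun j => ae_of_all _ fun x => abs_theta_le (kap_pos j) _ (norm_nonneg x))
    (ae_of_all _ fun x => tendsto_theta_kap ‖x‖) f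

lemma tendsto_mulLp_theta_sq (f : LTwo n) :
    Tendsto (fun j => mulLp _ (memLp_theta_sq (kap_pos j)) f) atTop (𝓝 f) :=
  tendsto_mulLp _ (fun j => ae_of_all _ fun x => abs_theta_sq_le (kap_pos j) _ (norm_nonneg x))
    (ae_of_all _ fun x => by simpa using (tendsto_theta_kap ‖x‖).pow 2) f

lemma mulLp_rho_eq {κ : ℝ} (hκ : 0 < κ) {f X : LTwo n} (hX : X =ᵐ[volume] fun x => (‖x‖ : ℂ) * f x) :
    mulLp _ (memLp_rho hκ) f = mulLp _ (memLp_theta hκ) X := by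
  refine Lp.ext ?_
  filter_upwards [mulLp_ae (memLp_rho hκ) f, mulLp_ae (memLp_theta hκ) X, hX] with x h1 h2 h3
  rw [h1, h2, h3, rho]
  push_cast
  ring

/-! ### Repulsivity with a phase and identities for the radial derivative -/

namespace FormSetup

variable {V W w : RSpace n → ℝ} (S : FormSetup V W w)

/-- The second inequality is the repulsivity assumption applied to `e^{-ikr} φ`: its gradient has
the size of the covariant gradient of `φ`, and the zeroth-order terms depend on the modulus only.
The constant is therefore independent of `k`. -/
lemma exists_repulsive_phase : ∃ δ : ℝ, 0 < δ ∧ ∀ a ∈ S.dom,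
    δ * ‖obsC 6 a‖ ^ 2 ≤ (qform a a).re ∧
    ∀ k : ℝ, δ * (∑ i, ‖covC k i a‖ ^ 2 + ‖obsC 6 a‖ ^ 2)
      ≤ ∑ i, ‖covC k i a‖ ^ 2 - (inner ℂ (obsC 1 a) (obsC 2 a)).re
        - (inner ℂ (obsC 3 a) (obsC 4 a)).re := by
  obtain ⟨δ, hδ, h⟩ := S.repulsive
  have hre : Continuous Complex.re := Complex.continuous_re
  refine ⟨δ, hδ, fun a ha => ⟨?_, fun k => ?_⟩⟩
  · refine S.dom_induction (P := fun a => δ * ‖obsC 6 a‖ ^ 2 ≤ (qform a a).re)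
      (isClosed_le (by fun_prop) (by fun_prop)) ?_ ha
    intro φ
    rw [qform_embed, norm_obsC_embed_sq]
    refine le_trans ?_ (h φ).1
    rw [gradNormSq_eq S]
    have : 0 ≤ ∑ i, ‖gradC i (S.embed φ)‖ ^ 2 := by positivity
    gcongr
    exact le_add_of_nonneg_left this
  · refine S.dom_induction (P := fun a => δ * (∑ i, ‖covC k i a‖ ^ 2 + ‖obsC 6 a‖ ^ 2)
      ≤ ∑ i, ‖covC k i a‖ ^ 2 - (inner ℂ (obsC 1 a) (obsC 2 a)).re
        - (inner ℂ (obsC 3 a) (obsC 4 a)).re) (isClosed_le (by fun_prop) (by fun_prop)) ?_ ha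
    intro φ
    have h1s : ∀ r : ℝ, 0 < r → ContDiffAt ℝ ∞ (fun _ : ℝ => (1 : ℝ)) r := fun r _ =>
      contDiffAt_const
    have h0s : ∀ r : ℝ, 0 < r → ContDiffAt ℝ ∞ (fun _ : ℝ => (0 : ℝ)) r := fun r _ =>
      contDiffAt_const
    have hone : MemLp (fun x : RSpace n => (fun _ : ℝ => (1 : ℝ)) ‖x‖) ∞ volume :=
      memLp_radial measurable_const (C := 1) (by simp)
    set ψ := phaseMul k (fun _ => 1) h1s φ with hψ
    have h2 := (h ψ).2
    have e1 : gradNormSq ψ = ∑ i, ‖covC k i (S.embed φ)‖ ^ 2 := by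
      rw [S.gradNormSq_eq]
      refine Finset.sum_congr rfl fun i _ => ?_
      rw [gradC_embed, norm_pd_phaseMul k h1s h0s (fun r _ => hasDerivAt_const r 1), covC_embed]
      congr 2
      rw [← map_add]
      refine toLTwo_congr fun x _ => ?_
      change ((1 : ℝ) : ℂ) * covT k i φ x + ((0 : ℝ) : ℂ) * _ = covT k i φ x
      simp
    have e2 : ∫ x, ‖(w x : ℂ) * ψ x‖ ^ 2 = ‖obsC 6 (S.embed φ)‖ ^ 2 := by
      rw [norm_obsC_embed_sq]
      refine integral_congr_ae (ae_of_all _ fun x => ?_)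
      simp only [norm_mul, hψ, norm_phaseMul_apply, abs_one, one_mul]
      rfl
    have e3 : ∀ k₁ k₂, inner ℂ (obsC k₁ (S.embed ψ)) (obsC k₂ (S.embed ψ))
        = inner ℂ (obsC k₁ (S.embed φ)) (obsC k₂ (S.embed φ)) := fun k₁ k₂ => by
      rw [hψ, S.inner_obsC_phaseMul k h1s hone (fun r _ => one_pow 2), mulLp_one]
    have e4 : (schrodingerForm (fun x => - V x - W x) ψ ψ).re = gradNormSq ψ
        - (inner ℂ (obsC 1 (S.embed ψ)) (obsC 2 (S.embed ψ))).re
        - (inner ℂ (obsC 3 (S.embed ψ)) (obsC 4 (S.embed ψ))).re := by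
      have e5 : ∫ x, ∑ i : Fin n, partialDeriv i ψ x * starRingEnd ℂ (partialDeriv i ψ x)
          = ((gradNormSq ψ : ℝ) : ℂ) := by
        rw [gradNormSq, ← integral_complex_ofReal]
        refine integral_congr_ae (ae_of_all _ fun x => ?_)
        simp only [Complex.mul_conj, Complex.normSq_eq_norm_sq]
        push_cast
        rfl
      have e6 : ∫ x, ((- V x - W x : ℝ) : ℂ) * ψ x * starRingEnd ℂ (ψ x)
          = -(inner ℂ (obsC 1 (S.embed ψ)) (obsC 2 (S.embed ψ)))
            - inner ℂ (obsC 3 (S.embed ψ)) (obsC 4 (S.embed ψ)) := by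
        rw [inner_eq_integral, inner_eq_integral, ← neg_add', ← integral_add
          (integrable_mul_conj _ _) (integrable_mul_conj _ _), ← integral_neg]
        refine integral_congr_ae ?_
        filter_upwards [S.obsC_embed_ae 1 ψ, S.obsC_embed_ae 2 ψ, S.obsC_embed_ae 3 ψ,
          S.obsC_embed_ae 4 ψ] with x h1 h2 h3 h4
        rw [h1, h2, h3, h4]
        simp only [obs, Matrix.cons_val_one, Matrix.cons_val, map_mul, Complex.conj_ofReal]
        conv_lhs => rw [← div_sqrt_abs_mul (V x), ← div_sqrt_abs_mul (W x)]
        push_cast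
        ring
      rw [schrodingerForm, e5, e6, Complex.add_re, Complex.sub_re, Complex.neg_re,
        Complex.ofReal_re]
      ring
    rw [e4, e1, e2, e3, e3] at h2
    exact h2

/-- The distributional definition of `x·∇V` tested against `|φ|²`, with `x·∇|φ|² = 2|x| Re(φ̄ ∂ᵣφ)`.
-/
lemma re_inner_radC_obsC {a : FormSpace n} (ha : a ∈ S.dom) :
    (inner ℂ (radC a) (obsC 5 a)).re = -(n / 2 * (inner ℂ (obsC 1 a) (obsC 2 a)).re)
      - 1 / 2 * (inner ℂ (obsC 3 a) (obsC 4 a)).re := by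
  have hre : Continuous Complex.re := Complex.continuous_re
  refine S.dom_induction (P := fun a => (inner ℂ (radC a) (obsC 5 a)).re
    = -(n / 2 * (inner ℂ (obsC 1 a) (obsC 2 a)).re)
      - 1 / 2 * (inner ℂ (obsC 3 a) (obsC 4 a)).re) (isClosed_eq (by fun_prop) (by fun_prop)) ?_ ha
  intro φ
  have h := S.euler.integral_eq (normSq φ)
  have e1 : ∫ x, (W x : ℂ) * normSq φ x = inner ℂ (obsC 3 (S.embed φ)) (obsC 4 (S.embed φ)) := by
    rw [inner_eq_integral]
    refine integral_congr_ae ?_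
    filter_upwards [S.obsC_embed_ae 3 φ, S.obsC_embed_ae 4 φ] with x h3 h4
    rw [h3, h4, normSq_apply]
    simp only [obs, Matrix.cons_val, map_mul, Complex.conj_ofReal]
    conv_lhs => rw [← div_sqrt_abs_mul (W x)]
    push_cast
    ring
  have e2 : ∫ x, (V x : ℂ) * ((n : ℂ) * normSq φ x + fderiv ℝ (normSq φ) x x)
      = n * inner ℂ (obsC 1 (S.embed φ)) (obsC 2 (S.embed φ))
        + (inner ℂ (radC (S.embed φ)) (obsC 5 (S.embed φ))
          + inner ℂ (obsC 5 (S.embed φ)) (radC (S.embed φ))) := by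
    rw [inner_eq_integral, inner_eq_integral, inner_eq_integral, ← integral_const_mul,
      ← add_assoc, ← integral_add ((integrable_mul_conj _ _).const_mul _)
        (integrable_mul_conj _ _), ← integral_add _ (integrable_mul_conj _ _)]
    rotate_left
    · exact ((integrable_mul_conj _ _).const_mul _).add (integrable_mul_conj _ _)
    refine integral_congr_ae ?_
    filter_upwards [S.obsC_embed_ae 1 φ, S.obsC_embed_ae 2 φ, S.obsC_embed_ae 5 φ,
      rad_ae φ, ae_ne_zero S.two_le] with x h1 h2 h5 hr hx
    rw [radC_embed, h1, h2, h5, hr, normSq_apply, fderiv_normSq, ← Complex.add_conj]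
    have hx' : (‖x‖ : ℂ) ≠ 0 := by exact_mod_cast norm_ne_zero_iff.mpr hx
    have hV : ((V x / √|V x| : ℝ) : ℂ) * ((√|V x| : ℝ) : ℂ) = (V x : ℂ) := by
      rw [← Complex.ofReal_mul, div_sqrt_abs_mul]
    simp only [obs, Matrix.cons_val_one, Matrix.cons_val, map_mul, Complex.conj_ofReal,
      Complex.conj_conj]
    have e7 : (((V x / √|V x| : ℝ) : ℂ) * φ x) * (((√|V x| : ℝ) : ℂ) * starRingEnd ℂ (φ x))
        = (V x : ℂ) * (φ x * starRingEnd ℂ (φ x)) := by rw [← hV]; ring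
    rw [e7]
    push_cast
    field_simp
    ring
  rw [e1, e2] at h
  have h3 := congrArg Complex.re h
  rw [Complex.neg_re, Complex.add_re, Complex.add_re,
    ← inner_conj_symm (obsC 5 (S.embed φ)) (radC (S.embed φ)), Complex.conj_re,
    show (n : ℂ) = ((n : ℝ) : ℂ) by push_cast; rfl, Complex.re_ofReal_mul] at h3
  linarith

/-- Integration by parts along `x θ(|x|)`. Since `κ r θ = 1 - θ`, the divergence `n θ + r θ'` equals
`(n-1)θ + θ²`. -/
lemma re_inner_rho_radC {a : FormSpace n} (ha : a ∈ S.dom) {κ : ℝ} (hκ : 0 < κ) :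
    (inner ℂ (mulLp _ (memLp_rho hκ) (obsC 0 a)) (radC a)).re
      = -((n - 1) / 2 * (inner ℂ (mulLp _ (memLp_theta hκ) (obsC 0 a)) (obsC 0 a)).re)
        - 1 / 2 * (inner ℂ (mulLp _ (memLp_theta_sq hκ) (obsC 0 a)) (obsC 0 a)).re := by
  have hre : Continuous Complex.re := Complex.continuous_re
  refine S.dom_induction (P := fun a => (inner ℂ (mulLp _ (memLp_rho hκ) (obsC 0 a)) (radC a)).re
      = -((n - 1) / 2 * (inner ℂ (mulLp _ (memLp_theta hκ) (obsC 0 a)) (obsC 0 a)).re)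
        - 1 / 2 * (inner ℂ (mulLp _ (memLp_theta_sq hκ) (obsC 0 a)) (obsC 0 a)).re)
    (isClosed_eq (by fun_prop) (by fun_prop)) ?_ ha
  intro φ
  have hθ : ∀ r, 0 < r → ContDiffAt ℝ ∞ (theta κ) r := fun r hr => contDiffAt_theta hκ hr
  have h := integral_radial_mul_normSq hθ
    (fun r hr => contDiffAt_const.mul ((hθ r hr).pow 2)) (fun r hr => hasDerivAt_theta hκ hr) φ
  have e1 : toLTwo (rmul (fun r => r * theta κ r) (fun r hr => contDiffAt_id.mul (hθ r hr)) φ)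
      = mulLp _ (memLp_rho hκ) (toLTwo φ) :=
    toLTwo_rmul (χ := rho κ) (fun r hr => contDiffAt_rho hκ hr) (memLp_rho hκ) φ
  have e2 : ∀ {b : RSpace n → ℝ} (hb : MemLp b ∞ volume),
      (fun x => toLTwo φ x * starRingEnd ℂ (mulLp b hb (toLTwo φ) x))
        =ᵐ[volume] fun x => ((b x * ‖φ x‖ ^ 2 : ℝ) : ℂ) := by
    intro b hb
    filter_upwards [mulLp_ae hb (toLTwo φ), φ.toLTwo_ae] with x h1 h2
    rw [h1, h2, map_mul, Complex.conj_ofReal, mul_left_comm, Complex.mul_conj,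
      Complex.normSq_eq_norm_sq]
    push_cast
    rfl
  have e3 : ∀ {b : RSpace n → ℝ} (hb : MemLp b ∞ volume),
      (inner ℂ (mulLp b hb (toLTwo φ)) (toLTwo φ)).re = ∫ x, b x * ‖φ x‖ ^ 2 := by
    intro b hb
    rw [inner_eq_integral, integral_congr_ae (e2 hb), integral_complex_ofReal, Complex.ofReal_re]
  have e4 : ∀ {b : RSpace n → ℝ} (_ : MemLp b ∞ volume), Integrable fun x => b x * ‖φ x‖ ^ 2 :=
    fun hb => by
      refine ((integrable_mul_conj (mulLp _ hb (toLTwo φ)) (toLTwo φ)).congr (e2 hb)).re.congr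
        (ae_of_all _ fun x => ?_)
      exact Complex.ofReal_re _
  rw [obsC_zero_embed, radC_embed, ← e1, e3, e3]
  have e5 : ∫ x : RSpace n, (n * theta κ ‖x‖ + ‖x‖ * (-κ * theta κ ‖x‖ ^ 2)) * ‖φ x‖ ^ 2
      = (n - 1) * (∫ x, theta κ ‖x‖ * ‖φ x‖ ^ 2) + ∫ x, theta κ ‖x‖ ^ 2 * ‖φ x‖ ^ 2 := by
    rw [← integral_const_mul, ← integral_add ((e4 (memLp_theta hκ)).const_mul _)
      (e4 (memLp_theta_sq hκ))]
    refine integral_congr_ae (ae_of_all _ fun x => ?_)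
    have : 1 + κ * ‖x‖ ≠ 0 := by positivity
    simp only [theta]
    field_simp
    ring
  rw [e5] at h
  linarith

end FormSetup

/-! ### Weighted integrability of solutions and identities with the weight `|x|` -/

lemma tendsto_rho_kap (r : ℝ) : Tendsto (fun j => rho (kap j) r) atTop (𝓝 r) := by
  simpa [rho] using (tendsto_theta_kap r).const_mul r

/-- Fatou's lemma along the truncations `ρ u → |x| u`. -/
lemma memLp_norm_mul_of_bound {u : LTwo n} {M : ℝ}
    (h : ∀ j, ‖mulLp _ (memLp_rho (kap_pos j)) u‖ ≤ M) :
    MemLp (fun x => (‖x‖ : ℂ) * u x) 2 volume := by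
  have hm : AEStronglyMeasurable (fun x : RSpace n => (‖x‖ : ℂ) * u x) volume := by
    have : Continuous fun x : RSpace n => (‖x‖ : ℂ) := by fun_prop
    exact this.aestronglyMeasurable.mul (Lp.aestronglyMeasurable u)
  refine ⟨hm, ?_⟩
  have h1 : ∀ᵐ x, Tendsto (fun j => mulLp _ (memLp_rho (kap_pos j)) u x) atTop
      (𝓝 ((‖x‖ : ℂ) * u x)) := by
    filter_upwards [ae_all_iff.mpr fun j => mulLp_ae (memLp_rho (kap_pos j)) u] with x hx
    simp only [hx]
    exact ((Complex.continuous_ofReal.tendsto _).comp (tendsto_rho_kap ‖x‖)).mul_const _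
  have h2 := Lp.eLpNorm_lim_le_liminf_eLpNorm (p := 2)
    (fun j => Lp.aestronglyMeasurable (mulLp _ (memLp_rho (kap_pos j)) u)) _ h1
  refine h2.trans_lt (lt_of_le_of_lt ?_ (ENNReal.ofReal_lt_top (r := M)))
  refine (liminf_le_liminf (v := fun _ : ℕ => ENNReal.ofReal M)
    (Eventually.of_forall fun j => ?_)).trans_eq (liminf_const _)
  rw [← ENNReal.ofReal_toReal (Lp.eLpNorm_ne_top _)]
  exact ENNReal.ofReal_le_ofReal (h j)

lemma norm_radC_sub_le (hn : 2 ≤ n) (k : ℝ) (a : FormSpace n) :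
    ‖radC a - (Complex.I * k) • obsC 0 a‖ ≤ ∑ i, ‖covC k i a‖ := by
  rw [← sum_mulLp_covC hn]
  refine (norm_sum_le _ _).trans (Finset.sum_le_sum fun i _ => ?_)
  refine (norm_mulLp_le (memLp_xhat i) (C := 1) (ae_of_all _ fun x => abs_xhat_le i x) _).trans_eq
    (one_mul _)

lemma sum_norm_covC_sq (hn : 2 ≤ n) (k : ℝ) (a : FormSpace n) :
    ∑ i, ‖covC k i a‖ ^ 2 = ∑ i, ‖gradC i a‖ ^ 2 + k ^ 2 * ‖obsC 0 a‖ ^ 2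
      - 2 * k * (inner ℂ (obsC 0 a) (radC a)).im := by
  have h1 : MemLp (fun _ : RSpace n => (1 : ℝ)) ∞ volume :=
    memLp_radial (χ := fun _ => 1) measurable_const (C := 1) (by simp)
  have h := sum_inner_covC hn h1 k a
  have e : ∀ f : LTwo n, (inner ℂ f f).re = ‖f‖ ^ 2 := fun f => inner_self_eq_norm_sq (𝕜 := ℂ) f
  simpa only [mulLp_one, e] using h

namespace FormSetup

variable {V W w : RSpace n → ℝ} (S : FormSetup V W w)

section Equation

variable {a : FormSpace n} (ha : a ∈ S.dom) {z : ℂ} {F : LTwo n}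
  (hEq : ∀ b ∈ S.dom, qform a b - z * inner ℂ (obsC 0 b) (obsC 0 a) = inner ℂ (obsC 0 b) F)

include hEq in
lemma test_equation (φ : PuncturedTest n) :
    qform a (S.embed φ) - z * inner ℂ (toLTwo φ) (obsC 0 a) = inner ℂ (toLTwo φ) F := by
  rw [← S.obsC_zero_embed]
  exact hEq _ (S.embed_mem φ)

include ha hEq in
lemma energy_re : (qform a a).re - z.re * ‖obsC 0 a‖ ^ 2 = (inner ℂ (obsC 0 a) F).re := by
  have h := congrArg Complex.re (hEq a ha)
  rw [inner_self_eq_norm_sq_to_K] at h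
  rw [← h]
  simp [← Complex.ofReal_pow]

include ha hEq in
lemma energy_im : -(z.im * ‖obsC 0 a‖ ^ 2) = (inner ℂ (obsC 0 a) F).im := by
  have h := congrArg Complex.im (hEq a ha)
  rw [inner_self_eq_norm_sq_to_K] at h
  rw [← h]
  simp [← Complex.ofReal_pow, S.qform_im ha]

include ha hEq in
-- Off the real axis the solution gains the weight `|x|`. The imaginary part of the equation with
-- weight `ρ²` leaves `Im z ‖ρ u‖²` against terms linear in `‖ρ u‖`, since `(ρ²)' = 2ρθ²` with `θ² ≤
-- 1` and `ρ F = θ |x| F`. Dividing by `‖ρ u‖` gives a bound uniform in the truncation; its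
-- dependence on `Im z` is harmless, as only finiteness is used later.
lemma exists_norm_mul {Y : LTwo n} (hY : Y =ᵐ[volume] fun x => (‖x‖ : ℂ) * F x)
    (hz : z.im ≠ 0) : ∃ X : LTwo n, X =ᵐ[volume] fun x => (‖x‖ : ℂ) * obsC 0 a x := by
  have hz' : 0 < |z.im| := abs_pos.mpr hz
  have h : ∀ j, ‖mulLp _ (memLp_rho (kap_pos j)) (obsC 0 a)‖
      ≤ (2 * ‖radC a‖ + ‖Y‖) / |z.im| := by
    intro j
    set κ := kap j
    have hκ : 0 < κ := kap_pos j
    set r := mulLp _ (memLp_rho hκ) (obsC 0 a) with hr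
    have hsm : Measurable fun r => 2 * rho κ r * theta κ r ^ 2 :=
      ((measurable_rho κ).const_mul 2).mul ((measurable_theta κ).pow_const 2)
    have b1 : MemLp (fun x : RSpace n => rho κ ‖x‖ ^ 2) ∞ volume :=
      memLp_radial (χ := fun r => rho κ r ^ 2) ((measurable_rho κ).pow_const 2) (C := κ⁻¹ ^ 2)
        fun r hr => by rw [abs_pow]; exact pow_le_pow_left₀ (abs_nonneg _) (abs_rho_le hκ r hr) 2
    have b2 : MemLp (fun x : RSpace n => 2 * rho κ ‖x‖ * theta κ ‖x‖ ^ 2) ∞ volume :=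
      memLp_radial (χ := fun r => 2 * rho κ r * theta κ r ^ 2) hsm (C := 2 * κ⁻¹ * 1)
        fun r hr => by
          rw [abs_mul, abs_mul, abs_two]
          have := abs_rho_le hκ r hr
          have := abs_theta_sq_le hκ r hr
          gcongr
    have hW := S.weighted_equation ha (S.test_equation hEq) (χ := fun r => rho κ r ^ 2)
      (χ' := fun r => 2 * rho κ r * theta κ r ^ 2) (fun r hr => (contDiffAt_rho hκ hr).pow 2)
      (fun r hr => (contDiffAt_const.mul (contDiffAt_rho hκ hr)).mul ((contDiffAt_theta hκ hr).pow 2))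
      (fun r hr => by simpa using (hasDerivAt_rho hκ hr).fun_pow 2) b1 b2
    have hI := congrArg Complex.im hW
    rw [Complex.sub_im, Complex.add_im, Complex.add_im, Complex.im_sum,
      Finset.sum_eq_zero fun i _ => inner_mulLp_self_im b1 _, S.inner_obsC_im ha b1,
      Complex.mul_im, inner_mulLp_self_im b1] at hI
    have e1 : mulLp _ b1 (obsC 0 a) = mulLp _ (memLp_rho hκ) r :=
      (mulLp_mulLp _ _ _ (ae_of_all _ fun x => (sq _).symm) _).symm
    have e2 : mulLp _ b2 (obsC 0 a) = (2 : ℂ) • mulLp _ (memLp_theta_sq hκ) r := by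
      refine Lp.ext ?_
      filter_upwards [mulLp_ae b2 (obsC 0 a), Lp.coeFn_smul (2 : ℂ) (mulLp _ (memLp_theta_sq hκ) r),
        mulLp_ae (memLp_theta_sq hκ) r, mulLp_ae (memLp_rho hκ) (obsC 0 a)] with x h1 h2 h3 h4
      rw [h1, h2, Pi.smul_apply, h3, hr, h4, smul_eq_mul]
      push_cast
      ring
    have e3 : inner ℂ (mulLp _ b1 (obsC 0 a)) F = inner ℂ r (mulLp _ (memLp_theta hκ) Y) := by
      rw [e1, inner_mulLp, mulLp_rho_eq hκ hY]
    have e4 : (inner ℂ (mulLp _ b1 (obsC 0 a)) (obsC 0 a)).re = ‖r‖ ^ 2 := by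
      rw [e1, inner_mulLp]
      exact inner_self_eq_norm_sq (𝕜 := ℂ) r
    rw [e3, e4] at hI
    have i1 : |(inner ℂ r (mulLp _ (memLp_theta hκ) Y)).im| ≤ ‖r‖ * ‖Y‖ := by
      refine (Complex.abs_im_le_norm _).trans ((norm_inner_le_norm _ _).trans ?_)
      gcongr
      exact (norm_mulLp_le _ (ae_of_all _ fun x => abs_theta_le hκ _ (norm_nonneg x)) _).trans_eq
        (one_mul _)
    have i2 : |(inner ℂ (mulLp _ b2 (obsC 0 a)) (radC a)).im| ≤ 2 * ‖r‖ * ‖radC a‖ := by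
      refine (Complex.abs_im_le_norm _).trans ((norm_inner_le_norm _ _).trans ?_)
      rw [e2, norm_smul, Complex.norm_ofNat]
      gcongr
      exact (norm_mulLp_le _ (ae_of_all _ fun x => abs_theta_sq_le hκ _ (norm_nonneg x)) _).trans_eq
        (one_mul _)
    have i3 : |z.im| * ‖r‖ ^ 2 ≤ ‖r‖ * (2 * ‖radC a‖ + ‖Y‖) := by
      rw [← abs_of_nonneg (sq_nonneg ‖r‖), ← abs_mul]
      have : z.im * ‖r‖ ^ 2 = (inner ℂ (mulLp _ b2 (obsC 0 a)) (radC a)).im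
        - (inner ℂ r (mulLp _ (memLp_theta hκ) Y)).im := by linarith
      rw [this]
      refine (abs_sub _ _).trans ?_
      linarith
    rw [le_div_iff₀ hz']
    rcases (norm_nonneg r).eq_or_lt with h0 | h0
    · rw [← h0]; simp only [zero_mul]; positivity
    · refine le_of_mul_le_mul_left ?_ h0
      linarith
  have hm := memLp_norm_mul_of_bound h
  exact ⟨hm.toLp _, hm.coeFn_toLp⟩

variable {X : LTwo n} (hX : X =ᵐ[volume] fun x => (‖x‖ : ℂ) * obsC 0 a x)

include ha hX in
lemma re_inner_norm_mul_radC : (inner ℂ X (radC a)).re = -(n / 2 * ‖obsC 0 a‖ ^ 2) := by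
  have hre : Continuous Complex.re := Complex.continuous_re
  have e : ∀ f : LTwo n, (inner ℂ f f).re = ‖f‖ ^ 2 := fun f => inner_self_eq_norm_sq (𝕜 := ℂ) f
  have h1 : Tendsto (fun j => (inner ℂ (mulLp _ (memLp_theta (kap_pos j)) X) (radC a)).re)
      atTop (𝓝 (inner ℂ X (radC a)).re) :=
    (hre.tendsto _).comp ((tendsto_mulLp_theta X).inner tendsto_const_nhds)
  have h2 : Tendsto (fun j => (inner ℂ (mulLp _ (memLp_theta (kap_pos j)) (obsC 0 a))
      (obsC 0 a)).re) atTop (𝓝 (‖obsC 0 a‖ ^ 2)) := by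
    rw [← e]
    exact (hre.tendsto _).comp ((tendsto_mulLp_theta _).inner tendsto_const_nhds)
  have h3 : Tendsto (fun j => (inner ℂ (mulLp _ (memLp_theta_sq (kap_pos j)) (obsC 0 a))
      (obsC 0 a)).re) atTop (𝓝 (‖obsC 0 a‖ ^ 2)) := by
    rw [← e]
    exact (hre.tendsto _).comp ((tendsto_mulLp_theta_sq _).inner tendsto_const_nhds)
  have h4 := tendsto_nhds_unique h1
    ((((h2.const_mul (((n : ℝ) - 1) / 2)).neg).sub (h3.const_mul (1 / 2))).congr fun j => by
      rw [← mulLp_rho_eq (kap_pos j) hX, S.re_inner_rho_radC ha (kap_pos j)])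
  rw [h4]
  ring

include ha hEq in
lemma weighted_equation_rho {κ : ℝ} (hκ : 0 < κ) :
    ∑ i, inner ℂ (mulLp _ (memLp_rho hκ) (gradC i a)) (gradC i a)
      + inner ℂ (mulLp _ (memLp_theta_sq hκ) (obsC 0 a)) (radC a)
      + inner ℂ (mulLp _ (memLp_rho hκ) (obsC 1 a)) (obsC 2 a)
      - z * inner ℂ (mulLp _ (memLp_rho hκ) (obsC 0 a)) (obsC 0 a)
      = inner ℂ (mulLp _ (memLp_rho hκ) (obsC 0 a)) F :=
  S.weighted_equation ha (S.test_equation hEq) (χ := rho κ) (χ' := fun r => theta κ r ^ 2)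
    (fun _ hr => contDiffAt_rho hκ hr) (fun _ hr => (contDiffAt_theta hκ hr).pow 2)
    (fun _ hr => hasDerivAt_rho hκ hr) (memLp_rho hκ) (memLp_theta_sq hκ)

include ha hEq hX in
-- Imaginary part of the equation with weight `ρ`, as `κ → 0`: the gradient and potential terms are
-- real and drop out.
lemma flux_identity : (inner ℂ (obsC 0 a) (radC a)).im - z.im * (inner ℂ X (obsC 0 a)).re
    = (inner ℂ X F).im := by
  have him : Continuous Complex.im := Complex.continuous_im
  have hre : Continuous Complex.re := Complex.continuous_re
  have h1 : ∀ j, (inner ℂ (mulLp _ (memLp_theta_sq (kap_pos j)) (obsC 0 a)) (radC a)).im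
      - z.im * (inner ℂ (mulLp _ (memLp_theta (kap_pos j)) X) (obsC 0 a)).re
      = (inner ℂ (mulLp _ (memLp_theta (kap_pos j)) X) F).im := by
    intro j
    have hI := congrArg Complex.im (S.weighted_equation_rho ha hEq (kap_pos j))
    rw [Complex.sub_im, Complex.add_im, Complex.add_im, Complex.im_sum,
      Finset.sum_eq_zero fun i _ => inner_mulLp_self_im (memLp_rho (kap_pos j)) _,
      S.inner_obsC_im ha (memLp_rho (kap_pos j)), Complex.mul_im,
      inner_mulLp_self_im (memLp_rho (kap_pos j)), mulLp_rho_eq (kap_pos j) hX] at hI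
    linarith
  have t1 := (him.tendsto _).comp ((tendsto_mulLp_theta_sq (obsC 0 a)).inner
    (tendsto_const_nhds (x := radC a)))
  have t2 := (hre.tendsto _).comp ((tendsto_mulLp_theta X).inner
    (tendsto_const_nhds (x := obsC 0 a)))
  have t3 := (him.tendsto _).comp ((tendsto_mulLp_theta X).inner
    (tendsto_const_nhds (x := F)))
  exact tendsto_nhds_unique ((t1.sub (t2.const_mul z.im)).congr h1) t3

include ha hEq hX in
-- The real part of the equation with weight `ρ` eliminates the gradient, potential and `θ²` terms
-- from `radial_positivity`. The phase term and the spectral term each contribute `k²⟨ρu, u⟩`,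
-- whence the coefficient `2k²`. Letting `κ → 0` restores the weight `|x|`.
lemma flux_inequality {k : ℝ} (hk : k ^ 2 = z.re) :
    0 ≤ (inner ℂ X F).re + 2 * k ^ 2 * (inner ℂ X (obsC 0 a)).re - 2 * k * (inner ℂ X (radC a)).im
      + 1 / 2 * (‖obsC 0 a‖ * ∑ i, ‖covC k i a‖) := by
  have him : Continuous Complex.im := Complex.continuous_im
  have hre : Continuous Complex.re := Complex.continuous_re
  have h1 : ∀ j, 0 ≤ (inner ℂ (mulLp _ (memLp_theta (kap_pos j)) X) F).re
      + 2 * k ^ 2 * (inner ℂ (mulLp _ (memLp_theta (kap_pos j)) X) (obsC 0 a)).re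
      - 2 * k * (inner ℂ (mulLp _ (memLp_theta (kap_pos j)) X) (radC a)).im
      + 1 / 2 * (‖obsC 0 a‖ * ∑ i, ‖covC k i a‖) := by
    intro j
    have hR := congrArg Complex.re (S.weighted_equation_rho ha hEq (kap_pos j))
    have hp := S.radial_positivity ha (kap_pos j) k
    rw [sum_inner_covC S.two_le, mulLp_rho_eq (kap_pos j) hX] at hp
    rw [Complex.sub_re, Complex.add_re, Complex.add_re, Complex.re_sum, Complex.mul_re,
      inner_mulLp_self_im (memLp_rho (kap_pos j)), mulLp_rho_eq (kap_pos j) hX, ← hk] at hR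
    linarith
  have t1 := (hre.tendsto _).comp ((tendsto_mulLp_theta X).inner
    (tendsto_const_nhds (x := F)))
  have t2 := (hre.tendsto _).comp ((tendsto_mulLp_theta X).inner
    (tendsto_const_nhds (x := obsC 0 a)))
  have t3 := (him.tendsto _).comp ((tendsto_mulLp_theta X).inner
    (tendsto_const_nhds (x := radC a)))
  exact ge_of_tendsto' (((t1.add (t2.const_mul (2 * k ^ 2))).sub (t3.const_mul (2 * k))).add_const _)
    h1

include ha hEq hX in
-- The equation reads `-Δu = F + z u - V u`, and `|x|` times the right side lies in `L²`; this is
-- why `|x| V u` is among the controlled multiples. The virial identity for the Laplacian then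
-- applies.
lemma virial_identity {Y : LTwo n} (hY : Y =ᵐ[volume] fun x => (‖x‖ : ℂ) * F x) :
    (inner ℂ (radC a) (Y + z • X - obsC 5 a)).re = (1 - n / 2) * ∑ i, ‖gradC i a‖ ^ 2 := by
  refine S.re_inner_radC ha fun φ => ?_
  have h := S.test_equation hEq φ
  have key : ∀ {f g : LTwo n}, (g =ᵐ[volume] fun x => (‖x‖ : ℂ) * f x) →
      inner ℂ (toLTwo (invR φ)) g = inner ℂ (toLTwo φ) f := by
    intro f g hg
    rw [inner_eq_integral, inner_eq_integral]
    refine integral_congr_ae ?_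
    filter_upwards [hg, (invR φ).toLTwo_ae, φ.toLTwo_ae, ae_ne_zero S.two_le] with x h1 h2 h3 h4
    have hx : (‖x‖ : ℂ) ≠ 0 := by exact_mod_cast norm_ne_zero_iff.mpr h4
    rw [h1, h2, h3, invR_apply]
    simp only [map_mul, Complex.conj_ofReal]
    push_cast
    field_simp
  have key2 : inner ℂ (toLTwo (invR φ)) (obsC 5 a)
      = inner ℂ (obsC 1 (S.embed φ)) (obsC 2 a) := by
    rw [inner_eq_integral, inner_eq_integral]
    refine integral_congr_ae ?_
    filter_upwards [S.obsC_ae ha 5, S.obsC_ae ha 2, S.obsC_embed_ae 1 φ, (invR φ).toLTwo_ae,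
      ae_ne_zero S.two_le] with x h1 h2 h3 h4 h5
    have hx : (‖x‖ : ℂ) ≠ 0 := by exact_mod_cast norm_ne_zero_iff.mpr h5
    rw [h1, h2, h3, h4, invR_apply]
    have hV : ((V x / √|V x| : ℝ) : ℂ) * ((√|V x| : ℝ) : ℂ) = (V x : ℂ) := by
      rw [← Complex.ofReal_mul, div_sqrt_abs_mul]
    simp only [obs, Matrix.cons_val_one, Matrix.cons_val, map_mul, Complex.conj_ofReal]
    rw [mul_mul_mul_comm, mul_mul_mul_comm ((V x / √|V x| : ℝ) : ℂ), hV]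
    push_cast
    field_simp
  rw [inner_sub_right, inner_add_right, inner_smul_right, key hY, key hX, key2, ← h, qform]
  simp only [gradC_embed]
  ring

end Equation

end FormSetup

/-! ### Absorption and the a priori estimate -/

/-- The constant which results from absorbing the quadratic terms in the multiplier inequality. -/
def absorbConst (n δ C : ℝ) : ℝ :=
  4 / δ * (2 * n * C ^ 2 / δ + C ^ 2 / 4 + ((n - 1) / 2 + n / (8 * δ) + 1 / 4) ^ 2 / δ)

lemma sq_le_absorbConst_mul {m δ C b N A B t : ℝ} (hm : 1 ≤ m) (hδ : 0 < δ) (hA : A ^ 2 ≤ m * B)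
    (ht : t ^ 2 ≤ b * N)
    (h : 1 / 2 * (δ * (B + b ^ 2)) ≤ A * (C * N) + (m - 1) / 2 * (b * N)
      + 1 / 2 * t * (C * N + 1 / 2 * A)) :
    b ^ 2 ≤ absorbConst m δ C * N ^ 2 := by
  have hm0 : 0 < m := by linarith
  have hAB : δ / (8 * m) * A ^ 2 ≤ δ / 8 * B := by
    calc δ / (8 * m) * A ^ 2 ≤ δ / (8 * m) * (m * B) := by gcongr
      _ = δ / 8 * B := by field_simp
  have amgm : ∀ x y s : ℝ, 0 < s → x * y ≤ s * x ^ 2 + y ^ 2 / (4 * s) := fun x y s hs => by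
    have : 0 ≤ (2 * s * x - y) ^ 2 / (4 * s) := by positivity
    have e : (2 * s * x - y) ^ 2 / (4 * s) = s * x ^ 2 + y ^ 2 / (4 * s) - x * y := by
      field_simp; ring
    linarith
  have h1 : A * (C * N) ≤ δ / 8 * B + 2 * m * C ^ 2 / δ * N ^ 2 := by
    refine (amgm A (C * N) (δ / (8 * m)) (by positivity)).trans ?_
    have : (C * N) ^ 2 / (4 * (δ / (8 * m))) = 2 * m * C ^ 2 / δ * N ^ 2 := by field_simp; ring
    linarith
  have h2 : A * (t / 4) ≤ δ / 8 * B + m / (8 * δ) * (b * N) := by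
    refine (amgm A (t / 4) (δ / (8 * m)) (by positivity)).trans ?_
    have e : (t / 4) ^ 2 / (4 * (δ / (8 * m))) = m / (8 * δ) * t ^ 2 := by field_simp; ring
    have : m / (8 * δ) * t ^ 2 ≤ m / (8 * δ) * (b * N) := by gcongr
    linarith
  have h3 : 1 / 2 * t * (C * N) ≤ 1 / 4 * (b * N) + C ^ 2 / 4 * N ^ 2 := by
    nlinarith [sq_nonneg (t - C * N)]
  set K := (m - 1) / 2 + m / (8 * δ) + 1 / 4 with hK
  have h4 : b * (K * N) ≤ δ / 4 * b ^ 2 + K ^ 2 / δ * N ^ 2 := by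
    refine (amgm b (K * N) (δ / 4) (by positivity)).trans_eq ?_
    field_simp
  have hB : 0 ≤ B := nonneg_of_mul_nonneg_right ((sq_nonneg A).trans hA) hm0
  have h5 : δ / 4 * b ^ 2 ≤ (2 * m * C ^ 2 / δ + C ^ 2 / 4 + K ^ 2 / δ) * N ^ 2 := by
    have : 0 ≤ δ * B := by positivity
    have e : b * (K * N) = (m - 1) / 2 * (b * N) + m / (8 * δ) * (b * N) + 1 / 4 * (b * N) := by
      rw [hK]; ring
    linarith
  calc b ^ 2 = 4 / δ * (δ / 4 * b ^ 2) := by field_simp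
    _ ≤ 4 / δ * ((2 * m * C ^ 2 / δ + C ^ 2 / 4 + K ^ 2 / δ) * N ^ 2) := by gcongr
    _ = absorbConst m δ C * N ^ 2 := by rw [absorbConst]; ring

namespace FormSetup

variable {V W w : RSpace n → ℝ} (S : FormSetup V W w)

section Equation

variable {a : FormSpace n} (ha : a ∈ S.dom) {z : ℂ} {F : LTwo n}
  (hEq : ∀ b ∈ S.dom, qform a b - z * inner ℂ (obsC 0 b) (obsC 0 a) = inner ℂ (obsC 0 b) F)

include ha hEq in
/-- The virial identity for `H`, with the phase `e^{ikr}` removed. -/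
lemma multiplier_identity {k : ℝ} (hk : k ^ 2 = z.re) {X Y : LTwo n}
    (hX : X =ᵐ[volume] fun x => (‖x‖ : ℂ) * obsC 0 a x)
    (hY : Y =ᵐ[volume] fun x => (‖x‖ : ℂ) * F x) :
    1 / 2 * (∑ i, ‖covC k i a‖ ^ 2 - (inner ℂ (obsC 1 a) (obsC 2 a)).re
        - (inner ℂ (obsC 3 a) (obsC 4 a)).re)
      = (inner ℂ (radC a - (Complex.I * k) • obsC 0 a) Y).re
        + (n - 1) / 2 * (inner ℂ (obsC 0 a) F).re
        + z.im * ((inner ℂ X (radC a)).im - k * (inner ℂ X (obsC 0 a)).re) := by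
  have hXY : inner ℂ X F = inner ℂ (obsC 0 a) Y := by
    rw [inner_eq_integral, inner_eq_integral]
    refine integral_congr_ae ?_
    filter_upwards [hX, hY] with x h1 h2
    rw [h1, h2, map_mul, Complex.conj_ofReal]
    ring
  have hvir := S.virial_identity ha hEq hX hY
  have hp := S.re_inner_norm_mul_radC ha hX
  have hen := S.energy_re ha hEq
  have hfl := S.flux_identity ha hEq hX
  have hcov := sum_norm_covC_sq S.two_le k a
  have heu := S.re_inner_radC_obsC ha
  have hq : (qform a a).re = ∑ i, ‖gradC i a‖ ^ 2 + (inner ℂ (obsC 1 a) (obsC 2 a)).re := by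
    rw [qform, Complex.add_re, Complex.re_sum]
    congr 1
    exact Finset.sum_congr rfl fun i _ => inner_self_eq_norm_sq (𝕜 := ℂ) _
  rw [inner_sub_right, inner_add_right, inner_smul_right, Complex.sub_re, Complex.add_re,
    Complex.mul_re, ← inner_conj_symm (radC a) X, Complex.conj_re, Complex.conj_im, hp, heu,
    ← hk] at hvir
  have hr : (inner ℂ (radC a - (Complex.I * k) • obsC 0 a) Y).re
      = (inner ℂ (radC a) Y).re - k * (inner ℂ (obsC 0 a) Y).im := by
    rw [inner_sub_left, inner_smul_left]
    simp [sub_eq_add_neg]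
  rw [hr, hcov]
  rw [hXY] at hfl
  rw [hq, ← hk] at hen
  -- The virial identity is combined with `n/2` times the energy identity and `-k` times the flux
  -- identity. Completing the covariant square uses up another half of the energy, leaving the
  -- coefficient `(n-1)/2`.
  have h1 : (n / 2 : ℝ) * (∑ i, ‖gradC i a‖ ^ 2 + (inner ℂ (obsC 1 a) (obsC 2 a)).re
      - k ^ 2 * ‖obsC 0 a‖ ^ 2) = n / 2 * (inner ℂ (obsC 0 a) F).re := by rw [hen]
  have h2 : k * ((inner ℂ (obsC 0 a) (radC a)).im - z.im * (inner ℂ X (obsC 0 a)).re)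
    = k * (inner ℂ (obsC 0 a) Y).im := by rw [hfl]
  linarith

end Equation

/-- The weighted a priori estimate for solutions of `(H - z) u = w f`. -/
theorem exists_norm_obsC_le : ∃ C : ℝ, 0 < C ∧ ∀ z : ℂ, z ∉ Complex.ofReal '' Set.Ici (0 : ℝ) →
    ∀ a ∈ S.dom, ∀ f F : LTwo n, (F =ᵐ[volume] fun x => (w x : ℂ) * f x) →
    (∀ b ∈ S.dom, qform a b - z * inner ℂ (obsC 0 b) (obsC 0 a) = inner ℂ (obsC 0 b) F) →
    ‖obsC 6 a‖ ≤ C * ‖f‖ := by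
  obtain ⟨δ, hδ, hrep⟩ := S.exists_repulsive_phase
  obtain ⟨C₁, hC₁, hw⟩ := S.weight
  have hn : (2 : ℝ) ≤ n := by exact_mod_cast S.two_le
  have hK0 : 0 ≤ absorbConst n δ C₁ := by unfold absorbConst; positivity
  refine ⟨2 / δ + √(absorbConst n δ C₁), by positivity, fun z hz a ha f F hF hEq => ?_⟩
  set N := ‖f‖ with hN
  set b := ‖obsC 6 a‖ with hb
  have hb0 : 0 ≤ b := norm_nonneg _
  have hN0 : 0 ≤ N := norm_nonneg _
  have huF : inner ℂ (obsC 0 a) F = inner ℂ (obsC 6 a) f := by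
    rw [inner_eq_integral, inner_eq_integral]
    refine integral_congr_ae ?_
    filter_upwards [hF, S.obsC_ae ha 6] with x h1 h2
    rw [h1, h2]
    simp only [obs, Matrix.cons_val, map_mul, Complex.conj_ofReal]
    ring
  have hbN : ‖inner ℂ (obsC 0 a) F‖ ≤ b * N := huF ▸ norm_inner_le_norm _ _
  have hre : |(inner ℂ (obsC 0 a) F).re| ≤ b * N := (Complex.abs_re_le_norm _).trans hbN
  have him : |(inner ℂ (obsC 0 a) F).im| ≤ b * N := (Complex.abs_im_le_norm _).trans hbN
  have hen := S.energy_re ha hEq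
  have hIm := S.energy_im ha hEq
  have hεu : |z.im| * ‖obsC 0 a‖ ^ 2 ≤ b * N := by
    rw [← abs_of_nonneg (sq_nonneg ‖obsC 0 a‖), ← abs_mul, ← abs_neg, hIm]
    exact him
  rw [add_mul]
  -- In this sector `Re z ‖u‖²` is at most `|Im z|‖u‖² ≤ b N`, so the energy identity alone closes
  -- the estimate.
  by_cases hcase : z.re ≤ |z.im|
  · have h1 : z.re * ‖obsC 0 a‖ ^ 2 ≤ b * N :=
      le_trans (mul_le_mul_of_nonneg_right hcase (sq_nonneg _)) hεu
    have h2 := (hrep a ha).1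
    have h3 : b * (δ * b) ≤ b * (2 * N) := by
      have := (abs_le.mp hre).2
      nlinarith
    have h4 : b ≤ 2 / δ * N := by
      rcases hb0.eq_or_lt with h0 | h0
      · rw [← h0]; positivity
      · have := le_of_mul_le_mul_left h3 h0
        rw [div_mul_eq_mul_div, le_div_iff₀ hδ]
        linarith
    have : 0 ≤ √(absorbConst n δ C₁) * N := by positivity
    linarith
  · push Not at hcase
    have hε : z.im ≠ 0 := by
      intro h0
      refine hz ⟨z.re, ?_, Complex.ext (Complex.ofReal_re _) (by rw [h0, Complex.ofReal_im])⟩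
      rw [h0, abs_zero] at hcase
      exact hcase.le
    have hre0 : 0 < z.re := (abs_nonneg _).trans_lt hcase
    -- The outgoing or incoming phase is chosen so that `Im z / k > 0`: only then can the one-sided
    -- `flux_inequality` be multiplied by this factor.
    obtain ⟨k, hk, hkε⟩ : ∃ k : ℝ, k ^ 2 = z.re ∧ 0 < k * z.im := by
      have hs : 0 < √z.re := Real.sqrt_pos.mpr hre0
      rcases hε.lt_or_gt with h | h
      · exact ⟨-√z.re, by rw [neg_sq, Real.sq_sqrt hre0.le], mul_pos_of_neg_of_neg (by linarith) h⟩
      · exact ⟨√z.re, Real.sq_sqrt hre0.le, mul_pos hs h⟩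
    have hk0 : k ≠ 0 := left_ne_zero_of_mul hkε.ne'
    have hwm : MemLp (fun x : RSpace n => ‖x‖ * w x) ∞ volume := by
      refine memLp_top_of_bound ?_ C₁ hw
      exact continuous_norm.aestronglyMeasurable.mul (S.aesm_obs 6)
    -- Boundedness of `|x| w` is what makes the source `|x| F = |x| w f` controlled by `‖f‖`.
    set Y := mulLp _ hwm f with hYdef
    have hY : Y =ᵐ[volume] fun x => (‖x‖ : ℂ) * F x := by
      filter_upwards [mulLp_ae hwm f, hF] with x h1 h2
      rw [hYdef, h1, h2]
      push_cast
      ring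
    have hYn : ‖Y‖ ≤ C₁ * N := norm_mulLp_le hwm hw f
    obtain ⟨X, hX⟩ := S.exists_norm_mul ha hEq hY hε
    have hXF : inner ℂ X F = inner ℂ (obsC 0 a) Y := by
      rw [inner_eq_integral, inner_eq_integral]
      refine integral_congr_ae ?_
      filter_upwards [hX, hY] with x h1 h2
      rw [h1, h2, map_mul, Complex.conj_ofReal]
      ring
    have hid := S.multiplier_identity ha hEq hk hX hY
    have hpos := S.flux_inequality ha hEq hX hk
    have hr := (hrep a ha).2 k
    set A := ∑ i, ‖covC k i a‖ with hA
    set B := ∑ i, ‖covC k i a‖ ^ 2 with hB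
    have hA0 : 0 ≤ A := Finset.sum_nonneg fun i _ => norm_nonneg _
    have hAB : A ^ 2 ≤ n * B := by
      have := sq_sum_le_card_mul_sum_sq (s := Finset.univ) (f := fun i : Fin n => ‖covC k i a‖)
      simpa using this
    set U := ‖obsC 0 a‖ with hU
    have hU0 : 0 ≤ U := norm_nonneg _
    -- Since `(Im z)² / k² = |Im z| (|Im z| / Re z) ≤ |Im z|`, this quantity satisfies `t² ≤ |Im
    -- z|‖u‖² ≤ b N`, uniformly in `z`.
    set t := z.im / k * U with ht
    have hεk : 0 < z.im / k := by
      have : z.im / k = k * z.im / k ^ 2 := by field_simp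
      rw [this]; positivity
    have ht0 : 0 ≤ t := by positivity
    have ht2 : t ^ 2 ≤ b * N := by
      refine le_trans ?_ hεu
      have e : t ^ 2 = |z.im| * (|z.im| / k ^ 2) * U ^ 2 := by
        rw [ht, mul_pow, div_pow, ← sq_abs z.im]; ring
      rw [e]
      have : |z.im| / k ^ 2 ≤ 1 := by rw [hk, div_le_one hre0]; exact hcase.le
      have := mul_le_mul_of_nonneg_left this (abs_nonneg z.im)
      rw [mul_one] at this
      exact mul_le_mul_of_nonneg_right this (sq_nonneg U)
    have h1 : (inner ℂ (radC a - (Complex.I * k) • obsC 0 a) Y).re ≤ A * (C₁ * N) := by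
      refine (Complex.re_le_norm _).trans ((norm_inner_le_norm _ _).trans ?_)
      exact mul_le_mul (norm_radC_sub_le S.two_le k a) hYn (norm_nonneg _) hA0
    have h2 : (n - 1) / 2 * (inner ℂ (obsC 0 a) F).re ≤ (n - 1) / 2 * (b * N) := by
      have h' : (0 : ℝ) ≤ (n - 1) / 2 := by linarith
      exact mul_le_mul_of_nonneg_left (abs_le.mp hre).2 h'
    have h3 : (inner ℂ X F).re ≤ U * (C₁ * N) := by
      rw [hXF]
      refine (Complex.re_le_norm _).trans ((norm_inner_le_norm _ _).trans ?_)
      gcongr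
    -- The remainder is `(Im z / 2k)` times the expression bounded in `flux_inequality`.
    have h4 : z.im * ((inner ℂ X (radC a)).im - k * (inner ℂ X (obsC 0 a)).re)
        ≤ 1 / 2 * t * (C₁ * N + 1 / 2 * A) := by
      have e : z.im * ((inner ℂ X (radC a)).im - k * (inner ℂ X (obsC 0 a)).re)
          = 1 / 2 * (z.im / k) * (2 * k * (inner ℂ X (radC a)).im
            - 2 * k ^ 2 * (inner ℂ X (obsC 0 a)).re) := by field_simp
      have e' : 1 / 2 * t * (C₁ * N + 1 / 2 * A)
          = 1 / 2 * (z.im / k) * (U * (C₁ * N) + 1 / 2 * (U * A)) := by rw [ht]; ring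
      rw [e, e']
      refine mul_le_mul_of_nonneg_left ?_ (by positivity)
      linarith
    have h5 : b ^ 2 ≤ absorbConst n δ C₁ * N ^ 2 :=
      sq_le_absorbConst_mul (by linarith) hδ hAB ht2 (by linarith)
    have h6 : b ≤ √(absorbConst n δ C₁) * N := by
      refine abs_le_of_sq_le_sq' ?_ (by positivity) |>.2
      rwa [mul_pow, Real.sq_sqrt hK0]
    have : 0 ≤ 2 / δ * N := by positivity
    linarith

include S in
/-- The uniform resolvent estimate in the abstract setting. -/
theorem uniformResolventEstimate : UniformResolventEstimate V w := by
  obtain ⟨C, hC, h⟩ := S.exists_norm_obsC_le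
  refine ⟨C.toNNReal, Real.toNNReal_pos.mpr hC, fun z hz => ?_⟩
  obtain ⟨R, hR, hsol⟩ := S.exists_resolvent hz
  refine ⟨R, hR, fun φ => ⟨S.memLp_obs 6 φ, ?_⟩⟩
  obtain ⟨a, ha, hRa, hEq⟩ := hsol ((S.memLp_obs 6 φ).toLp _)
  have hF : (S.memLp_obs 6 φ).toLp _ =ᵐ[volume] fun x => (w x : ℂ) * toLTwo φ x := by
    filter_upwards [(S.memLp_obs 6 φ).coeFn_toLp, φ.toLTwo_ae] with x h1 h2
    rw [h1, h2]
    rfl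
  have hb := h z hz a ha (toLTwo φ) _ hF hEq
  have e1 : eLpNorm (fun x => (w x : ℂ) * R ((S.memLp_obs 6 φ).toLp _) x) 2 volume
      = eLpNorm (obsC 6 a) 2 volume := by
    refine eLpNorm_congr_ae ?_
    filter_upwards [S.obsC_ae ha 6] with x h1
    rw [h1, hRa]
    rfl
  have e2 : eLpNorm (fun x => φ x) 2 volume = eLpNorm (toLTwo φ) 2 volume :=
    eLpNorm_congr_ae φ.toLTwo_ae.symm
  rw [e2]
  refine e1.trans_le ?_
  rw [← ENNReal.ofReal_toReal (Lp.eLpNorm_ne_top (obsC 6 a)),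
    ← ENNReal.ofReal_toReal (Lp.eLpNorm_ne_top (toLTwo φ))]
  refine (ENNReal.ofReal_le_ofReal hb).trans_eq ?_
  rw [ENNReal.ofReal_mul hC.le]
  rfl

end FormSetup

/-! ### Reduction of the abstract hypotheses to form bounds -/

lemma schrodingerForm_self_re (U : RSpace n → ℝ) (φ : PuncturedTest n) :
    (schrodingerForm U φ φ).re = gradNormSq φ + ∫ x, U x * ‖φ x‖ ^ 2 := by
  have e1 : ∫ x, ∑ i : Fin n, partialDeriv i φ x * starRingEnd ℂ (partialDeriv i φ x)
      = ((gradNormSq φ : ℝ) : ℂ) := by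
    rw [gradNormSq, ← integral_complex_ofReal]
    refine integral_congr_ae (ae_of_all _ fun x => ?_)
    simp only [Complex.mul_conj, Complex.normSq_eq_norm_sq]
    push_cast
    rfl
  have e2 : ∫ x, (U x : ℂ) * φ x * starRingEnd ℂ (φ x) = ((∫ x, U x * ‖φ x‖ ^ 2 : ℝ) : ℂ) := by
    rw [← integral_complex_ofReal]
    refine integral_congr_ae (ae_of_all _ fun x => ?_)
    simp only [mul_assoc, Complex.mul_conj, Complex.normSq_eq_norm_sq]
    push_cast
    rfl
  rw [schrodingerForm, e1, e2, Complex.add_re, Complex.ofReal_re, Complex.ofReal_re]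

lemma aestronglyMeasurable_of_locallyIntegrableOn (hn : 2 ≤ n) {U : RSpace n → ℝ}
    (h : LocallyIntegrableOn U {0}ᶜ volume) : AEStronglyMeasurable U volume := by
  have h1 : ∀ᵐ x : RSpace n, x ∈ ({0}ᶜ : Set (RSpace n)) := ae_ne_zero hn
  simpa only [Measure.restrict_eq_self_of_ae_mem h1] using h.aestronglyMeasurable

lemma integrable_mul_norm_sq {U : RSpace n → ℝ} (h : LocallyIntegrableOn U {0}ᶜ volume)
    (φ : PuncturedTest n) : Integrable fun x => U x * ‖φ x‖ ^ 2 := by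
  have h1 : IntegrableOn U (tsupport φ) volume :=
    h.integrableOn_compact_subset φ.tsupport_subset φ.hasCompactSupport
  have h2 : IntegrableOn (fun x => U x * ‖φ x‖ ^ 2) (tsupport φ) volume :=
    h1.mul_continuousOn (φ.continuous.norm.pow 2).continuousOn φ.hasCompactSupport
  refine (integrableOn_iff_integrable_of_support_subset fun x hx => ?_).mp h2
  by_contra h3
  exact hx (by simp [image_eq_zero_of_notMem_tsupport h3])

/-- The multiplication operator by `m` is controlled by the form norm. -/
def FormBounded (V m : RSpace n → ℝ) : Prop :=
  AEStronglyMeasurable m volume ∧ ∃ C : ℝ, ∀ φ : PuncturedTest n,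
    MemLp (fun x => (m x : ℂ) * φ x) 2 volume ∧
    ∫ x, ‖(m x : ℂ) * φ x‖ ^ 2 ≤ C * ((schrodingerForm V φ φ).re + ∫ x, ‖φ x‖ ^ 2)

lemma FormBounded.of_abs_le {V m m' : RSpace n → ℝ} (h : FormBounded V m)
    (hm : AEStronglyMeasurable m' volume) {K : ℝ} (hK : ∀ᵐ x, |m' x| ≤ K * |m x|) :
    FormBounded V m' := by
  obtain ⟨-, C, hC⟩ := h
  refine ⟨hm, K ^ 2 * C, fun φ => ?_⟩
  have hb : ∀ᵐ x, ‖(m' x : ℂ) * φ x‖ ≤ K * ‖(m x : ℂ) * φ x‖ := by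
    filter_upwards [hK] with x hx
    rw [norm_mul, norm_mul, Complex.norm_real, Complex.norm_real, Real.norm_eq_abs,
      Real.norm_eq_abs, ← mul_assoc]
    gcongr
  have hmem : MemLp (fun x => (m' x : ℂ) * φ x) 2 volume :=
    (hC φ).1.of_le_mul ((Complex.continuous_ofReal.comp_aestronglyMeasurable hm).mul
      φ.continuous.aestronglyMeasurable) hb
  refine ⟨hmem, ?_⟩
  calc ∫ x, ‖(m' x : ℂ) * φ x‖ ^ 2 ≤ ∫ x, K ^ 2 * ‖(m x : ℂ) * φ x‖ ^ 2 := by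
        refine integral_mono_ae (hmem.integrable_norm_pow (by simp))
          (((hC φ).1.integrable_norm_pow (by simp)).const_mul _) ?_
        filter_upwards [hb] with x hx
        rw [← mul_pow]
        gcongr
    _ = K ^ 2 * ∫ x, ‖(m x : ℂ) * φ x‖ ^ 2 := integral_const_mul _ _
    _ ≤ K ^ 2 * C * ((schrodingerForm V φ φ).re + ∫ x, ‖φ x‖ ^ 2) := by
        rw [mul_assoc]
        exact mul_le_mul_of_nonneg_left (hC φ).2 (sq_nonneg _)

lemma abs_div_sqrt_abs (t : ℝ) : |t / √(|t|)| = |√(|t|)| := by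
  rw [abs_div, abs_of_nonneg (Real.sqrt_nonneg _), Real.div_sqrt]

lemma aestronglyMeasurable_sqrt_abs {U : RSpace n → ℝ} (h : AEStronglyMeasurable U volume) :
    AEStronglyMeasurable (fun x => √|U x|) volume :=
  (Real.continuous_sqrt.comp continuous_abs).comp_aestronglyMeasurable h

lemma FormBounded.div_sqrt_abs {V U : RSpace n → ℝ} (h : FormBounded V fun x => √|U x|)
    (hU : AEStronglyMeasurable U volume) : FormBounded V fun x => U x / √|U x| :=
  h.of_abs_le (hU.aemeasurable.div h.1.aemeasurable).aestronglyMeasurable (K := 1)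
    (ae_of_all _ fun x => by rw [abs_div_sqrt_abs, one_mul])

lemma FormSetup.of_formBounded {V W w : RSpace n → ℝ} (hn : 2 ≤ n) (hE : IsEulerDeriv V W)
    (hV : FormBounded V fun x => √|V x|) (hW : FormBounded V fun x => √|W x|)
    (hxV : FormBounded V fun x => ‖x‖ * V x) (hw : FormBounded V w)
    (hrep : ∃ δ : ℝ, 0 < δ ∧ ∀ φ : PuncturedTest n,
      δ * (gradNormSq φ + ∫ x, ‖(w x : ℂ) * φ x‖ ^ 2) ≤ (schrodingerForm V φ φ).re ∧
      δ * (gradNormSq φ + ∫ x, ‖(w x : ℂ) * φ x‖ ^ 2)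
        ≤ (schrodingerForm (fun x => - V x - W x) φ φ).re)
    (hwt : ∃ C : ℝ, 0 < C ∧ ∀ᵐ x ∂(volume : Measure (RSpace n)), |‖x‖ * w x| ≤ C) :
    FormSetup V W w := by
  have hQ : ∀ φ : PuncturedTest n, 0 ≤ (schrodingerForm V φ φ).re := by
    obtain ⟨δ, hδ, h⟩ := hrep
    intro φ
    refine le_trans ?_ (h φ).1
    have h1 : 0 ≤ gradNormSq φ := integral_nonneg fun x => by positivity
    have h2 : 0 ≤ ∫ x, ‖(w x : ℂ) * φ x‖ ^ 2 := integral_nonneg fun x => by positivity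
    positivity
  have hobs : ∀ k, FormBounded V (obs V W w k) := by
    intro k
    fin_cases k
    · refine ⟨aestronglyMeasurable_const, 1, fun φ => ?_⟩
      have e : ∀ x, ((obs V W w 0 x : ℝ) : ℂ) * φ x = φ x := fun x => by simp [obs]
      change MemLp (fun x => ((obs V W w 0 x : ℝ) : ℂ) * φ x) 2 volume ∧
        ∫ x, ‖((obs V W w 0 x : ℝ) : ℂ) * φ x‖ ^ 2 ≤ _
      simp only [e]
      exact ⟨φ.memLp, by linarith [hQ φ]⟩
    · exact hV
    · exact hV.div_sqrt_abs (aestronglyMeasurable_of_locallyIntegrableOn hn hE.locInt)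
    · exact hW
    · exact hW.div_sqrt_abs (aestronglyMeasurable_of_locallyIntegrableOn hn hE.locInt_deriv)
    · exact hxV
    · exact hw
  choose C hC using fun k => (hobs k).2
  refine ⟨hn, hE, fun k => (hobs k).1, fun k φ => (hC k φ).1,
    ⟨1 + ∑ k, |C k|, by positivity, fun k φ => (hC k φ).2.trans ?_⟩, hrep, hwt⟩
  have h1 : 0 ≤ ∫ x, ‖φ x‖ ^ 2 := integral_nonneg fun x => by positivity
  refine mul_le_mul_of_nonneg_right ?_ (add_nonneg (hQ φ) h1)
  have := Finset.single_le_sum (f := fun k => |C k|) (fun _ _ => abs_nonneg _) (Finset.mem_univ k)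
  linarith [le_abs_self (C k)]

/-! ### Dimension two: pointwise repulsivity -/

/-- The repulsive potentials of dimension two. -/
lemma FormSetup.of_repulsivePointwise {V W : RSpace 2 → ℝ} (hX : InClassXTwo V W)
    (hR : RepulsivePointwise V W) : FormSetup V W fun x => √(V x) := by
  obtain ⟨_, hE, -, M, hM⟩ := hX
  obtain ⟨δ, hδ, hb⟩ := hR.bounds
  have hVm := aestronglyMeasurable_of_locallyIntegrableOn le_rfl hE.locInt
  have hWm := aestronglyMeasurable_of_locallyIntegrableOn le_rfl hE.locInt_deriv
  have hsm : AEStronglyMeasurable (fun x => √(V x)) volume :=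
    Real.continuous_sqrt.comp_aestronglyMeasurable hVm
  have hsq : ∀ φ : PuncturedTest 2, ∀ᵐ x, ‖((√(V x) : ℝ) : ℂ) * φ x‖ ^ 2 = V x * ‖φ x‖ ^ 2 := by
    intro φ
    filter_upwards [hb] with x hx
    rw [norm_mul, mul_pow, Complex.norm_real, Real.norm_eq_abs, sq_abs, Real.sq_sqrt hx.1.le]
  have hgn : ∀ φ : PuncturedTest 2, 0 ≤ gradNormSq φ := fun φ =>
    integral_nonneg fun x => by positivity
  have hVn : ∀ φ : PuncturedTest 2, 0 ≤ ∫ x, V x * ‖φ x‖ ^ 2 := fun φ => by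
    refine integral_nonneg_of_ae ?_
    filter_upwards [hb] with x hx
    have := hx.1.le
    change (0 : ℝ) ≤ V x * ‖φ x‖ ^ 2
    positivity
  have hw : FormBounded V fun x => √(V x) := by
    refine ⟨hsm, 1, fun φ => ⟨?_, ?_⟩⟩
    · refine (memLp_two_iff_integrable_sq_norm
        ((Complex.continuous_ofReal.comp_aestronglyMeasurable hsm).mul
          φ.continuous.aestronglyMeasurable)).mpr ?_
      exact (integrable_mul_norm_sq hE.locInt φ).congr ((hsq φ).mono fun x hx => hx.symm)
    · rw [integral_congr_ae (hsq φ), schrodingerForm_self_re, one_mul]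
      have : 0 ≤ ∫ x, ‖φ x‖ ^ 2 := integral_nonneg fun x => by positivity
      linarith [hgn φ]
  have hsV : ∀ᵐ x : RSpace 2, √(V x) ^ 2 = V x := by
    filter_upwards [hb] with x hx
    exact Real.sq_sqrt hx.1.le
  refine FormSetup.of_formBounded le_rfl hE ?_ ?_ ?_ hw ?_ ?_
  · refine hw.of_abs_le (aestronglyMeasurable_sqrt_abs hVm) (K := 1) ?_
    filter_upwards [hb] with x hx
    rw [abs_of_pos hx.1, one_mul]
  · refine hw.of_abs_le (aestronglyMeasurable_sqrt_abs hWm) (K := √(δ⁻¹)) ?_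
    filter_upwards [hb] with x hx
    -- The lower bound on `-W` makes `W` negative, so `|W| = -W` and the upper bound applies.
    have h1 : |W x| ≤ δ⁻¹ * V x := by
      rw [abs_of_nonpos (by nlinarith [hx.1, hx.2.2])]
      exact hx.2.1
    rw [abs_of_nonneg (Real.sqrt_nonneg _), abs_of_nonneg (Real.sqrt_nonneg _),
      ← Real.sqrt_mul (by positivity)]
    exact Real.sqrt_le_sqrt h1
  · refine hw.of_abs_le (continuous_norm.aestronglyMeasurable.mul hVm) (K := √M) ?_
    filter_upwards [hb, hM, hsV] with x hx hx' h2
    -- This is the bound `|x|² V ≤ M`; it gives `|x| V ≤ √M √V`, a multiple already controlled by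
    -- the form.
    have h1 : ‖x‖ * √(V x) ≤ √M := by
      refine Real.le_sqrt_of_sq_le ?_
      rw [mul_pow, h2]
      exact (mul_le_mul_of_nonneg_left (le_abs_self _) (by positivity)).trans hx'.1
    rw [abs_of_nonneg (Real.sqrt_nonneg _), abs_of_nonneg (mul_nonneg (norm_nonneg _) hx.1.le)]
    calc ‖x‖ * V x = ‖x‖ * √(V x) * √(V x) := by rw [mul_assoc, ← sq, h2]
      _ ≤ √M * √(V x) := by gcongr
  -- The form of `-Δ + V` needs the constant `1`; that of `-Δ - V - W` needs `1` for the gradient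
  -- and `δ` for the potential, since `-V - W ≥ δ V`.
  · refine ⟨min 1 δ, by positivity, fun φ => ?_⟩
    rw [integral_congr_ae (hsq φ), schrodingerForm_self_re, schrodingerForm_self_re]
    have h1 : min 1 δ * gradNormSq φ ≤ gradNormSq φ :=
      mul_le_of_le_one_left (hgn φ) (min_le_left _ _)
    have h2 : min 1 δ * (∫ x, V x * ‖φ x‖ ^ 2) ≤ ∫ x, V x * ‖φ x‖ ^ 2 :=
      mul_le_of_le_one_left (hVn φ) (min_le_left _ _)
    have h3 : min 1 δ * (∫ x, V x * ‖φ x‖ ^ 2) ≤ ∫ x, (- V x - W x) * ‖φ x‖ ^ 2 := by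
      refine (mul_le_mul_of_nonneg_right (min_le_right 1 δ) (hVn φ)).trans ?_
      rw [← integral_const_mul]
      refine integral_mono_ae ((integrable_mul_norm_sq hE.locInt φ).const_mul _) ?_ ?_
      · exact integrable_mul_norm_sq (hE.locInt.neg.sub hE.locInt_deriv) φ
      · filter_upwards [hb] with x hx
        rw [← mul_assoc]
        refine mul_le_mul_of_nonneg_right ?_ (by positivity)
        linarith [hx.2.2]
    constructor <;> linarith
  · refine ⟨√M + 1, by positivity, ?_⟩
    filter_upwards [hb, hM, hsV] with x hx hx' h2
    rw [abs_of_nonneg (by positivity)]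
    have h1 : ‖x‖ * √(V x) ≤ √M := by
      refine Real.le_sqrt_of_sq_le ?_
      rw [mul_pow, h2]
      exact (mul_le_mul_of_nonneg_left (le_abs_self _) (by positivity)).trans hx'.1
    linarith

/-! ### Dimension at least three: Hardy's inequality and Sobolev form bounds -/

namespace PuncturedTest

lemma isSobolevOne (φ : PuncturedTest n) : IsSobolevOne φ fun i => partialDeriv i φ where
  memLp := φ.memLp
  memLp_grad i := (pd i φ).memLp
  weak_grad i ψ := by
    have hψ : Differentiable ℝ ψ := ψ.contDiff.differentiable (by simp)
    have hψ' : Continuous (partialDeriv i ψ) :=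
      (ψ.contDiff.continuous_fderiv (by simp)).clm_apply continuous_const
    have := integral_mul_fderiv_eq_neg_fderiv_mul_of_integrable (μ := volume)
      (f := φ) (g := ψ) (v := EuclideanSpace.single i 1)
      (((pd i φ).integrable_mul ψ.continuous).congr (ae_of_all _ fun x => mul_comm _ _))
      ((φ.integrable_mul hψ').congr (ae_of_all _ fun x => mul_comm _ _))
      ((φ.integrable_mul ψ.continuous).congr (ae_of_all _ fun x => mul_comm _ _))
      (fun x _ => φ.differentiable.differentiableAt) (fun x _ => hψ.differentiableAt)
    exact this

lemma eLpNorm_sq (φ : PuncturedTest n) :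
    eLpNorm φ 2 volume ^ 2 = ENNReal.ofReal (∫ x, ‖φ x‖ ^ 2) := by
  rw [← norm_toLTwo_sq, ENNReal.ofReal_pow (norm_nonneg _), Lp.norm_def,
    ENNReal.ofReal_toReal (Lp.eLpNorm_ne_top _), eLpNorm_congr_ae φ.toLTwo_ae]

lemma gradNormSq_eq_sum (φ : PuncturedTest n) :
    gradNormSq φ = ∑ i, ∫ x, ‖partialDeriv i φ x‖ ^ 2 :=
  integral_finsetSum _ fun i _ => (pd i φ).memLp.integrable_norm_pow (by simp)

lemma sobolevOneNorm_sq (φ : PuncturedTest n) :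
    sobolevOneNorm φ (fun i => partialDeriv i φ) ^ 2
      = ENNReal.ofReal ((∫ x, ‖φ x‖ ^ 2) + gradNormSq φ) := by
  have h : ∀ i, eLpNorm (partialDeriv i φ) 2 volume ^ 2
      = ENNReal.ofReal (∫ x, ‖partialDeriv i φ x‖ ^ 2) := fun i => (pd i φ).eLpNorm_sq
  rw [sobolevOneNorm, ← ENNReal.rpow_natCast, ← ENNReal.rpow_mul]
  simp only [h, eLpNorm_sq]
  rw [gradNormSq_eq_sum,
    ENNReal.ofReal_add (integral_nonneg fun x => by positivity)
      (Finset.sum_nonneg fun i _ => integral_nonneg fun x => by positivity),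
    ENNReal.ofReal_sum_of_nonneg fun i _ => integral_nonneg fun x => by positivity]
  norm_num

lemma gradNorm_sq_le (φ : PuncturedTest n) : gradNorm φ ^ 2 ≤ n * gradNormSq φ := by
  have h := sq_sum_le_card_mul_sum_sq (s := Finset.univ) (f := fun i : Fin n => ‖toLTwo (pd i φ)‖)
  rw [gradNormSq_eq_sum]
  simp only [norm_toLTwo_sq, Finset.card_univ, Fintype.card_fin] at h
  exact h

/-- Hardy's inequality. -/
lemma norm_invR_le (hn : 3 ≤ n) (φ : PuncturedTest n) : ‖toLTwo (invR φ)‖ ≤ 2 * gradNorm φ := by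
  -- The field `x/|x|²` has divergence `(n-2)/|x|²`, and `n - 2 ≥ 1`; Cauchy–Schwarz then leaves one
  -- factor of the Hardy norm on each side.
  have hχ : ∀ r : ℝ, 0 < r → ContDiffAt ℝ ∞ (fun r : ℝ => (r ^ 2)⁻¹) r := fun r hr =>
    (contDiffAt_id.pow 2).inv (by positivity)
  have hχ' : ∀ r : ℝ, 0 < r → ContDiffAt ℝ ∞ (fun r : ℝ => -2 * (r ^ 3)⁻¹) r := fun r hr =>
    contDiffAt_const.mul ((contDiffAt_id.pow 3).inv (by positivity))
  have hd : ∀ r : ℝ, 0 < r → HasDerivAt (fun r : ℝ => (r ^ 2)⁻¹) (-2 * (r ^ 3)⁻¹) r := fun r hr => by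
    refine ((hasDerivAt_pow 2 r).fun_inv (by positivity)).congr_deriv ?_
    field_simp
    push_cast
    ring
  have h := integral_radial_mul_normSq hχ hχ' hd φ
  have e1 : rmul (fun r : ℝ => r * (r ^ 2)⁻¹) (fun r hr => contDiffAt_id.mul (hχ r hr)) φ
      = invR φ := by
    ext x
    rw [rmul_apply, invR_apply]
    by_cases hx : x = 0
    · simp [hx]
    · have : ‖x‖ ≠ 0 := norm_ne_zero_iff.mpr hx
      congr 2
      field_simp
  have e2 : ∫ x : RSpace n, (n * (‖x‖ ^ 2)⁻¹ + ‖x‖ * (-2 * (‖x‖ ^ 3)⁻¹)) * ‖φ x‖ ^ 2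
      = (n - 2) * ‖toLTwo (invR φ)‖ ^ 2 := by
    rw [norm_toLTwo_sq, ← integral_const_mul]
    refine integral_congr_ae (ae_of_all _ fun x => ?_)
    simp only [invR_apply, norm_mul, Complex.norm_real, norm_inv, norm_norm]
    by_cases hx : x = 0
    · simp [hx, φ.apply_zero]
    · have : ‖x‖ ≠ 0 := norm_ne_zero_iff.mpr hx
      field_simp
      ring
  rw [e1, e2] at h
  set b := ‖toLTwo (invR φ)‖
  have hb : 0 ≤ b := norm_nonneg _
  have h1 : |(inner ℂ (toLTwo (invR φ)) (rad φ)).re| ≤ b * gradNorm φ :=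
    (Complex.abs_re_le_norm _).trans ((norm_inner_le_norm _ _).trans
      (mul_le_mul_of_nonneg_left (norm_rad_le φ) hb))
  have hn' : (3 : ℝ) ≤ n := by exact_mod_cast hn
  have h2 : b * b ≤ b * (2 * gradNorm φ) := by
    have := neg_le_of_abs_le h1
    nlinarith [sq_nonneg b]
  rcases hb.eq_or_lt with h0 | h0
  · rw [← h0]
    exact mul_nonneg zero_le_two (gradNorm_nonneg φ)
  · exact le_of_mul_le_mul_left h2 h0

end PuncturedTest

/-- The first repulsivity inequality bounds `‖∇φ‖²` by `δ⁻¹ Q_H(φ,φ)`, so the `ℋ¹` norm is dominated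
by the form norm. -/
lemma RepulsiveForm.formBounded {V W m : RSpace n → ℝ} (hR : RepulsiveForm V W)
    (hm : AEStronglyMeasurable m volume) {C : ℝ≥0}
    (h : ∀ φ : PuncturedTest n, eLpNorm (fun x => (m x : ℂ) * φ x) 2 volume
      ≤ C * sobolevOneNorm φ fun i => partialDeriv i φ) : FormBounded V m := by
  obtain ⟨δ, hδ, hR⟩ := hR
  refine ⟨hm, C ^ 2 * (1 + δ⁻¹), fun φ => ?_⟩
  have hmm : AEStronglyMeasurable (fun x => (m x : ℂ) * φ x) volume :=
    (Complex.continuous_ofReal.comp_aestronglyMeasurable hm).mul φ.continuous.aestronglyMeasurable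
  have hsq : eLpNorm (fun x => (m x : ℂ) * φ x) 2 volume ^ 2
      ≤ ENNReal.ofReal (C ^ 2 * ((∫ x, ‖φ x‖ ^ 2) + gradNormSq φ)) := by
    refine (pow_le_pow_left₀ (zero_le) (h φ) 2).trans_eq ?_
    rw [mul_pow, φ.sobolevOneNorm_sq, ENNReal.ofReal_mul (by positivity),
      ENNReal.ofReal_pow C.coe_nonneg, ENNReal.ofReal_coe_nnreal]
  have hmem : MemLp (fun x => (m x : ℂ) * φ x) 2 volume := by
    refine ⟨hmm, ?_⟩
    by_contra h0
    rw [not_lt_top_iff.mp h0, ENNReal.top_pow two_ne_zero] at hsq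
    exact ENNReal.ofReal_ne_top (top_le_iff.mp hsq)
  refine ⟨hmem, ?_⟩
  have hg : 0 ≤ gradNormSq φ := integral_nonneg fun x => by positivity
  have hu : 0 ≤ ∫ x, ‖φ x‖ ^ 2 := integral_nonneg fun x => by positivity
  have h1 : ∫ x, ‖(m x : ℂ) * φ x‖ ^ 2 ≤ C ^ 2 * ((∫ x, ‖φ x‖ ^ 2) + gradNormSq φ) := by
    rw [← norm_toLp_sq hmem, Lp.norm_toLp, ← ENNReal.toReal_pow]
    exact ENNReal.toReal_le_of_le_ofReal (by positivity) hsq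
  refine h1.trans ?_
  rw [mul_assoc]
  refine mul_le_mul_of_nonneg_left ?_ (by positivity)
  have h2 : gradNormSq φ ≤ δ⁻¹ * (schrodingerForm V φ φ).re := by
    rw [inv_mul_eq_div, le_div_iff₀ hδ, mul_comm]
    exact (hR φ).1
  have h3 : 0 ≤ (schrodingerForm V φ φ).re := le_trans (by positivity) (hR φ).1
  have : 0 ≤ δ⁻¹ * ∫ x, ‖φ x‖ ^ 2 := by positivity
  linarith

/-- The repulsive potentials of dimension at least three. -/
lemma FormSetup.of_repulsiveForm (hn : 3 ≤ n) {V W : RSpace n → ℝ} (hE : IsEulerDeriv V W)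
    (hR : RepulsiveForm V W) (hS : SobolevFormBound V W) : FormSetup V W fun x => ‖x‖⁻¹ := by
  have hn2 : 2 ≤ n := by omega
  have hVm := aestronglyMeasurable_of_locallyIntegrableOn hn2 hE.locInt
  have hWm := aestronglyMeasurable_of_locallyIntegrableOn hn2 hE.locInt_deriv
  have hwm : AEStronglyMeasurable (fun x : RSpace n => ‖x‖⁻¹) volume :=
    measurable_norm.inv.aestronglyMeasurable
  obtain ⟨C, hC⟩ := hS
  have hC' := fun φ : PuncturedTest n => hC φ _ φ.isSobolevOne
  -- The constant is not sharp: `4` is the square of the `2` in `norm_invR_le`, and `n` comes from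
  -- passing from the sum of the norms of the partial derivatives to the sum of their squares.
  have hH : ∀ φ : PuncturedTest n, ∫ x, ‖((‖x‖⁻¹ : ℝ) : ℂ) * φ x‖ ^ 2 ≤ 4 * n * gradNormSq φ := by
    intro φ
    have h1 := pow_le_pow_left₀ (norm_nonneg _) (φ.norm_invR_le hn) 2
    rw [norm_toLTwo_sq] at h1
    have h2 := φ.gradNorm_sq_le
    simp only [invR_apply] at h1
    linarith
  refine FormSetup.of_formBounded hn2 hE
    (hR.formBounded (C := C) (aestronglyMeasurable_sqrt_abs hVm) fun φ => ?_)
    (hR.formBounded (C := C) (aestronglyMeasurable_sqrt_abs hWm) fun φ => ?_)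
    (hR.formBounded (C := C) (continuous_norm.aestronglyMeasurable.mul hVm) fun φ => ?_) ?_ ?_
    ⟨(1 : ℝ), zero_lt_one, ae_of_all _ fun x => ?_⟩
  · exact (le_self_add.trans le_self_add).trans (hC' φ)
  · exact (le_add_self.trans le_self_add).trans (hC' φ)
  · exact le_add_self.trans (hC' φ)
  · obtain ⟨δ, hδ, hR⟩ := hR
    refine ⟨hwm, 4 * n * δ⁻¹, fun φ => ⟨(invR φ).memLp, (hH φ).trans ?_⟩⟩
    rw [mul_assoc (4 * (n : ℝ)) δ⁻¹]
    refine mul_le_mul_of_nonneg_left ?_ (by positivity)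
    have h1 : 0 ≤ ∫ x, ‖φ x‖ ^ 2 := integral_nonneg fun x => by positivity
    rw [inv_mul_eq_div, le_div_iff₀ hδ, mul_comm]
    linarith [(hR φ).1]
  · obtain ⟨δ, hδ, hR⟩ := hR
    have hp : (0 : ℝ) < 1 + 4 * n := by positivity
    -- By Hardy's inequality the gradient and weight terms together are at most `(1 + 4n)‖∇φ‖²`.
    refine ⟨δ / (1 + 4 * n), by positivity, fun φ => ?_⟩
    have h1 : δ / (1 + 4 * n) * (gradNormSq φ + ∫ x, ‖((‖x‖⁻¹ : ℝ) : ℂ) * φ x‖ ^ 2)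
        ≤ δ * gradNormSq φ := by
      rw [div_mul_eq_mul_div, div_le_iff₀ hp, mul_assoc]
      refine mul_le_mul_of_nonneg_left ?_ hδ.le
      linarith [hH φ]
    exact ⟨h1.trans (hR φ).1, h1.trans (hR φ).2⟩
  · rw [abs_of_nonneg (by positivity)]
    exact mul_inv_le_one

end

theorem mainTheorem7 :
    (∀ (n : ℕ), 3 ≤ n → ∀ V W : RSpace n → ℝ,
      IsEulerDeriv V W → RepulsiveForm V W → SobolevFormBound V W →
        UniformResolventEstimate V (fun x => ‖x‖⁻¹)) ∧
    (∀ V W : RSpace 2 → ℝ,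
      InClassXTwo V W → RepulsivePointwise V W →
        UniformResolventEstimate V (fun x => √(V x))) :=
  ⟨fun _ hn _ _ hE hR hS => (FormSetup.of_repulsiveForm hn hE hR hS).uniformResolventEstimate,
    fun _ _ hX hR => (FormSetup.of_repulsivePointwise hX hR).uniformResolventEstimate⟩
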